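/- For oriented links $\ell\subset S^3$ (up to isotopy) let $\nabla_\ell(z)\in\mathbb Z[z]$ be the Alexander–Conway polynomial, i.e. the unique invariant of oriented links with $\nabla_{\text{unknot}}=1$ and $\nabla_{\ell_+}-\nabla_{\ell_-}=z\,\nabla_{\ell_0}$ for all links $\ell_+,\ell_-,\ell_0$ that differ only inside a ball as a positive crossing, a negative crossing, and its oriented smoothing. (Such an invariant exists and is unique; the value on the empty link is $0$ by convention.) Let $n\ge 1$ and let $t$ be an oriented $2n$-tangle: $n$ disjoint oriented arcs and finitely many oriented circles properly embedded in the $3$-ball, up to isotopy fixing the boundary, represented by diagrams in a disk up to Reidemeister moves. The tangle $t$ embeds in an oriented link $\ell$ if some diagram of $t$ extends to a diagram of $\ell$. For a diagram $h$ in the complementary disk whose ends match those of $t$, let $t^h$ be the link obtained by joining corresponding ends of $t$ and $h$ without further crossings. There are $n!$ bijections $\sigma$ from the $n$ ends at which strands leave $t$ to the $n$ ends at which strands enter $t$. For every $\sigma$ there is a diagram $h$ without closed components which joins the ends as prescribed by $\sigma$ and has the fewest crossings among all diagrams that join the ends in this way. Choose any such diagram $h_\sigma$ for every $\sigma$. If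 $t$ embeds in $\ell$, then $\nabla_\ell(z)$ lies in the ideal of $\mathbb Z[z^{\pm1}]$ generated by the $n!$ polynomials $\nabla_{t^{h_\sigma}}(z)$. In particular, if $t$ is a $4$-tangle ($n=2$), then $\nabla_\ell(z)$ lies in the ideal generated by the Alexander–Conway polynomials of the two closures of $t$ that use the fewest possible crossings, one for each of the two ways to join its ends. -/

import Mathlib

/-!
# Oriented tangle and link diagrams, and the Alexander-Conway polynomial

A generic diagram in a horizontal strip of the plane is cut by horizontal lines into slices, each of
which holds one local minimum (a cup), one local maximum (a cap) or one crossing, all other strands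
being vertical.  A diagram is the list of its slices, read from bottom to top.  A horizontal level
is the list of the directions of the strands that meet it, from left to right: `true` is a strand
pointing up and `false` a strand pointing down.

Tangles and links are classes of diagrams under planar isotopy and Reidemeister moves.
-/

namespace PlanarTangle

/-- The non-vertical part of a slice.
`cup a` creates two strands, of directions `a` (left) and `!a` (right);
`cap` joins two neighbouring strands of opposite directions;
`cross s` is a crossing of two neighbouring strands, in which the strand that runs from the lower
left to the upper right is the overcrossing strand if `s = true` and the undercrossing one if
`s = false`. -/
inductive Piece : Type
  | cup (a : Bool)
  | cap
  | cross (s : Bool)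

/-- The number of strand ends of a piece on its lower side. -/
def Piece.lower : Piece → ℕ
  | .cup _ => 0
  | .cap => 2
  | .cross _ => 2

/-- The number of strand ends of a piece on its upper side. -/
def Piece.upper : Piece → ℕ
  | .cup _ => 2
  | .cap => 0
  | .cross _ => 2

/-- A slice: a piece together with the number of vertical strands to its left. -/
abbrev Slice : Type := ℕ × Piece

/-- `Step g x y`: the slice `g` fits between the level `x` below it and the level `y` above it. -/
inductive Step : Slice → List Bool → List Bool → Prop
  | cup (l r : List Bool) (a : Bool) : Step (l.length, .cup a) (l ++ r) (l ++ a :: (!a) :: r)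
  | cap (l r : List Bool) (a : Bool) : Step (l.length, .cap) (l ++ a :: (!a) :: r) (l ++ r)
  | cross (l r : List Bool) (a b s : Bool) :
      Step (l.length, .cross s) (l ++ a :: b :: r) (l ++ b :: a :: r)

/-- `Runs w x y`: the slices in `w` fit together to a diagram with lower boundary `x` and upper
boundary `y`. -/
inductive Runs : List Slice → List Bool → List Bool → Prop
  | nil (x : List Bool) : Runs [] x x
  | cons {g : Slice} {w : List Slice} {x y z : List Bool} :
      Step g x y → Runs w y z → Runs (g :: w) x z

theorem Runs.append {v w : List Slice} {x y z : List Bool} (hv : Runs v x y) (hw : Runs w y z) :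
    Runs (v ++ w) x z := by
  induction hv with
  | nil x => exact hw
  | cons h _ ih => exact Runs.cons h (ih hw)

/-- Oriented diagrams with lower boundary `x` and upper boundary `y`. -/
def Diagram (x y : List Bool) : Type := {w : List Slice // Runs w x y}

/-- Stacking of diagrams: `H` is placed on top of `T`. -/
def Diagram.comp {x y z : List Bool} (T : Diagram x y) (H : Diagram y z) : Diagram x z :=
  ⟨T.1 ++ H.1, T.2.append H.2⟩

/-- The elementary local moves.  The first five are the planar isotopies of sliced diagrams, the
others are the Reidemeister moves of type I, II and III. -/
inductive Move : List Slice → List Slice → Prop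
  /-- Two pieces that lie side by side exchange their heights. -/
  | interchange (i k : ℕ) (p q : Piece) :
      Move [(i, p), (i + p.upper + k, q)] [(i + p.lower + k, q), (i, p)]
  | zigzagLeft (i : ℕ) (a : Bool) : Move [(i + 1, .cup a), (i, .cap)] []
  | zigzagRight (i : ℕ) (a : Bool) : Move [(i, .cup a), (i + 1, .cap)] []
  /-- A crossing slides from the left leg of a local maximum to its right leg. -/
  | slideCap (i : ℕ) (s : Bool) :
      Move [(i, .cross s), (i + 1, .cap)] [(i + 1, .cross (!s)), (i, .cap)]
  /-- A crossing slides from the left leg of a local minimum to its right leg. -/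
  | slideCup (i : ℕ) (a s : Bool) :
      Move [(i + 1, .cup a), (i, .cross s)] [(i, .cup a), (i + 1, .cross (!s))]
  | reidemeisterOneCap (i : ℕ) (s : Bool) : Move [(i, .cross s), (i, .cap)] [(i, .cap)]
  | reidemeisterOneCup (i : ℕ) (a s : Bool) :
      Move [(i, .cup a), (i, .cross s)] [(i, .cup (!a))]
  | reidemeisterTwo (i : ℕ) (s : Bool) : Move [(i, .cross s), (i, .cross (!s))] []
  /-- The condition on `a`, `b`, `c` says that the three strands lie at three different heights. -/
  | reidemeisterThree (i : ℕ) (a b c : Bool) (h : a = b ∨ b = c) :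
      Move [(i, .cross a), (i + 1, .cross b), (i, .cross c)]
        [(i + 1, .cross c), (i, .cross b), (i + 1, .cross a)]

/-- Two diagrams differ by one elementary move. -/
def OneMove {x y : List Bool} (D E : Diagram x y) : Prop :=
  ∃ u m m' v : List Slice, Move m m' ∧ D.1 = u ++ m ++ v ∧ E.1 = u ++ m' ++ v

/-- Equivalence of diagrams under planar isotopies and Reidemeister moves. -/
def diagramSetoid (x y : List Bool) : Setoid (Diagram x y) := Relation.EqvGen.setoid OneMove

/-- Oriented tangles in a strip, with lower ends `x` and upper ends `y`.  An oriented tangle in the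
ball is a `Tangle [] ε`: the boundary circle of the disk that carries its diagram is cut open at a
base point, so that all of its ends, of directions `ε`, lie on the upper side. -/
def Tangle (x y : List Bool) : Type := Quotient (diagramSetoid x y)

/-- The tangle of a diagram. -/
def Diagram.toTangle {x y : List Bool} (D : Diagram x y) : Tangle x y :=
  Quotient.mk (diagramSetoid x y) D

/-- Oriented links in the three-sphere. -/
abbrev OrientedLink : Type := Tangle [] []

theorem eqvGen_comp {x y z : List Bool} (H : Diagram y z) {D E : Diagram x y}
    (h : Relation.EqvGen OneMove D E) : Relation.EqvGen OneMove (D.comp H) (E.comp H) := by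
  induction h with
  | rel D E h =>
    obtain ⟨u, m, m', v, hm, hD, hE⟩ := h
    refine .rel _ _ ⟨u, m, m', v ++ H.1, hm, ?_, ?_⟩
    · simp [Diagram.comp, hD]
    · simp [Diagram.comp, hE]
  | refl D => exact .refl _
  | symm D E _ ih => exact .symm _ _ ih
  | trans D E F _ _ ih₁ ih₂ => exact .trans _ _ _ ih₁ ih₂

/-- The closure of the tangle `t` by the diagram `H`: corresponding ends are joined without further
crossings. -/
def Tangle.close {x y z : List Bool} (t : Tangle x y) (H : Diagram y z) : Tangle x z :=
  Quotient.map' (s₁ := diagramSetoid x y) (s₂ := diagramSetoid x z)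
    (fun T => T.comp H) (fun _ _ h => eqvGen_comp H h) t

/-- The slices of a diagram, drawn with `k` more strands to the left. -/
def shift (k : ℕ) (w : List Slice) : List Slice := w.map fun g => (g.1 + k, g.2)

/-- A tangle embeds in a link if some diagram of the tangle extends to a diagram of the link.  The
diagram of the tangle may sit anywhere in the diagram of the link. -/
def Tangle.Embeds {ε : List Bool} (t : Tangle [] ε) (ℓ : OrientedLink) : Prop :=
  ∃ (T : Diagram [] ε) (L : Diagram [] []) (k : ℕ) (u v : List Slice),
    T.toTangle = t ∧ L.toTangle = ℓ ∧ L.1 = u ++ shift k T.1 ++ v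

/-! ### The Alexander-Conway polynomial -/

/-- The empty diagram. -/
def emptyDiagram : Diagram [] [] := ⟨[], Runs.nil []⟩

/-- The round circle. -/
def circleDiagram : Diagram [] [] :=
  ⟨[(0, .cup true), (0, .cap)],
    Runs.cons (Step.cup [] [] true) (Runs.cons (Step.cap [] [] true) (Runs.nil []))⟩

/-- `P`, `N` and `Z` agree outside a disk in which there are two strands pointing up: they form a
positive crossing in `P`, a negative crossing in `N`, and do not cross in `Z`. -/
def IsSkeinTriple (P N Z : Diagram [] []) : Prop :=
  ∃ (u v : List Slice) (l r : List Bool), Runs u [] (l ++ true :: true :: r) ∧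
    P.1 = u ++ (l.length, .cross true) :: v ∧
    N.1 = u ++ (l.length, .cross false) :: v ∧
    Z.1 = u ++ v

/-- The characterization of the Alexander-Conway polynomial, as an invariant of oriented links: it
is `1` on the trivial knot and satisfies the skein relation.  The skein relation says nothing about
the empty link, to which the value `0` is assigned by convention. -/
structure IsAlexanderConway (f : OrientedLink → Polynomial ℤ) : Prop where
  empty : f emptyDiagram.toTangle = 0
  circle : f circleDiagram.toTangle = 1
  skein : ∀ P N Z : Diagram [] [], IsSkeinTriple P N Z →
    f P.toTangle - f N.toTangle = Polynomial.X * f Z.toTangle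

/-- The Alexander-Conway polynomial, in `ℤ[z]`. -/
noncomputable def alexanderConway : OrientedLink → Polynomial ℤ :=
  Classical.epsilon IsAlexanderConway

/-- The Alexander-Conway polynomial as an element of `ℤ[z, z⁻¹]`. -/
noncomputable def nabla (ℓ : OrientedLink) : LaurentPolynomial ℤ :=
  Polynomial.toLaurent (alexanderConway ℓ)

/-! ### Closures with fewest crossings -/

/-- The number of crossings. -/
def crossings : List Slice → ℕ
  | [] => 0
  | (_, .cross _) :: w => crossings w + 1
  | (_, .cup _) :: w => crossings w
  | (_, .cap) :: w => crossings w

/-- Positions of old strands after two strands have been inserted at `i` and `i + 1`. -/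
def insertTwo (i j : ℕ) : ℕ := if j < i then j else j + 2

/-- Positions of the other strands after the strands `i` and `i + 1` have been removed. -/
def removeTwo (i j : ℕ) : ℕ := if j < i then j else j - 2

/-- For a diagram `w` with empty upper boundary, `partner w j` is the position of the lower end at
which the strand through the lower end at position `j` ends. -/
def partner : List Slice → ℕ → ℕ
  | [], j => j
  | (i, .cap) :: w, j =>
      if j = i then i + 1 else if j = i + 1 then i else
        insertTwo i (partner w (removeTwo i j))
  | (i, .cross _) :: w, j => Equiv.swap i (i + 1) (partner w (Equiv.swap i (i + 1) j))
  | (i, .cup _) :: w, j =>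
      let p := partner w (insertTwo i j)
      removeTwo i (if p = i then partner w (i + 1) else if p = i + 1 then partner w i else p)

/-- The number of closed components of a diagram with empty upper boundary. -/
def loops : List Slice → ℕ
  | [] => 0
  | (i, .cup _) :: w => loops w + if partner w i = i + 1 then 1 else 0
  | (_, .cap) :: w => loops w
  | (_, .cross _) :: w => loops w

/-- The ways to connect the ends of a diagram with lower boundary `ε` and empty upper boundary:
a bijection from the ends at which strands enter it to the ends at which strands leave it. -/
abbrev EndPairing (ε : List Bool) : Type :=
  {i : Fin ε.length // ε.get i = true} ≃ {i : Fin ε.length // ε.get i = false}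

/-- The strands of `H` connect the ends as `σ` prescribes. -/
def Connects {ε : List Bool} (σ : EndPairing ε) (H : Diagram ε []) : Prop :=
  ∀ i, partner H.1 (i.1 : ℕ) = ((σ i).1 : ℕ)

/-- `H` connects the ends as `σ` prescribes, with fewest possible crossings and without closed
components. -/
structure IsMinimalClosure {ε : List Bool} (σ : EndPairing ε) (H : Diagram ε []) : Prop where
  connects : Connects σ H
  noLoops : loops H.1 = 0
  minimal : ∀ H' : Diagram ε [], Connects σ H' → crossings H.1 ≤ crossings H'.1

end PlanarTangle

namespace PlanarTangle

/-! ### Slices as partial functions on levels -/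

/-! Every link in which `t` embeds is a closure of `t`: the strands that run to the left of `t` can
be moved across it by a strand passing over everything, and `t` can then be slid to the bottom of
the diagram (`Tangle.Embeds.exists_close`). It remains to treat the closure of a diagram `T` by an
arbitrary diagram `H` (`alexanderConway_mem_span`), by induction on the number of crossings of `H`.
At a crossing of `H` the skein relation compares the closure with the one after a crossing change.
The third term has fewer crossings in `H`, so it lies in the ideal by induction, and membership in
the ideal is insensitive to crossing changes in `H`.

If `H` has no closed component, then `H` and the chosen diagram with the same pairing of ends become
isotopic after crossing changes in both of them (`exists_iso_of_partner_eq`). The chosen diagram has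
at most as many crossings as `H`, so the induction hypothesis also covers the crossing changes in
it. If `H` has a closed component, crossing changes split off a circle (`exists_iso_circle`), and
the polynomial vanishes because a split circle is the smoothing of a kink (`skein_circle`). The
geometric core of both cases is `exists_pulls`: after crossing changes a given strand lies on top
and can be pulled off the rest.

The Alexander-Conway polynomial is also constructed. The same moves resolve every nonempty link by
skein relations into round circles (`hasResolution`), which gives uniqueness. Existence needs that
two resolutions of one link give the same polynomial (`Resolves.unique`). For this a vertex model
with labels in `Fin N` is used; its state sum is a link invariant `L` with `q ^ N * L₊ - q ^ (-N) *
L₋ = (q - q⁻¹) * L₀`. The Conway relation is formally the case `N = 0`, and this case is imitated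
over the dual numbers: for `q = ζ (1 + ε)` with `ζ ^ N = 1`, the value of the circle is a nonzero
multiple of `ε`, on which `q ^ N` acts as `1`. The state sum of a link with resolution value `p` is
then the value of the circle times `p (ζ - ζ⁻¹)`. Infinitely many values `ζ - ζ⁻¹` determine `p`.

At `q = 1` with two labels, the state sum counts the labellings that are constant along strands.
This shows that the pairing of the ends and the number of closed components are invariant under the
moves (`Iso.matched_loops`). -/

/-- The level above a slice, as a function of the level below it. -/
def stepAt : ℕ → Piece → List Bool → Option (List Bool)
  | 0, .cup a, r => some (a :: (!a) :: r)
  | 0, .cap, a :: b :: r => if b = !a then some r else none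
  | 0, .cross _, a :: b :: r => some (b :: a :: r)
  | 0, .cap, _ => none
  | 0, .cross _, _ => none
  | _ + 1, _, [] => none
  | i + 1, p, a :: x => (stepAt i p x).map (a :: ·)

/-- The upper boundary of a diagram, as a function of its lower boundary. -/
def run : List Slice → List Bool → Option (List Bool)
  | [], x => some x
  | g :: w, x => (stepAt g.1 g.2 x).bind (run w)

theorem step_cons {i : ℕ} {p : Piece} {x y : List Bool} (b : Bool) (h : Step (i, p) x y) :
    Step (i + 1, p) (b :: x) (b :: y) := by
  generalize hg : (i, p) = g at h
  cases h with
  | cup l r a => cases hg; exact Step.cup (b :: l) r a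
  | cap l r a => cases hg; exact Step.cap (b :: l) r a
  | cross l r a c s => cases hg; exact Step.cross (b :: l) r a c s

theorem step_iff (i : ℕ) (p : Piece) (x y : List Bool) :
    Step (i, p) x y ↔ stepAt i p x = some y := by
  constructor
  · intro h
    generalize hg : (i, p) = g at h
    cases h with
    | cup l r a =>
      cases hg
      induction l with
      | nil => rfl
      | cons b l ih => simp [stepAt, ih]
    | cap l r a =>
      cases hg
      induction l with
      | nil => simp [stepAt]
      | cons b l ih => simp [stepAt, ih]
    | cross l r a c s =>
      cases hg
      induction l with
      | nil => rfl
      | cons b l ih => simp [stepAt, ih]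
  · induction i generalizing x y with
    | zero =>
      intro h
      cases p with
      | cup a =>
        simp only [stepAt, Option.some.injEq] at h
        subst h; exact Step.cup [] x a
      | cap =>
        match x, h with
        | a :: b :: r, h =>
          simp only [stepAt, Option.ite_none_right_eq_some, Option.some.injEq] at h
          obtain ⟨rfl, rfl⟩ := h
          exact Step.cap [] r a
        | [], h => simp [stepAt] at h
        | [_], h => simp [stepAt] at h
      | cross s =>
        match x, h with
        | a :: b :: r, h =>
          simp only [stepAt, Option.some.injEq] at h
          subst h
          exact Step.cross [] r a b s
        | [], h => simp [stepAt] at h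
        | [_], h => simp [stepAt] at h
    | succ i ih =>
      intro h
      match x, h with
      | [], h => simp [stepAt] at h
      | b :: x, h =>
        simp only [stepAt, Option.map_eq_some_iff] at h
        obtain ⟨z, hz, rfl⟩ := h
        exact step_cons b (ih _ _ hz)

theorem runs_iff (w : List Slice) (x y : List Bool) : Runs w x y ↔ run w x = some y := by
  constructor
  · intro h
    induction h with
    | nil x => rfl
    | cons hg _ ih => simp [run, (step_iff _ _ _ _).1 hg, ih]
  · induction w generalizing x with
    | nil => intro h; simp only [run, Option.some.injEq] at h; subst h; exact Runs.nil _
    | cons g w ih =>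
      intro h
      simp only [run, Option.bind_eq_some_iff] at h
      obtain ⟨z, hz, h⟩ := h
      exact Runs.cons ((step_iff _ _ _ _).2 hz) (ih _ h)

theorem run_append (v w : List Slice) (x : List Bool) :
    run (v ++ w) x = (run v x).bind (run w) := by
  induction v generalizing x with
  | nil => simp [run]
  | cons g v ih =>
    simp only [List.cons_append, run, Option.bind_assoc]
    congr 1; funext z; exact ih z

theorem runs_append_iff (v w : List Slice) (x z : List Bool) :
    Runs (v ++ w) x z ↔ ∃ y, Runs v x y ∧ Runs w y z := by
  simp [runs_iff, run_append, Option.bind_eq_some_iff]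

theorem runs_cons_iff (g : Slice) (w : List Slice) (x z : List Bool) :
    Runs (g :: w) x z ↔ ∃ y, Step g x y ∧ Runs w y z := by
  obtain ⟨i, p⟩ := g
  simp [runs_iff, step_iff, run, Option.bind_eq_some_iff]

/-- An extra strand on the left is inert. By iteration, every local identity reduces to the one at
position `0`. -/
theorem run_shift_one (w : List Slice) (a : Bool) (x : List Bool) :
    run (shift 1 w) (a :: x) = (run w x).map (a :: ·) := by
  induction w generalizing x with
  | nil => rfl
  | cons g w ih =>
    simp only [shift, List.map_cons, run, stepAt, Option.bind_map] at ih ⊢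
    cases h : stepAt g.1 g.2 x with
    | none => rfl
    | some y => simpa using ih y

/-- Every level on which `m` runs is one on which `m'` runs, with the same result. -/
def RunsTo (m m' : List Slice) : Prop := ∀ x y, run m x = some y → run m' x = some y

/-- Nonemptiness matters on the empty level: the empty word runs there, but a shifted nonempty word
does not. For nonempty `m`, the shifted word runs only on levels that have a leftmost strand to set
aside. -/
theorem RunsTo.shift_one {m m' : List Slice} (h : RunsTo m m') (hm : m ≠ []) :
    RunsTo (shift 1 m) (shift 1 m') := by
  intro x y hx
  match x with
  | [] =>
    obtain ⟨g, w, rfl⟩ := List.exists_cons_of_ne_nil hm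
    simp [shift, run, stepAt] at hx
  | a :: x =>
    rw [run_shift_one, Option.map_eq_some_iff] at hx ⊢
    obtain ⟨z, hz, rfl⟩ := hx
    exact ⟨z, h _ _ hz, rfl⟩

theorem stepAt_length_le {i : ℕ} {p : Piece} {x y : List Bool} (h : stepAt i p x = some y) :
    i + p.lower ≤ x.length ∧ x.length + p.upper = y.length + p.lower := by
  rw [← step_iff] at h
  generalize hg : (i, p) = g at h
  cases h <;> cases hg <;> simp [Piece.lower, Piece.upper] <;> omega

theorem interchange_zero (k : ℕ) (p q : Piece) (x : List Bool) :
    run [(0, p), (0 + p.upper + k, q)] x = run [(0 + p.lower + k, q), (0, p)] x := by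
  cases p with
  | cup a =>
    simp only [run, Piece.upper, Piece.lower, Nat.add_comm (0 + 2), stepAt,
      Option.bind_some, Nat.add_zero, Nat.zero_add]
    cases stepAt k q x <;> simp
  | cap =>
    simp only [run, Piece.upper, Piece.lower, Nat.add_comm (0 + 2), Nat.add_zero, Nat.zero_add]
    match x with
    | [] => simp [stepAt]
    | [_] => simp [stepAt]
    | a :: b :: r =>
      simp only [stepAt]
      by_cases hb : b = !a <;> cases hk : stepAt k q r <;> simp [stepAt, hb, hk]
  | cross s =>
    simp only [run, Piece.upper, Piece.lower, Nat.add_comm (0 + 2), Nat.zero_add]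
    match x with
    | [] => simp [stepAt]
    | [_] => simp [stepAt]
    | a :: b :: r =>
      simp only [stepAt]
      cases h : stepAt k q r <;> simp [stepAt, h]

theorem shift_shift (a b : ℕ) (w : List Slice) : shift a (shift b w) = shift (b + a) w := by
  simp [shift, Function.comp_def, Nat.add_assoc]

theorem shift_zero (w : List Slice) : shift 0 w = w := by simp [shift]

@[simp] theorem shift_nil (k : ℕ) : shift k [] = [] := rfl

@[simp] theorem shift_cons (k : ℕ) (g : Slice) (w : List Slice) :
    shift k (g :: w) = (g.1 + k, g.2) :: shift k w := rfl

@[simp] theorem shift_append (k : ℕ) (v w : List Slice) :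
    shift k (v ++ w) = shift k v ++ shift k w := by simp [shift]

theorem RunsTo.shift {m m' : List Slice} (h : RunsTo m m') (hm : m ≠ []) (i : ℕ) :
    RunsTo (shift i m) (shift i m') := by
  induction i with
  | zero => simpa only [shift_zero]
  | succ i ih =>
    rw [← shift_shift, ← shift_shift]
    exact ih.shift_one (by simpa [PlanarTangle.shift] using hm)

theorem RunsTo.interchange (i k : ℕ) (p q : Piece) :
    RunsTo [(i, p), (i + p.upper + k, q)] [(i + p.lower + k, q), (i, p)] := by
  have := RunsTo.shift (m := [(0, p), (0 + p.upper + k, q)])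
    (fun x y h => by rwa [interchange_zero] at h) (by simp) i
  simpa [Nat.add_comm, Nat.add_left_comm] using this

theorem RunsTo.interchange_symm (i k : ℕ) (p q : Piece) :
    RunsTo [(i + p.lower + k, q), (i, p)] [(i, p), (i + p.upper + k, q)] := by
  have := RunsTo.shift (m := [(0 + p.lower + k, q), (0, p)])
    (fun x y h => by rwa [← interchange_zero] at h) (by simp) i
  simpa [Nat.add_comm, Nat.add_left_comm] using this

/-- Both diagrams run on the same levels, with the same results. -/
theorem RunsTo.of_eq_zero {m m' : List Slice} (h : ∀ x, run m x = run m' x) (hm : m ≠ [])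
    (hm' : m' ≠ []) (i : ℕ) : RunsTo (PlanarTangle.shift i m) (PlanarTangle.shift i m') ∧
      RunsTo (PlanarTangle.shift i m') (PlanarTangle.shift i m) :=
  ⟨RunsTo.shift (fun x y hx => by rwa [← h]) hm i,
    RunsTo.shift (fun x y hx => by rwa [h]) hm' i⟩

theorem run_slideCap (s t : Bool) (x : List Bool) :
    run [(0, .cross s), (1, .cap)] x = run [(1, .cross t), (0, .cap)] x := by
  match x with
  | [] => simp [run, stepAt]
  | [_] => simp [run, stepAt]
  | [_, _] => simp [run, stepAt]
  | a :: b :: c :: r => simp [run, stepAt]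

theorem run_slideCup (a s t : Bool) (x : List Bool) :
    run [(1, .cup a), (0, .cross s)] x = run [(0, .cup a), (1, .cross t)] x := by
  match x with
  | [] => simp [run, stepAt]
  | a :: r => simp [run, stepAt]

theorem run_reidemeisterOneCap (s : Bool) (x : List Bool) :
    run [(0, .cross s), (0, .cap)] x = run [(0, .cap)] x := by
  match x with
  | [] => simp [run, stepAt]
  | [_] => simp [run, stepAt]
  | a :: b :: r => cases a <;> cases b <;> simp [run, stepAt]

theorem run_reidemeisterOneCup (a s : Bool) (x : List Bool) :
    run [(0, .cup a), (0, .cross s)] x = run [(0, .cup (!a))] x := by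
  simp [run, stepAt]

theorem run_reidemeisterThree (a b c a' b' c' : Bool) (x : List Bool) :
    run [(0, .cross a), (1, .cross b), (0, .cross c)] x =
      run [(1, .cross c'), (0, .cross b'), (1, .cross a')] x := by
  match x with
  | [] => simp [run, stepAt]
  | [_] => simp [run, stepAt]
  | [_, _] => simp [run, stepAt]
  | a :: b :: c :: r => simp [run, stepAt]

theorem runsTo_zigzagLeft (i : ℕ) (a : Bool) : RunsTo [(i + 1, .cup a), (i, .cap)] [] := by
  have := RunsTo.shift (m := [(1, .cup a), (0, .cap)]) (m' := []) ?_ (by simp) i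
  · simpa [Nat.add_comm] using this
  · intro x y
    match x with
    | [] => simp [run, stepAt]
    | b :: r => cases a <;> cases b <;> simp [run, stepAt]

theorem runsTo_zigzagRight (i : ℕ) (a : Bool) : RunsTo [(i, .cup a), (i + 1, .cap)] [] := by
  have := RunsTo.shift (m := [(0, .cup a), (1, .cap)]) (m' := []) ?_ (by simp) i
  · simpa [Nat.add_comm] using this
  · intro x y
    match x with
    | [] => simp [run, stepAt]
    | b :: r => cases a <;> cases b <;> simp [run, stepAt]

theorem runsTo_reidemeisterTwo (i : ℕ) (s t : Bool) :
    RunsTo [(i, .cross s), (i, .cross t)] [] := by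
  have := RunsTo.shift (m := [(0, .cross s), (0, .cross t)]) (m' := []) ?_ (by simp) i
  · simpa using this
  · intro x y
    match x with
    | [] => simp [run, stepAt]
    | [_] => simp [run, stepAt]
    | a :: b :: r => simp [run, stepAt]

theorem Move.runsTo {m m' : List Slice} (h : Move m m') : RunsTo m m' := by
  cases h with
  | interchange i k p q => exact .interchange i k p q
  | zigzagLeft i a => exact runsTo_zigzagLeft i a
  | zigzagRight i a => exact runsTo_zigzagRight i a
  | slideCap i s => simpa [Nat.add_comm] using
      (RunsTo.of_eq_zero (run_slideCap s !s) (by simp) (by simp) i).1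
  | slideCup i a s => simpa [Nat.add_comm] using
      (RunsTo.of_eq_zero (run_slideCup a s !s) (by simp) (by simp) i).1
  | reidemeisterOneCap i s => simpa using
      (RunsTo.of_eq_zero (run_reidemeisterOneCap s) (by simp) (by simp) i).1
  | reidemeisterOneCup i a s => simpa using
      (RunsTo.of_eq_zero (run_reidemeisterOneCup a s) (by simp) (by simp) i).1
  | reidemeisterTwo i s => exact runsTo_reidemeisterTwo i s _
  | reidemeisterThree i a b c h => simpa [Nat.add_comm] using
      (RunsTo.of_eq_zero (run_reidemeisterThree a b c a b c) (by simp) (by simp) i).1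

/-- The empty word runs on every level, whereas a zigzag or a pair of crossings needs strands at its
position and, for a zigzag, of the right direction. This is why an empty right side is excluded. -/
theorem Move.runsTo_symm {m m' : List Slice} (h : Move m m') (hm : m' ≠ []) : RunsTo m' m := by
  cases h with
  | interchange i k p q => exact .interchange_symm i k p q
  | zigzagLeft i a => exact absurd rfl hm
  | zigzagRight i a => exact absurd rfl hm
  | slideCap i s => simpa [Nat.add_comm] using
      (RunsTo.of_eq_zero (run_slideCap s !s) (by simp) (by simp) i).2
  | slideCup i a s => simpa [Nat.add_comm] using
      (RunsTo.of_eq_zero (run_slideCup a s !s) (by simp) (by simp) i).2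
  | reidemeisterOneCap i s => simpa using
      (RunsTo.of_eq_zero (run_reidemeisterOneCap s) (by simp) (by simp) i).2
  | reidemeisterOneCup i a s => simpa using
      (RunsTo.of_eq_zero (run_reidemeisterOneCup a s) (by simp) (by simp) i).2
  | reidemeisterTwo i s => exact absurd rfl hm
  | reidemeisterThree i a b c h => simpa [Nat.add_comm] using
      (RunsTo.of_eq_zero (run_reidemeisterThree a b c a b c) (by simp) (by simp) i).2

/-! ### Isotopy of words -/

/-- `w` and `w'` are equivalent diagrams with boundary levels `x` and `y`. -/
def Iso (x y : List Bool) (w w' : List Slice) : Prop :=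
  ∃ (h : Runs w x y) (h' : Runs w' x y),
    Relation.EqvGen OneMove (⟨w, h⟩ : Diagram x y) ⟨w', h'⟩

theorem Iso.refl {x y : List Bool} {w : List Slice} (h : Runs w x y) : Iso x y w w :=
  ⟨h, h, .refl _⟩

theorem Iso.symm {x y : List Bool} {w w' : List Slice} (h : Iso x y w w') : Iso x y w' w :=
  let ⟨a, b, c⟩ := h; ⟨b, a, c.symm⟩

theorem Iso.trans {x y : List Bool} {w w' w'' : List Slice} (h : Iso x y w w')
    (h' : Iso x y w' w'') : Iso x y w w'' :=
  let ⟨a, _, c⟩ := h; let ⟨_, b', c'⟩ := h'; ⟨a, b', c.trans _ _ _ c'⟩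

theorem Iso.append {x y z : List Bool} {v v' w w' : List Slice} (h : Iso x y v v')
    (h' : Iso y z w w') : Iso x z (v ++ w) (v' ++ w') := by
  obtain ⟨a, b, c⟩ := h
  obtain ⟨a', b', c'⟩ := h'
  refine ⟨a.append a', b.append b', ?_⟩
  refine .trans _ (Diagram.comp ⟨v', b⟩ ⟨w, a'⟩) _ (eqvGen_comp ⟨w, a'⟩ c) ?_
  suffices H : ∀ D E : Diagram y z, Relation.EqvGen OneMove D E →
      Relation.EqvGen OneMove (Diagram.comp ⟨v', b⟩ D) (Diagram.comp ⟨v', b⟩ E) from H _ _ c'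
  intro D E h
  induction h with
  | rel D E h =>
    obtain ⟨u, m, m', v, hm, hD, hE⟩ := h
    exact .rel _ _ ⟨v' ++ u, m, m', v, hm, by simp [Diagram.comp, hD], by simp [Diagram.comp, hE]⟩
  | refl D => exact .refl _
  | symm D E _ ih => exact .symm _ _ ih
  | trans D E F _ _ ih₁ ih₂ => exact .trans _ _ _ ih₁ ih₂

theorem Iso.toTangle_eq {x y : List Bool} {D E : Diagram x y} (h : Iso x y D.1 E.1) :
    D.toTangle = E.toTangle :=
  let ⟨_, _, c⟩ := h; Quotient.sound (s := diagramSetoid x y) c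

theorem iso_of_toTangle_eq {x y : List Bool} {D E : Diagram x y}
    (h : D.toTangle = E.toTangle) : Iso x y D.1 E.1 :=
  ⟨D.2, E.2, Quotient.exact (s := diagramSetoid x y) h⟩

/-- Wherever `w` is a diagram, so is `w'`, and the two are equivalent. -/
def Red (w w' : List Slice) : Prop := ∀ x y, Runs w x y → Iso x y w w'

theorem Red.refl (w : List Slice) : Red w w := fun _ _ h => .refl h

theorem Red.of_eq {w w' : List Slice} (h : w = w') : Red w w' := h ▸ .refl w

theorem Red.trans {w w' w'' : List Slice} (h : Red w w') (h' : Red w' w'') : Red w w'' :=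
  fun x y hw => (h x y hw).trans (h' x y (h x y hw).2.1)

theorem Red.append {v v' w w' : List Slice} (h : Red v v') (h' : Red w w') :
    Red (v ++ w) (v' ++ w') := by
  intro x z hw
  obtain ⟨y, h1, h2⟩ := (runs_append_iff _ _ _ _).1 hw
  exact (h _ _ h1).append (h' _ _ h2)

theorem Red.congr {m m' : List Slice} (u v : List Slice) (h : Red m m') :
    Red (u ++ (m ++ v)) (u ++ (m' ++ v)) := (Red.refl u).append (h.append (.refl v))

theorem Red.append_left {m m' : List Slice} (u : List Slice) (h : Red m m') :
    Red (u ++ m) (u ++ m') := (Red.refl u).append h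

theorem Red.append_right {m m' : List Slice} (v : List Slice) (h : Red m m') :
    Red (m ++ v) (m' ++ v) := h.append (.refl v)

theorem Red.cons {m m' : List Slice} (g : Slice) (h : Red m m') : Red (g :: m) (g :: m') :=
  h.append_left [g]

/-- `Red` is a one-way relation so that moves which erase everything can be used without information
about the boundary levels: the level on which the left side runs supplies it. -/
theorem Move.red {m m' : List Slice} (h : Move m m') : Red m m' := fun x y hm =>
  ⟨hm, (runs_iff _ _ _).2 (h.runsTo x y ((runs_iff _ _ _).1 hm)),
    .rel _ _ ⟨[], m, m', [], h, by simp, by simp⟩⟩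

theorem Move.red_symm {m m' : List Slice} (h : Move m m') (hm : m' ≠ []) : Red m' m :=
  fun x y hm' => Iso.symm
    ⟨(runs_iff _ _ _).2 (h.runsTo_symm hm x y ((runs_iff _ _ _).1 hm')), hm',
      .rel _ _ ⟨[], m, m', [], h, by simp, by simp⟩⟩

/-- Two slices side by side, the lower one on the left. -/
theorem red_interchange {i j : ℕ} {p q : Piece} (j' : ℕ) (h : i + p.upper ≤ j)
    (h' : j' + p.upper = j + p.lower) : Red [(i, p), (j, q)] [(j', q), (i, p)] := by
  obtain ⟨k, rfl⟩ := Nat.exists_eq_add_of_le h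
  obtain rfl : j' = i + p.lower + k := by omega
  exact (Move.interchange i k p q).red

/-- Two slices side by side, the lower one on the right. -/
theorem red_interchange' {i j : ℕ} {p q : Piece} (j' : ℕ) (h : i + p.lower ≤ j)
    (h' : j' + p.lower = j + p.upper) : Red [(j, q), (i, p)] [(i, p), (j', q)] := by
  obtain ⟨k, rfl⟩ := Nat.exists_eq_add_of_le h
  obtain rfl : j' = i + p.upper + k := by omega
  exact (Move.interchange i k p q).red_symm (by simp)

theorem red_slideCap (i : ℕ) (s : Bool) :
    Red [(i, .cross s), (i + 1, .cap)] [(i + 1, .cross (!s)), (i, .cap)] :=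
  (Move.slideCap i s).red

theorem red_slideCap' (i : ℕ) (s : Bool) :
    Red [(i + 1, .cross s), (i, .cap)] [(i, .cross (!s)), (i + 1, .cap)] := by
  simpa using (Move.slideCap i (!s)).red_symm (by simp)

theorem red_slideCup (i : ℕ) (a s : Bool) :
    Red [(i + 1, .cup a), (i, .cross s)] [(i, .cup a), (i + 1, .cross (!s))] :=
  (Move.slideCup i a s).red

theorem red_capTwist (i : ℕ) (s : Bool) : Red [(i, .cross s), (i, .cap)] [(i, .cap)] :=
  (Move.reidemeisterOneCap i s).red

theorem red_cupTwist (i : ℕ) (a s : Bool) :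
    Red [(i, .cup a), (i, .cross s)] [(i, .cup (!a))] :=
  (Move.reidemeisterOneCup i a s).red

theorem red_crossCancel (i : ℕ) (s : Bool) : Red [(i, .cross s), (i, .cross (!s))] [] :=
  (Move.reidemeisterTwo i s).red

theorem red_zigzagLeft (i : ℕ) (a : Bool) : Red [(i + 1, .cup a), (i, .cap)] [] :=
  (Move.zigzagLeft i a).red

theorem red_zigzagRight (i : ℕ) (a : Bool) : Red [(i, .cup a), (i + 1, .cap)] [] :=
  (Move.zigzagRight i a).red

/-- Reidemeister move II, read backwards. -/
theorem iso_crossInsert {i : ℕ} {x : List Bool} (s : Bool) (h : i + 1 < x.length) :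
    Iso x x [] [(i, .cross s), (i, .cross (!s))] := by
  suffices hr : ∃ y, run [(i, .cross s), (i, .cross (!s))] x = some y by
    obtain ⟨y, hy⟩ := hr
    obtain rfl : x = y := by simpa [run] using runsTo_reidemeisterTwo i s (!s) x y hy
    exact (red_crossCancel i s x x ((runs_iff _ _ _).2 hy)).symm
  induction i generalizing x with
  | zero =>
    match x, h with
    | a :: b :: r, _ => simp [run, stepAt]
  | succ i ih =>
    match x, h with
    | a :: r, h =>
      obtain ⟨y, hy⟩ := ih (x := r) (by simpa using h)
      have := run_shift_one [(i, .cross s), (i, .cross (!s))] a r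
      rw [hy] at this
      exact ⟨_, this⟩

end PlanarTangle
namespace PlanarTangle

instance : Trans Red Red Red := ⟨Red.trans⟩

/-! ### Strands that pass over other strands -/

/-- The strand at position `j` moves to the right over `k` strands. -/
def overRight (j : ℕ) : ℕ → List Slice
  | 0 => []
  | k + 1 => (j, .cross true) :: overRight (j + 1) k

/-- The strand at position `j + k` moves to the left over `k` strands. -/
def overLeft (j : ℕ) : ℕ → List Slice
  | 0 => []
  | k + 1 => (j + k, .cross false) :: overLeft j k

/-- The strand at position `j` moves to the right over `k` strands and is joined to the next one. -/
def pull (j k : ℕ) : List Slice := overRight j k ++ [(j + k, .cap)]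

theorem overRight_add (j a b : ℕ) :
    overRight j (a + b) = overRight j a ++ overRight (j + a) b := by
  induction a generalizing j with
  | zero => simp [overRight]
  | succ a ih =>
    rw [Nat.add_right_comm, overRight, ih, overRight, Nat.add_assoc j 1 a, Nat.add_comm 1 a]; rfl

theorem overLeft_add (j a b : ℕ) :
    overLeft j (a + b) = overLeft (j + a) b ++ overLeft j a := by
  induction b with
  | zero => simp [overLeft]
  | succ b ih => rw [← Nat.add_assoc, overLeft, ih, overLeft, Nat.add_assoc]; rfl

theorem overRight_succ' (j k : ℕ) :
    overRight j (k + 1) = overRight j k ++ [(j + k, .cross true)] := by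
  rw [overRight_add]; rfl

theorem overLeft_succ' (j k : ℕ) :
    overLeft j (k + 1) = overLeft (j + 1) k ++ [(j, .cross false)] := by
  rw [Nat.add_comm, overLeft_add]; rfl

theorem red_overRight_right {i j k : ℕ} (p : Piece) (h : j + k + 1 ≤ i) :
    Red ((i, p) :: overRight j k) (overRight j k ++ [(i, p)]) := by
  induction k generalizing j with
  | zero => exact .refl _
  | succ k ih =>
    calc Red ([(i, p), (j, .cross true)] ++ overRight (j + 1) k)
          ([(j, .cross true), (i, p)] ++ overRight (j + 1) k) :=
            Red.append_right _ (red_interchange' i (by simp [Piece.lower]; omega) rfl)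
      Red _ ((j, .cross true) :: (overRight (j + 1) k ++ [(i, p)])) :=
            (ih (by omega)).cons _

theorem red_overRight_left {i j j' k : ℕ} {p : Piece} (h : i + p.upper ≤ j)
    (h' : j' + p.upper = j + p.lower) :
    Red ((i, p) :: overRight j k) (overRight j' k ++ [(i, p)]) := by
  induction k generalizing j j' with
  | zero => exact .refl _
  | succ k ih =>
    calc Red ([(i, p), (j, .cross true)] ++ overRight (j + 1) k)
          ([(j', .cross true), (i, p)] ++ overRight (j + 1) k) :=
            Red.append_right _ (red_interchange j' h h')
      Red _ ((j', .cross true) :: (overRight (j' + 1) k ++ [(i, p)])) :=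
            (ih (by omega) (by omega)).cons _

theorem red_overLeft_left {i j j' k : ℕ} {p : Piece} (h : i + p.upper ≤ j)
    (h' : j' + p.upper = j + p.lower) :
    Red ((i, p) :: overLeft j k) (overLeft j' k ++ [(i, p)]) := by
  induction k with
  | zero => exact .refl _
  | succ k ih =>
    calc Red ([(i, p), (j + k, .cross false)] ++ overLeft j k)
          ([(j' + k, .cross false), (i, p)] ++ overLeft j k) :=
            Red.append_right _ (red_interchange (j' + k) (by omega) (by omega))
      Red _ ((j' + k, .cross false) :: (overLeft j' k ++ [(i, p)])) := ih.cons _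

theorem red_overLeft_left' {i j j' k : ℕ} {p : Piece} (h : i + p.upper ≤ j)
    (h' : j' + p.upper = j + p.lower) :
    Red (overLeft j' k ++ [(i, p)]) ((i, p) :: overLeft j k) := by
  induction k with
  | zero => exact .refl _
  | succ k ih =>
    calc Red ((j' + k, .cross false) :: (overLeft j' k ++ [(i, p)]))
          ([(j' + k, .cross false), (i, p)] ++ overLeft j k) := ih.cons _
      Red _ ([(i, p), (j + k, .cross false)] ++ overLeft j k) :=
            Red.append_right _ (red_interchange' (j + k) (by omega) (by omega))

/-- A strand passes over a piece. -/
theorem red_overRight_piece (i : ℕ) (p : Piece) :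
    Red ((i + 1, p) :: overRight i p.upper) (overRight i p.lower ++ [(i, p)]) := by
  cases p with
  | cup a =>
    calc Red ([(i + 1, .cup a), (i, .cross true)] ++ [(i + 1, .cross true)])
          ([(i, .cup a), (i + 1, .cross false)] ++ [(i + 1, .cross true)]) :=
            (red_slideCup i a true).append_right _
      Red _ ([(i, .cup a)] ++ []) := (red_crossCancel (i + 1) false).append_left [(i, .cup a)]
  | cap =>
    intro x y h
    have hx : i + 1 + 2 ≤ x.length := by
      have := (stepAt_length_le (i := i + 1) (p := .cap) (x := x) (y := y)
        (by simpa [overRight, Piece.upper, runs_iff, run] using h)).1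
      simpa [Piece.lower] using this
    -- A cap has no upper ends, so there is no crossing to start from: a cancelling pair is created,
    -- and its second crossing slides over the maximum.
    have h1 : Iso x y ([] ++ [(i + 1, .cap)])
        ([(i, .cross true), (i, .cross false)] ++ [(i + 1, .cap)]) :=
      (iso_crossInsert true (by omega)).append (.refl h)
    exact h1.trans ((red_slideCap i false).cons (i, .cross true) x y h1.2.1)
  -- The passing strand lies above the two others, so move III is available for either sign `s`.
  | cross s => exact (Move.reidemeisterThree i true true s (Or.inl rfl)).red_symm (by simp)

/-- The passage is cut into three: over the `d` strands before the piece, over the piece itself, and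
over the `e` strands beyond it. The first and the last part commute with the piece. -/
theorem red_overRight_middle (j d e : ℕ) (p : Piece) :
    Red ((j + d + 1, p) :: overRight j (d + p.upper + e))
      (overRight j (d + p.lower + e) ++ [(j + d, p)]) := by
  calc Red _ (((j + d + 1, p) :: overRight j d) ++
        (overRight (j + d) p.upper ++ overRight (j + d + p.upper) e)) :=
          .of_eq (by simp [overRight_add, Nat.add_assoc])
    Red _ ((overRight j d ++ [(j + d + 1, p)]) ++
        (overRight (j + d) p.upper ++ overRight (j + d + p.upper) e)) :=
          (red_overRight_right p (by omega)).append_right _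
    Red _ (overRight j d ++ (((j + d + 1, p) :: overRight (j + d) p.upper) ++
        overRight (j + d + p.upper) e)) := .of_eq (by simp)
    Red _ (overRight j d ++ ((overRight (j + d) p.lower ++ [(j + d, p)]) ++
        overRight (j + d + p.upper) e)) :=
          (red_overRight_piece _ p).congr _ _
    Red _ ((overRight j d ++ overRight (j + d) p.lower) ++
        ((j + d, p) :: overRight (j + d + p.upper) e)) := .of_eq (by simp)
    Red _ ((overRight j d ++ overRight (j + d) p.lower) ++
        (overRight (j + d + p.lower) e ++ [(j + d, p)])) :=
          (red_overRight_left (by omega) (by omega)).append_left _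
    Red _ _ := .of_eq (by simp [overRight_add, Nat.add_assoc])

theorem red_overRight_overLeft (j k : ℕ) : Red (overRight j k ++ overLeft j k) [] := by
  induction k with
  | zero => exact .refl _
  | succ k ih =>
    calc Red _ (overRight j k ++ ([(j + k, .cross true), (j + k, .cross false)] ++ overLeft j k)) :=
          .of_eq (by simp [overRight_succ', overLeft])
      Red _ (overRight j k ++ ([] ++ overLeft j k)) := (red_crossCancel _ true).congr _ _
      Red _ [] := ih

theorem red_overLeft_overRight (j k : ℕ) : Red (overLeft j k ++ overRight j k) [] := by
  induction k generalizing j with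
  | zero => exact .refl _
  | succ k ih =>
    calc Red _ (overLeft (j + 1) k ++ ([(j, .cross false), (j, .cross true)] ++
            overRight (j + 1) k)) := .of_eq (by simp [overLeft_succ', overRight])
      Red _ (overLeft (j + 1) k ++ ([] ++ overRight (j + 1) k)) :=
          (red_crossCancel _ false).congr _ _
      Red _ [] := ih _

theorem pull_succ (j k : ℕ) : pull j (k + 1) = (j, .cross true) :: pull (j + 1) k := by
  simp [pull, overRight, Nat.add_comm, Nat.add_left_comm]

/-- Instead of its left end, the right end of the pulled strand may travel: the crossings slide over
the maximum one by one. The flag of a crossing flips when it slides, so the strand stays on top. -/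
theorem red_pull_overLeft (j k : ℕ) : Red (pull j k) (overLeft (j + 1) k ++ [(j, .cap)]) := by
  induction k generalizing j with
  | zero => exact .refl _
  | succ k ih =>
    calc Red (pull j (k + 1)) ((j, .cross true) :: pull (j + 1) k) := .of_eq (pull_succ j k)
      Red _ ((j, .cross true) :: (overLeft (j + 2) k ++ [(j + 1, .cap)])) := (ih _).cons _
      Red _ (((j, .cross true) :: overLeft (j + 2) k) ++ [(j + 1, .cap)]) := .refl _
      Red _ ((overLeft (j + 2) k ++ [(j, .cross true)]) ++ [(j + 1, .cap)]) :=
        (red_overLeft_left (by simp [Piece.upper]) rfl).append_right _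
      Red _ (overLeft (j + 2) k ++ [(j, .cross true), (j + 1, .cap)]) := .of_eq (by simp)
      Red _ (overLeft (j + 2) k ++ [(j + 1, .cross false), (j, .cap)]) :=
        (red_slideCap j true).append_left _
      Red _ _ := .of_eq (by simp [overLeft_succ'])

theorem red_overLeft_pull (j k : ℕ) : Red (overLeft (j + 1) k ++ [(j, .cap)]) (pull j k) := by
  induction k generalizing j with
  | zero => exact .refl _
  | succ k ih =>
    calc Red _ (overLeft (j + 2) k ++ [(j + 1, .cross false), (j, .cap)]) :=
          .of_eq (by simp [overLeft_succ'])
      Red _ (overLeft (j + 2) k ++ [(j, .cross true), (j + 1, .cap)]) :=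
        (red_slideCap' j false).append_left _
      Red _ ((overLeft (j + 2) k ++ [(j, .cross true)]) ++ [(j + 1, .cap)]) := .of_eq (by simp)
      Red _ (((j, .cross true) :: overLeft (j + 2) k) ++ [(j + 1, .cap)]) :=
        (red_overLeft_left' (by simp [Piece.upper]) rfl).append_right _
      Red _ ((j, .cross true) :: pull (j + 1) k) := (ih _).cons _
      Red _ _ := .of_eq (pull_succ j k).symm

/-- This and the next two lemmas move a slice past the pulled strand when the slice lies to the left
of both its ends, between them, or to the right of both. -/
theorem red_pull_left {i j j' : ℕ} (k : ℕ) {p : Piece} (h : i + p.upper ≤ j)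
    (h' : j' + p.upper = j + p.lower) :
    Red ((i, p) :: pull j k) (pull j' k ++ [(i, p)]) := by
  calc Red _ (((i, p) :: overRight j k) ++ [(j + k, .cap)]) := .refl _
    Red _ ((overRight j' k ++ [(i, p)]) ++ [(j + k, .cap)]) :=
      (red_overRight_left h h').append_right _
    Red _ (overRight j' k ++ [(i, p), (j + k, .cap)]) := .of_eq (by simp)
    Red _ (overRight j' k ++ [(j' + k, .cap), (i, p)]) :=
      (red_interchange (j' + k) (by omega) (by omega)).append_left _
    Red _ _ := .of_eq (by simp [pull])

theorem red_pull_middle (j d e : ℕ) (p : Piece) :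
    Red ((j + d + 1, p) :: pull j (d + p.upper + e))
      (pull j (d + p.lower + e) ++ [(j + d, p)]) := by
  calc Red _ (((j + d + 1, p) :: overRight j (d + p.upper + e)) ++
        [(j + (d + p.upper + e), .cap)]) := .refl _
    Red _ ((overRight j (d + p.lower + e) ++ [(j + d, p)]) ++
        [(j + (d + p.upper + e), .cap)]) :=
      (red_overRight_middle j d e p).append_right _
    Red _ (overRight j (d + p.lower + e) ++ [(j + d, p), (j + (d + p.upper + e), .cap)]) :=
      .of_eq (by simp)
    Red _ (overRight j (d + p.lower + e) ++ [(j + (d + p.lower + e), .cap), (j + d, p)]) :=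
      (red_interchange _ (by omega) (by omega)).append_left _
    Red _ _ := .of_eq (by simp [pull])

theorem red_pull_right {i j k : ℕ} (p : Piece) (h : j + k ≤ i) :
    Red ((i + 2, p) :: pull j k) (pull j k ++ [(i, p)]) := by
  calc Red _ (((i + 2, p) :: overRight j k) ++ [(j + k, .cap)]) := .refl _
    Red _ ((overRight j k ++ [(i + 2, p)]) ++ [(j + k, .cap)]) :=
      (red_overRight_right p (by omega)).append_right _
    Red _ (overRight j k ++ [(i + 2, p), (j + k, .cap)]) := .of_eq (by simp)
    Red _ (overRight j k ++ [(j + k, .cap), (i, p)]) :=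
      (red_interchange' _ (by simp [Piece.lower]; omega) (by simp [Piece.lower, Piece.upper])
        ).append_left _
    Red _ _ := .of_eq (by simp [pull])

/-- Here and in the next three lemmas the crossing involves an end of the pulled strand. When the
other strand is a different one, the flag is such that the pulled strand lies on top, and the
crossing is absorbed. A crossing of the strand with itself is a kink and may have either flag. -/
theorem red_pull_crossLeft (j k : ℕ) :
    Red ((j, .cross false) :: pull j (k + 1)) (pull (j + 1) k) := by
  rw [pull_succ]
  exact (red_crossCancel j false).append_right (pull (j + 1) k)

theorem red_pull_cross (j : ℕ) (s : Bool) : Red ((j, .cross s) :: pull j 0) (pull j 0) :=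
  red_capTwist j s

theorem red_pull_crossIn (j k : ℕ) :
    Red ((j + k + 1, .cross false) :: pull j k) (pull j (k + 1)) := by
  calc Red _ (((j + k + 1, .cross false) :: overRight j k) ++ [(j + k, .cap)]) := .refl _
    Red _ ((overRight j k ++ [(j + k + 1, .cross false)]) ++ [(j + k, .cap)]) :=
      (red_overRight_right _ (by omega)).append_right _
    Red _ (overRight j k ++ [(j + k + 1, .cross false), (j + k, .cap)]) := .of_eq (by simp)
    Red _ (overRight j k ++ [(j + k, .cross true), (j + k + 1, .cap)]) :=
      (red_slideCap' _ _).append_left _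
    Red _ _ := .of_eq (by simp [pull, overRight_succ', Nat.add_assoc])

theorem red_pull_crossOut (j k : ℕ) :
    Red ((j + k + 1, .cross true) :: pull j (k + 1)) (pull j k) := by
  calc Red _ (((j + k + 1, .cross true) :: overRight j k) ++
          [(j + k, .cross true), (j + k + 1, .cap)]) := .of_eq (by
            simp [pull, overRight_succ', Nat.add_assoc])
    Red _ ((overRight j k ++ [(j + k + 1, .cross true)]) ++
          [(j + k, .cross true), (j + k + 1, .cap)]) :=
      (red_overRight_right _ (by omega)).append_right _
    Red _ ((overRight j k ++ [(j + k + 1, .cross true)]) ++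
          [(j + k + 1, .cross false), (j + k, .cap)]) :=
      (red_slideCap _ _).append_left _
    Red _ (overRight j k ++ ([(j + k + 1, .cross true), (j + k + 1, .cross false)] ++
          [(j + k, .cap)])) := .of_eq (by simp)
    Red _ _ := (red_crossCancel _ true).congr _ _

/-- Here and in the next three lemmas the pulled strand ends at one leg of a minimum. The zigzag is
straightened, and the strand continues along the other leg. If the pulled strand takes the farther
leg, a twist of the minimum comes first. -/
theorem red_cup_pull_left (a m : ℕ) (c : Bool) :
    Red ((a + m + 1, .cup c) :: pull a m) (overRight a m) := by
  calc Red _ (((a + m + 1, .cup c) :: overRight a m) ++ [(a + m, .cap)]) := .refl _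
    Red _ ((overRight a m ++ [(a + m + 1, .cup c)]) ++ [(a + m, .cap)]) :=
      (red_overRight_right _ (by omega)).append_right _
    Red _ (overRight a m ++ ([(a + m + 1, .cup c), (a + m, .cap)] ++ [])) := .of_eq (by simp)
    Red _ (overRight a m ++ ([] ++ [])) := (red_zigzagLeft _ _).congr _ _
    Red _ _ := .of_eq (by simp)

theorem red_cup_pull_left' (a m : ℕ) (c : Bool) :
    Red ((a + m + 1, .cup c) :: pull a (m + 1)) (overRight a m) := by
  calc Red _ (((a + m + 1, .cup c) :: overRight a m) ++
          [(a + m, .cross true), (a + m + 1, .cap)]) := .of_eq (by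
            simp [pull, overRight_succ', Nat.add_assoc])
    Red _ ((overRight a m ++ [(a + m + 1, .cup c)]) ++
          [(a + m, .cross true), (a + m + 1, .cap)]) :=
      (red_overRight_right _ (by omega)).append_right _
    Red _ ((overRight a m ++ [(a + m + 1, .cup c)]) ++
          [(a + m + 1, .cross false), (a + m, .cap)]) :=
      (red_slideCap _ _).append_left _
    Red _ (overRight a m ++ ([(a + m + 1, .cup c), (a + m + 1, .cross false)] ++
          [(a + m, .cap)])) := .of_eq (by simp)
    Red _ (overRight a m ++ ([(a + m + 1, .cup !c)] ++ [(a + m, .cap)])) :=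
      (red_cupTwist _ _ _).congr _ _
    Red _ (overRight a m ++ ([(a + m + 1, .cup !c), (a + m, .cap)] ++ [])) := .of_eq (by simp)
    Red _ (overRight a m ++ ([] ++ [])) := (red_zigzagLeft _ _).congr _ _
    Red _ _ := .of_eq (by simp)

theorem red_cup_pull_right (i m : ℕ) (c : Bool) :
    Red ((i, .cup c) :: pull (i + 1) m) (overLeft i m) := by
  calc Red _ ((i, .cup c) :: (overLeft (i + 2) m ++ [(i + 1, .cap)])) :=
        (red_pull_overLeft _ _).cons _
    Red _ (((i, .cup c) :: overLeft (i + 2) m) ++ [(i + 1, .cap)]) := .refl _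
    Red _ ((overLeft i m ++ [(i, .cup c)]) ++ [(i + 1, .cap)]) :=
      (red_overLeft_left (by simp [Piece.upper]) rfl).append_right _
    Red _ (overLeft i m ++ ([(i, .cup c), (i + 1, .cap)] ++ [])) := .of_eq (by simp)
    Red _ (overLeft i m ++ ([] ++ [])) := (red_zigzagRight _ _).congr _ _
    Red _ _ := .of_eq (by simp)

theorem red_cup_pull_right' (i m : ℕ) (c : Bool) :
    Red ((i, .cup c) :: pull i (m + 1)) (overLeft i m) := by
  calc Red _ ((i, .cup c) :: (overLeft (i + 1) (m + 1) ++ [(i, .cap)])) :=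
        (red_pull_overLeft _ _).cons _
    Red _ (((i, .cup c) :: overLeft (i + 2) m) ++ [(i + 1, .cross false), (i, .cap)]) :=
      .of_eq (by simp [overLeft_succ'])
    Red _ ((overLeft i m ++ [(i, .cup c)]) ++ [(i + 1, .cross false), (i, .cap)]) :=
      (red_overLeft_left (by simp [Piece.upper]) rfl).append_right _
    Red _ ((overLeft i m ++ [(i, .cup c)]) ++ [(i, .cross true), (i + 1, .cap)]) :=
      (red_slideCap' _ _).append_left _
    Red _ (overLeft i m ++ ([(i, .cup c), (i, .cross true)] ++ [(i + 1, .cap)])) :=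
      .of_eq (by simp)
    Red _ (overLeft i m ++ ([(i, .cup !c)] ++ [(i + 1, .cap)])) :=
      (red_cupTwist _ _ _).congr _ _
    Red _ (overLeft i m ++ ([(i, .cup !c), (i + 1, .cap)] ++ [])) := .of_eq (by simp)
    Red _ (overLeft i m ++ ([] ++ [])) := (red_zigzagRight _ _).congr _ _
    Red _ _ := .of_eq (by simp)

theorem overRight_pull (a m k : ℕ) : overRight a m ++ pull (a + m) k = pull a (m + k) := by
  simp [pull, overRight_add, Nat.add_assoc]

/-- The strand overshoots its partner by `e` further strands and returns above them. The overshoot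
cancels, and the crossing with the partner becomes a kink at the maximum. -/
theorem red_overRight_pull (a k e : ℕ) :
    Red (overRight a (k + 1 + e) ++ pull (a + k) e) (pull a k) := by
  calc Red _ (overRight a (k + 1 + e) ++ (overLeft (a + k + 1) e ++ [(a + k, .cap)])) :=
        (red_pull_overLeft _ _).append_left _
    Red _ (overRight a (k + 1) ++ ((overRight (a + k + 1) e ++ overLeft (a + k + 1) e) ++
        [(a + k, .cap)])) := .of_eq (by simp [overRight_add, Nat.add_assoc])
    Red _ (overRight a (k + 1) ++ ([] ++ [(a + k, .cap)])) :=
      (red_overRight_overLeft _ _).congr _ _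
    Red _ (overRight a k ++ [(a + k, .cross true), (a + k, .cap)]) := .of_eq (by
      simp [overRight_succ'])
    Red _ _ := (red_capTwist _ _).append_left _

/-- The mirror situation: the right end overshoots its partner to the left by `e` strands and
returns. -/
theorem red_overLeft_pull_of_lt (i e k : ℕ) :
    Red (overLeft i (e + (k + 1)) ++ pull i e) (pull (i + e) k) := by
  calc Red _ (overLeft (i + e) (k + 1) ++ ((overLeft i e ++ overRight i e) ++
        [(i + e, .cap)])) := .of_eq (by simp [overLeft_add i e, pull])
    Red _ (overLeft (i + e) (k + 1) ++ ([] ++ [(i + e, .cap)])) :=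
      (red_overLeft_overRight _ _).congr _ _
    Red _ (overLeft (i + e + 1) k ++ [(i + e, .cross false), (i + e, .cap)]) := .of_eq (by
      simp [overLeft_succ'])
    Red _ (overLeft (i + e + 1) k ++ [(i + e, .cap)]) := (red_capTwist _ _).append_left _
    Red _ _ := red_overLeft_pull _ _

end PlanarTangle
namespace PlanarTangle

/-! ### A vertex model -/

section VertexModel

variable {A : Type*} [CommRing A] (q : Aˣ) {N : ℕ}

/-- Powers of `q`. -/
def qpow (k : ℤ) : A := ((q ^ k : Aˣ) : A)

theorem qpow_mul (a b : ℤ) : qpow q a * qpow q b = qpow q (a + b) := by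
  simp [qpow, zpow_add]

@[simp] theorem qpow_zero : qpow q 0 = 1 := by simp [qpow]

theorem qpow_mul_neg (a : ℤ) : qpow q a * qpow q (-a) = 1 := by simp [qpow_mul]

/-- `q` or its inverse. -/
def sgn (s : Bool) : ℤ := if s then 1 else -1

/-- The exponent of the weight of a label on a counterclockwise local maximum. -/
def turn (x : Fin N) : ℤ := (N : ℤ) - 1 - 2 * (x : ℕ)

/-- Whether two unequal labels may touch at a crossing. -/
def touches (s : Bool) (x y : Fin N) : Prop := if s then x < y else y < x

instance (s : Bool) (x y : Fin N) : Decidable (touches s x y) := by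
  unfold touches; infer_instance

/-- The coefficient of the smoothing in the weights of a crossing. -/
def touchWeight (s : Bool) (x y : Fin N) : A :=
  if touches s x y then qpow q (sgn s) - qpow q (-sgn s) else 0

/-- The weights of a crossing of two strands that point up. -/
def upWeight (s : Bool) (x y u v : Fin N) : A :=
  qpow q (-sgn s * N) * ((if x = v ∧ y = u then (if x = y then qpow q (sgn s) else 1) else 0) +
    if x = u ∧ y = v then touchWeight q s x y else 0)

theorem sum_fin_Ico (a b : ℕ) (hb : b ≤ N) (g : ℕ → A) :
    ∑ u : Fin N, (if a ≤ (u : ℕ) ∧ (u : ℕ) < b then g u else 0) = ∑ n ∈ Finset.Ico a b, g n := by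
  rw [Fin.sum_univ_eq_sum_range (fun n => if a ≤ n ∧ n < b then g n else 0) N,
    ← Finset.sum_filter]
  congr 1
  ext n
  simp
  omega

/-- The sum telescopes, since `(q - q⁻¹) q ^ (c - 2u) = q ^ (c + 1 - 2u) - q ^ (c + 1 - 2(u + 1))`.
-/
theorem sum_qpow (a b : ℕ) (hab : a ≤ b) (hb : b ≤ N) (c : ℤ) :
    ∑ u : Fin N, (if a ≤ (u : ℕ) ∧ (u : ℕ) < b then
        (qpow q 1 - qpow q (-1)) * qpow q (c - 2 * (u : ℕ)) else 0) =
      qpow q (c + 1 - 2 * a) - qpow q (c + 1 - 2 * b) := by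
  rw [sum_fin_Ico a b hb (fun n => (qpow q 1 - qpow q (-1)) * qpow q (c - 2 * n))]
  induction b, hab using Nat.le_induction with
  | base => simp
  | succ b hab ih =>
    rw [Finset.sum_Ico_succ_top hab, ih (by omega), sub_mul, qpow_mul, qpow_mul]
    push_cast
    ring_nf

/-- The labels that may touch `x` form the interval below or above `x`, according to the sign, so
the sum telescopes. -/
theorem sum_touchWeight_left (s : Bool) (x : Fin N) :
    ∑ u : Fin N, touchWeight q s u x * qpow q (turn u) =
      qpow q (sgn s * N) - qpow q (sgn s) * qpow q (turn x) := by
  cases s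
  · have := sum_qpow q ((x : ℕ) + 1) N (by omega) le_rfl ((N : ℤ) - 1)
    rw [qpow_mul]
    calc _ = - ∑ u : Fin N, (if (x : ℕ) + 1 ≤ (u : ℕ) ∧ (u : ℕ) < N then
        (qpow q 1 - qpow q (-1)) * qpow q ((N : ℤ) - 1 - 2 * (u : ℕ)) else 0) := by
          rw [← Finset.sum_neg_distrib]
          refine Finset.sum_congr rfl fun u _ => ?_
          have hu := u.2
          by_cases h : x < u
          · have h' : (x : ℕ) + 1 ≤ u := h
            simp [touchWeight, touches, h, h', sgn, turn]
            ring
          · have h' : ¬ (x : ℕ) + 1 ≤ u := h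
            simp [touchWeight, touches, h, h']
      _ = _ := by
        rw [this]; simp [sgn, turn]; ring_nf
  · have := sum_qpow q 0 (x : ℕ) (Nat.zero_le _) x.2.le ((N : ℤ) - 1)
    rw [qpow_mul]
    calc _ = ∑ u : Fin N, (if 0 ≤ (u : ℕ) ∧ (u : ℕ) < x then
        (qpow q 1 - qpow q (-1)) * qpow q ((N : ℤ) - 1 - 2 * (u : ℕ)) else 0) := by
          refine Finset.sum_congr rfl fun u _ => ?_
          by_cases h : u < x
          · have h' : (u : ℕ) < x := h
            simp [touchWeight, touches, h, sgn, turn]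
          · have h' : ¬ (u : ℕ) < x := h
            simp [touchWeight, touches, h]
      _ = _ := by
        rw [this]; simp [sgn, turn]; ring_nf

theorem qpow_inv (k : ℤ) : qpow q⁻¹ k = qpow q (-k) := by simp [qpow]

theorem sgn_not (s : Bool) : sgn (!s) = -sgn s := by cases s <;> rfl

/-- Inverting `q` reflects the model: signs change and left and right are exchanged. Identities on
one side thus yield those on the other. -/
theorem touchWeight_inv (s : Bool) (x y : Fin N) :
    touchWeight q⁻¹ s x y = touchWeight q (!s) y x := by
  cases s <;> simp [touchWeight, touches, qpow_inv, sgn]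

/-- The identity behind the second Reidemeister move for antiparallel strands. -/
theorem touchWeight_cancel_left (s : Bool) (x y : Fin N) :
    qpow q (sgn s) * touchWeight q (!s) x y * qpow q (turn x) +
      touchWeight q s y x * qpow q (-sgn s) * qpow q (turn y) +
      ∑ u : Fin N, touchWeight q s u x * touchWeight q (!s) u y * qpow q (turn u) = 0 := by
  -- Only labels strictly between `x` and `y` contribute to the sum, and their contribution
  -- telescopes. For the other order of `x` and `y` all terms vanish.
  suffices H : ∀ (x y : Fin N), x < y → ∑ u : Fin N, (if x < u ∧ u < y then
      (qpow q 1 - qpow q (-1)) * qpow q (turn u) else 0) =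
      qpow q (-1) * qpow q (turn x) - qpow q 1 * qpow q (turn y) by
    cases s
    · by_cases h : x < y
      · have : ∑ u : Fin N, touchWeight q false u x * touchWeight q (!false) u y *
            qpow q (turn u) = - (qpow q 1 - qpow q (-1)) * ∑ u : Fin N, (if x < u ∧ u < y then
              (qpow q 1 - qpow q (-1)) * qpow q (turn u) else 0) := by
          rw [Finset.mul_sum]
          refine Finset.sum_congr rfl fun u _ => ?_
          by_cases h1 : x < u <;> by_cases h2 : u < y <;>
            simp [touchWeight, touches, h1, h2, sgn]
          ring
        rw [this, H x y h]
        simp [touchWeight, touches, h, sgn]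
        ring
      · have : ∑ u : Fin N, touchWeight q false u x * touchWeight q (!false) u y *
            qpow q (turn u) = 0 := by
          refine Finset.sum_eq_zero fun u _ => ?_
          by_cases h1 : x < u
          · have h2 : ¬ u < y := fun h2 => h (h1.trans h2)
            simp [touchWeight, touches, h2]
          · simp [touchWeight, touches, h1]
        rw [this]
        simp [touchWeight, touches, h]
    · by_cases h : y < x
      · have : ∑ u : Fin N, touchWeight q true u x * touchWeight q (!true) u y *
            qpow q (turn u) = - (qpow q 1 - qpow q (-1)) * ∑ u : Fin N, (if y < u ∧ u < x then
              (qpow q 1 - qpow q (-1)) * qpow q (turn u) else 0) := by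
          rw [Finset.mul_sum]
          refine Finset.sum_congr rfl fun u _ => ?_
          by_cases h1 : y < u <;> by_cases h2 : u < x <;>
            simp [touchWeight, touches, h1, h2, sgn]
          ring
        rw [this, H y x h]
        simp [touchWeight, touches, h, sgn]
        ring
      · have : ∑ u : Fin N, touchWeight q true u x * touchWeight q (!true) u y *
            qpow q (turn u) = 0 := by
          refine Finset.sum_eq_zero fun u _ => ?_
          by_cases h1 : y < u
          · have h2 : ¬ u < x := fun h2 => h (h1.trans h2)
            simp [touchWeight, touches, h2]
          · simp [touchWeight, touches, h1]
        rw [this]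
        simp [touchWeight, touches, h]
  intro x y h
  have := sum_qpow q ((x : ℕ) + 1) (y : ℕ) h y.2.le ((N : ℤ) - 1)
  rw [qpow_mul, qpow_mul]
  convert this using 2
  · simp [turn]
  · simp [turn]; ring_nf
  · simp [turn]; ring_nf

/-- The factor `qpow q (-sgn s * N)` in `upWeight` is the framing correction that makes the weight
of a kink exactly `1`, so that the state sum is invariant under move I. -/
theorem sum_upWeight_left (s : Bool) (x y : Fin N) :
    ∑ u : Fin N, upWeight q s u x u y * qpow q (turn u) = if x = y then 1 else 0 := by
  by_cases h : x = y
  · subst h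
    have := sum_touchWeight_left q s x
    calc _ = qpow q (-sgn s * N) * (qpow q (sgn s) * qpow q (turn x) +
          ∑ u : Fin N, touchWeight q s u x * qpow q (turn u)) := by
            have h1 : qpow q (sgn s) * qpow q (turn x) = ∑ u : Fin N, if u = x then
              qpow q (sgn s) * qpow q (turn u) else 0 := by simp
            rw [h1, ← Finset.sum_add_distrib, Finset.mul_sum]
            refine Finset.sum_congr rfl fun u _ => ?_
            by_cases hu : u = x
            · subst hu; simp [upWeight]; ring
            · simp [upWeight, hu]; ring
      _ = _ := by rw [this]; simp [qpow_mul]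
  · have : ∀ u, upWeight q s u x u y = 0 := by
      intro u
      have : ¬ (u = y ∧ x = u) := by rintro ⟨rfl, rfl⟩; exact h rfl
      simp [upWeight, h, this]
    simp [this, h]

theorem upWeight_inv (s : Bool) (x y u v : Fin N) :
    upWeight q⁻¹ s x y u v = upWeight q (!s) y x v u := by
  simp only [upWeight, qpow_inv, touchWeight_inv, sgn_not, eq_comm (a := x) (b := y),
    and_comm (a := x = v), and_comm (a := x = u)]
  ring_nf

theorem sum_upWeight_right (s : Bool) (x y : Fin N) :
    ∑ u : Fin N, upWeight q s x u y u * qpow q (-turn u) = if x = y then 1 else 0 := by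
  simpa [upWeight_inv, qpow_inv] using sum_upWeight_left q⁻¹ (!s) x y

theorem upWeight_eq_zero_or (s : Bool) (x y u v : Fin N) :
    upWeight q s x y u v = 0 ∨ (turn x + turn y = turn u + turn v) := by
  by_cases h : x = v ∧ y = u
  · obtain ⟨rfl, rfl⟩ := h; right; ring
  · by_cases h' : x = u ∧ y = v
    · obtain ⟨rfl, rfl⟩ := h'; right; ring
    · left; simp [upWeight, h, h']

/-- The weights of a crossing of two strands of directions `a` and `b`. -/
def weight : Bool → Bool → Bool → Fin N → Fin N → Fin N → Fin N → A
  | true, true, s, x, y, u, v => upWeight q s x y u v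
  | true, false, s, x, y, u, v => upWeight q (!s) u x v y
  | false, false, s, x, y, u, v => upWeight q s v u y x
  | false, true, s, x, y, u, v => upWeight q (!s) y v x u * qpow q (turn y) * qpow q (-turn u)

/-- The exponent of the weight of a local maximum whose left leg has direction `a`. -/
def capTurn (a : Bool) (x : Fin N) : ℤ := if a then 0 else turn x

/-- The weights for the other directions are those of the upward crossing turned by quarter turns; a
leg that is bent over a maximum contributes the weights of that maximum. Only the turn that closes
the cycle of directions needs an argument: a crossing conserves its labels, so the turning exponents
cancel. -/
theorem weight_rotate (a b s : Bool) (x y u r : Fin N) :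
    weight q b (!a) (!s) y r x u =
      weight q a b s x y u r * qpow q (capTurn a r) * qpow q (-capTurn a x) := by
  cases a <;> cases b
  · simp only [weight, Bool.not_false, capTurn, Bool.not_not, Bool.false_eq_true, if_false]
  · simp only [weight, Bool.not_false, capTurn, Bool.false_eq_true, if_false]
    rcases upWeight_eq_zero_or q (!s) y r x u with h | h
    · simp [h]
    · rw [mul_assoc, mul_assoc, mul_assoc, qpow_mul, qpow_mul, qpow_mul,
        show turn y + (-turn u + (turn r + -turn x)) = 0 by linarith]
      simp
  · simp [weight, capTurn]
  · simp [weight, capTurn]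

/-- The two families of weights are inverse to each other. -/
def IsInv (w w' : Fin N → Fin N → Fin N → Fin N → A) : Prop :=
  ∀ x y x' y', ∑ u, ∑ v, w x y u v * w' u v x' y' = if x = x' ∧ y = y' then 1 else 0

theorem upWeight_apply (s : Bool) (x y : Fin N) (G : Fin N → Fin N → A) :
    ∑ u, ∑ v, upWeight q s x y u v * G u v = qpow q (-sgn s * N) *
      ((if x = y then qpow q (sgn s) * G x y else G y x) + touchWeight q s x y * G x y) := by
  have h : ∀ u v, upWeight q s x y u v * G u v = qpow q (-sgn s * N) *
      ((if x = v then if y = u then ((if x = y then qpow q (sgn s) else 1) * G u v) else 0 else 0)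
      + if x = u then if y = v then touchWeight q s x y * G u v else 0 else 0) := by
    intro u v
    simp only [upWeight, ite_and]
    split_ifs <;> ring
  simp only [h, ← Finset.mul_sum, Finset.sum_add_distrib]
  simp
  by_cases hxy : x = y
  · subst hxy; simp
  · simp [hxy]

/-- Move II for parallel strands. On a pair of distinct labels and its transpose the crossing is a
transposition with one extra diagonal entry, and the extra entries of the two crossings cancel; on
equal labels the weights are inverse powers of `q`. -/
theorem isInv_upWeight (s : Bool) : IsInv (upWeight q s : Fin N → _) (upWeight q !s) := by
  intro x y x' y'
  rw [upWeight_apply q s x y (fun u v => upWeight q (!s) u v x' y')]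
  have h1 : (qpow q (-(sgn s * N)) : A) * qpow q (sgn s * N) = 1 := by simp [qpow_mul]
  have h2 : (qpow q (sgn s) : A) * qpow q (- sgn s) = 1 := by simp [qpow_mul]
  by_cases hxy : x = y
  · subst hxy
    have ht : ∀ s, (touchWeight q s x x : A) = 0 := by intro s; simp [touchWeight, touches]
    simp only [upWeight, ht, sgn_not]
    by_cases hh : x = x' ∧ x = y'
    · obtain ⟨rfl, rfl⟩ := hh; simp; linear_combination (qpow q (sgn s) * qpow q (-sgn s)) * h1 + h2
    · have hh' : ¬ (x = y' ∧ x = x') := fun h => hh h.symm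
      simp [hh, hh']
  · have hyx : ¬ y = x := fun h => hxy h.symm
    have ht : (touchWeight q s x y : A) + touchWeight q (!s) y x = 0 := by
      cases s <;> simp [touchWeight, touches, sgn]
      all_goals split_ifs <;> ring
    have htt : (touchWeight q s x y : A) * touchWeight q (!s) x y = 0 := by
      cases s <;> simp [touchWeight, touches, sgn]
      all_goals intro h1 h2; exact absurd h1 h2.not_gt
    simp only [upWeight, hxy, hyx, if_false, sgn_not, neg_neg]
    have e1 : (if x = y' ∧ y = x' then (1 : A) else 0) = if y = x' ∧ x = y' then 1 else 0 := by
      simp only [and_comm]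
    by_cases hA : x = x' ∧ y = y'
    · obtain ⟨rfl, rfl⟩ := hA
      simp [hxy, hyx]
      linear_combination h1 + (qpow q (-(sgn s * N)) * qpow q (sgn s * N)) * htt
    · by_cases hB : x = y' ∧ y = x'
      · obtain ⟨rfl, rfl⟩ := hB
        simp [hxy, hyx]
        linear_combination (qpow q (-(sgn s * N)) * qpow q (sgn s * N)) * ht
      · have hB' : ¬ (y = x' ∧ x = y') := fun h => hB h.symm
        have hA' : ¬ (y = y' ∧ x = x') := fun h => hA h.symm
        simp [hA, hB, hA', hB']

end VertexModel

end PlanarTangle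
namespace PlanarTangle

/-! ### Move II for strands of arbitrary directions -/

section VertexModel

variable {A : Type*} [CommRing A] (q : Aˣ) {N : ℕ}

theorem upWeight_apply_side (s : Bool) (x y : Fin N) (G : Fin N → Fin N → A) :
    ∑ u, ∑ v, upWeight q s u x v y * G u v = qpow q (-sgn s * N) *
      ((if x = y then qpow q (sgn s) else 1) * G y x +
        if x = y then ∑ u, touchWeight q s u x * G u u else 0) := by
  have h : ∀ u v, upWeight q s u x v y * G u v = qpow q (-sgn s * N) *
      ((if u = y then if x = v then ((if x = y then qpow q (sgn s) else 1) * G u v) else 0 else 0)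
      + if u = v then if x = y then touchWeight q s u x * G u v else 0 else 0) := by
    intro u v
    by_cases huy : u = y
    · subst huy
      simp only [upWeight, ite_and, eq_comm (a := u) (b := x)]
      split_ifs <;> simp_all; ring
    · simp only [upWeight, huy, false_and, ite_and]
      split_ifs <;> simp_all; ring
  simp only [h, ← Finset.mul_sum, Finset.sum_add_distrib]
  by_cases hxy : x = y
  · subst hxy; simp
  · simp [hxy]

/-- Move II for antiparallel strands: the crossings are read sideways. Unequal labels must run
straight through both crossings. For equal labels the smoothings contribute as well, and
`touchWeight_cancel_left` says that their contributions cancel. -/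
theorem upWeight_side_inv (s : Bool) (x y x' y' : Fin N) :
    ∑ u, ∑ v, upWeight q (!s) u x v y * (upWeight q s v y' u x' * qpow q (turn v)) =
      if x = x' ∧ y = y' then qpow q (turn x') else 0 := by
  rw [upWeight_apply_side q (!s) x y (fun u v => upWeight q s v y' u x' * qpow q (turn v))]
  have h1 : (qpow q (-(sgn s * N)) : A) * qpow q (sgn s * N) = 1 := by simp [qpow_mul]
  have h2 : (qpow q (sgn s) : A) * qpow q (- sgn s) = 1 := by simp [qpow_mul]
  by_cases hxy : x = y
  · subst hxy
    by_cases hxy' : x' = y'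
    · subst hxy'
      have key := touchWeight_cancel_left q (!s) x x'
      have hsum : ∑ u, touchWeight q (!s) u x * (upWeight q s u x' u x' * qpow q (turn u)) =
          qpow q (-(sgn s * N)) * (touchWeight q (!s) x' x * (qpow q (sgn s) * qpow q (turn x')) +
          ∑ u : Fin N, touchWeight q (!s) u x * touchWeight q s u x' * qpow q (turn u)) := by
        have : touchWeight q (!s) x' x * (qpow q (sgn s) * qpow q (turn x')) =
            ∑ u : Fin N, if u = x' then touchWeight q (!s) u x *
              (qpow q (sgn s) * qpow q (turn u)) else 0 := by simp
        rw [this, ← Finset.sum_add_distrib, Finset.mul_sum]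
        refine Finset.sum_congr rfl fun u _ => ?_
        by_cases hu : u = x'
        · subst hu; simp [upWeight]; ring
        · have : ¬ (u = x' ∧ x' = u) := fun h => hu h.1
          simp [upWeight, hu]; ring
      rw [if_pos rfl, if_pos rfl, hsum]
      simp only [sgn_not, Bool.not_not, neg_neg] at key ⊢
      by_cases hx : x = x'
      · subst hx
        simp [upWeight]
        linear_combination (qpow q (-sgn s) * qpow q (sgn s) * qpow q (turn x)) * h1 +
          qpow q (turn x) * h2 + (qpow q (-(sgn s * N)) * qpow q (sgn s * N)) * key
      · simp [upWeight, hx]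
        linear_combination (qpow q (-(sgn s * N)) * qpow q (sgn s * N)) * key
    · have h3 : ∀ u, upWeight q s u y' u x' = 0 := by
        intro u
        have h4 : ¬ (u = x' ∧ y' = u) := by rintro ⟨rfl, rfl⟩; exact hxy' rfl
        have h5 : ¬ y' = x' := fun h => hxy' h.symm
        simp [upWeight, h4, h5]
      have h4 : ¬ (x = x' ∧ x = y') := by rintro ⟨rfl, rfl⟩; exact hxy' rfl
      simp [h3, h4]
  · simp only [hxy, if_false]
    by_cases h : x = x' ∧ y = y'
    · obtain ⟨rfl, rfl⟩ := h
      simp [upWeight, hxy, sgn_not]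
      linear_combination qpow q (turn x) * h1
    · have h' : ¬ (x = x' ∧ y' = y) := fun h' => h ⟨h'.1, h'.2.symm⟩
      simp [upWeight, h, h', hxy]

/-- Parallel strands are covered by `isInv_upWeight` and antiparallel ones by `upWeight_side_inv`;
inverting `q` relates the two antiparallel cases. -/
theorem isInv_weight (a b s : Bool) :
    IsInv (weight q a b s : Fin N → _) (weight q b a (!s)) := by
  cases a <;> cases b
  · intro x y x' y'
    have := isInv_upWeight q (!s) (N := N) y' x' y x
    rw [Finset.sum_comm] at this
    simp only [weight]
    simp only [Bool.not_not] at this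
    rw [← (by simp only [and_comm, eq_comm] :
      (if y' = y ∧ x' = x then (1 : A) else 0) = if x = x' ∧ y = y' then 1 else 0), ← this]
    refine Finset.sum_congr rfl fun u _ => Finset.sum_congr rfl fun v _ => ?_
    ring
  · intro x y x' y'
    have := upWeight_side_inv q⁻¹ (!s) y x y' x'
    simp only [upWeight_inv, qpow_inv, Bool.not_not] at this
    simp only [weight, Bool.not_not]
    rw [Finset.sum_comm] at this
    have e : ∀ u v, upWeight q (!s) y v x u * qpow q (turn y) * qpow q (-turn u) *
        upWeight q s x' u y' v = qpow q (turn y) * (upWeight q (!s) y v x u *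
          (upWeight q s x' u y' v * qpow q (-turn u))) := fun u v => by ring
    simp only [e, ← Finset.mul_sum]
    rw [this]
    by_cases h : x = x' ∧ y = y'
    · obtain ⟨rfl, rfl⟩ := h; simp [qpow_mul]
    · have h' : ¬ (y = y' ∧ x = x') := fun h' => h h'.symm
      simp [h, h']
  · intro x y x' y'
    have := upWeight_side_inv q s x y x' y'
    simp only [weight, Bool.not_not]
    have e : ∀ u v, upWeight q (!s) u x v y * (upWeight q s v y' u x' * qpow q (turn v) *
        qpow q (-turn x')) = (upWeight q (!s) u x v y * (upWeight q s v y' u x' *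
          qpow q (turn v))) * qpow q (-turn x') := fun u v => by ring
    simp only [e, ← Finset.sum_mul]
    rw [this]
    by_cases h : x = x' ∧ y = y'
    · obtain ⟨rfl, rfl⟩ := h; simp [qpow_mul]
    · simp [h]
  · exact isInv_upWeight q s

/-! ### The Yang-Baxter equation -/

/-- `w` acts on the first two of three labels. -/
def opLeft (w : Fin N → Fin N → Fin N → Fin N → A) (G : Fin N → Fin N → Fin N → A)
    (x y z : Fin N) : A := ∑ u, ∑ v, w x y u v * G u v z

/-- `w` acts on the last two of three labels. -/
def opRight (w : Fin N → Fin N → Fin N → Fin N → A) (G : Fin N → Fin N → Fin N → A)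
    (x y z : Fin N) : A := ∑ u, ∑ v, w y z u v * G x u v

/-- The Yang-Baxter equation. -/
def IsYangBaxter (w₁ w₂ w₃ : Fin N → Fin N → Fin N → Fin N → A) : Prop :=
  ∀ G, opLeft w₁ (opRight w₂ (opLeft w₃ G)) = opRight w₃ (opLeft w₂ (opRight w₁ G))

theorem sum_comm_two (f : Fin N → Fin N → Fin N → Fin N → A) :
    ∑ a, ∑ b, ∑ c, ∑ d, f a b c d = ∑ c, ∑ d, ∑ a, ∑ b, f a b c d := by
  calc _ = ∑ p : Fin N × Fin N × Fin N × Fin N, f p.1 p.2.1 p.2.2.1 p.2.2.2 := by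
        simp only [Fintype.sum_prod_type]
    _ = ∑ p : Fin N × Fin N × Fin N × Fin N, f p.2.2.1 p.2.2.2 p.1 p.2.1 :=
        Fintype.sum_equiv ⟨fun p => (p.2.2.1, p.2.2.2, p.1, p.2.1),
          fun p => (p.2.2.1, p.2.2.2, p.1, p.2.1), fun _ => rfl, fun _ => rfl⟩ _ _ fun _ => rfl
    _ = _ := by simp only [Fintype.sum_prod_type]

theorem opLeft_opLeft {w w' : Fin N → Fin N → Fin N → Fin N → A} (h : IsInv w w')
    (G : Fin N → Fin N → Fin N → A) : opLeft w (opLeft w' G) = G := by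
  funext x y z
  calc _ = ∑ u', ∑ v', (∑ u, ∑ v, w x y u v * w' u v u' v') * G u' v' z := by
        simp only [opLeft, Finset.mul_sum, Finset.sum_mul, ← mul_assoc]
        exact sum_comm_two _
    _ = _ := by
        simp only [h x y, ite_and, ite_mul, one_mul, zero_mul]
        simp

theorem opRight_opRight {w w' : Fin N → Fin N → Fin N → Fin N → A} (h : IsInv w w')
    (G : Fin N → Fin N → Fin N → A) : opRight w (opRight w' G) = G := by
  funext x y z
  calc _ = ∑ u', ∑ v', (∑ u, ∑ v, w y z u v * w' u v u' v') * G x u' v' := by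
        simp only [opRight, Finset.mul_sum, Finset.sum_mul, ← mul_assoc]
        exact sum_comm_two _
    _ = _ := by
        simp only [h y z, ite_and, ite_mul, one_mul, zero_mul]
        simp

/-- Multiplying move III on both sides by an inverse crossing yields another instance of move III.
In this way signs and directions are changed at the expense of move II only. -/
theorem IsYangBaxter.conj_left {wab wba wac wbc : Fin N → Fin N → Fin N → Fin N → A}
    (h : IsYangBaxter wba wbc wac) (hi : IsInv wab wba) (hi' : IsInv wba wab) :
    IsYangBaxter wab wac wbc := by
  intro G
  have := h (opRight wab G)
  rw [opRight_opRight hi'] at this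
  rw [← this, opLeft_opLeft hi]

theorem IsYangBaxter.conj_right {wab wac wbc wcb : Fin N → Fin N → Fin N → Fin N → A}
    (h : IsYangBaxter wac wab wcb) (hi : IsInv wbc wcb) (hi' : IsInv wcb wbc) :
    IsYangBaxter wab wac wbc := by
  intro G
  have := h (opLeft wbc G)
  rw [opLeft_opLeft hi'] at this
  rw [this, opRight_opRight hi]

-- Both sides only permute three labels, so the identity depends only on their relative order. Each
-- of the 13 weak orders leaves a polynomial identity in `Q`, `Q'` and `n` with `Q * Q' = 1`.
set_option linter.unusedSimpArgs false in
theorem isYangBaxter_upWeight_true :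
    IsYangBaxter (upWeight q true : Fin N → _) (upWeight q true) (upWeight q true) := by
  intro G
  funext x y z
  simp only [opLeft, opRight, upWeight_apply]
  have hQ : (qpow q 1 : A) * qpow q (-1) = 1 := by simp [qpow_mul]
  have ht : ∀ a b : Fin N, touchWeight q true a b =
    if a < b then (qpow q 1 : A) - qpow q (-1) else 0 := fun a b => by
      simp [touchWeight, touches, sgn]
  simp only [ht, show sgn true = 1 from rfl]
  generalize (qpow q 1 : A) = Q at hQ
  generalize (qpow q (-1) : A) = Q' at hQ
  generalize (qpow q (-1 * N) : A) = n
  rcases lt_trichotomy x y with hxy | rfl | hxy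
  · rcases lt_trichotomy y z with hyz | rfl | hyz
    · have hxz := hxy.trans hyz
      simp only [hxy, hxy.ne, hxy.ne', hxy.not_gt, hyz, hyz.ne, hyz.ne', hyz.not_gt, hxz, hxz.ne,
        hxz.ne', hxz.not_gt, if_true, if_false, lt_irrefl]
      grind
    · simp only [hxy, hxy.ne, hxy.ne', hxy.not_gt, if_true, if_false, lt_irrefl]
      grind
    · rcases lt_trichotomy x z with hxz | rfl | hxz
      · simp only [hxy, hxy.ne, hxy.ne', hxy.not_gt, hyz, hyz.ne, hyz.ne', hyz.not_gt, hxz, hxz.ne,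
          hxz.ne', hxz.not_gt, if_true, if_false, lt_irrefl]
        grind
      · simp only [hxy, hxy.ne, hxy.ne', hxy.not_gt, if_true, if_false, lt_irrefl]
        grind
      · simp only [hxy, hxy.ne, hxy.ne', hxy.not_gt, hyz, hyz.ne, hyz.ne', hyz.not_gt, hxz, hxz.ne,
          hxz.ne', hxz.not_gt, if_true, if_false, lt_irrefl]
        grind
  · rcases lt_trichotomy x z with hxz | rfl | hxz
    · simp only [hxz, hxz.ne, hxz.ne', hxz.not_gt, if_true, if_false, lt_irrefl]
      grind
    · simp only [if_true, if_false, lt_irrefl]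
    · simp only [hxz, hxz.ne, hxz.ne', hxz.not_gt, if_true, if_false, lt_irrefl]
      grind
  · rcases lt_trichotomy y z with hyz | rfl | hyz
    · rcases lt_trichotomy x z with hxz | rfl | hxz
      · simp only [hxy, hxy.ne, hxy.ne', hxy.not_gt, hyz, hyz.ne, hyz.ne', hyz.not_gt, hxz, hxz.ne,
          hxz.ne', hxz.not_gt, if_true, if_false, lt_irrefl]
        grind
      · simp only [hxy, hxy.ne, hxy.ne', hxy.not_gt, if_true, if_false, lt_irrefl]
        grind
      · simp only [hxy, hxy.ne, hxy.ne', hxy.not_gt, hyz, hyz.ne, hyz.ne', hyz.not_gt, hxz, hxz.ne,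
          hxz.ne', hxz.not_gt, if_true, if_false, lt_irrefl]
        grind
    · simp only [hxy, hxy.ne, hxy.ne', hxy.not_gt, if_true, if_false, lt_irrefl]
      grind
    · have hxz := hyz.trans hxy
      simp only [hxy, hxy.ne, hxy.ne', hxy.not_gt, hyz, hyz.ne, hyz.ne', hyz.not_gt, hxz, hxz.ne,
        hxz.ne', hxz.not_gt, if_true, if_false, lt_irrefl]
      grind

theorem isYangBaxter_upWeight (s t r : Bool) (h : s = t ∨ t = r) :
    IsYangBaxter (upWeight q s : Fin N → _) (upWeight q t) (upWeight q r) := by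
  have hi : ∀ s, IsInv (upWeight q s : Fin N → _) (upWeight q !s) := isInv_upWeight q
  have hi' : ∀ s, IsInv (upWeight q (!s) : Fin N → _) (upWeight q s) := fun s => by
    simpa using isInv_upWeight q (!s)
  have ttt := isYangBaxter_upWeight_true q (N := N)
  -- The six sign patterns with three distinct heights form a chain, in which neighbours differ by a
  -- conjugation with an outer crossing.
  have ftt := ttt.conj_left (hi' true) (hi true)
  have ttf := ttt.conj_right (hi' true) (hi true)
  have tff := ftt.conj_right (hi' true) (hi true)
  have fff := tff.conj_left (hi' true) (hi true)
  have fft := ttf.conj_left (hi' true) (hi true)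
  cases s <;> cases t <;> cases r <;> simp_all

theorem sum_move_left (f : Fin N → Fin N → Fin N → Fin N → Fin N → Fin N → A) :
    ∑ i, ∑ j, ∑ k, ∑ c, ∑ a, ∑ b, f i j k a b c = ∑ a, ∑ b, ∑ c, ∑ i, ∑ j, ∑ k, f i j k a b c := by
  calc _ = ∑ p : Fin N × Fin N × Fin N × Fin N × Fin N × Fin N,
        f p.1 p.2.1 p.2.2.1 p.2.2.2.2.1 p.2.2.2.2.2 p.2.2.2.1 := by
        simp only [Fintype.sum_prod_type]
    _ = ∑ p : Fin N × Fin N × Fin N × Fin N × Fin N × Fin N,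
        f p.2.2.2.1 p.2.2.2.2.1 p.2.2.2.2.2 p.1 p.2.1 p.2.2.1 :=
        Fintype.sum_equiv
          ⟨fun p => (p.2.2.2.2.1, p.2.2.2.2.2, p.2.2.2.1, p.1, p.2.1, p.2.2.1),
          fun p => (p.2.2.2.1, p.2.2.2.2.1, p.2.2.2.2.2, p.2.2.1, p.1, p.2.1),
          fun _ => rfl, fun _ => rfl⟩ _ _ fun _ => rfl
    _ = _ := by simp only [Fintype.sum_prod_type]

theorem sum_move_right (f : Fin N → Fin N → Fin N → Fin N → Fin N → Fin N → A) :
    ∑ i, ∑ j, ∑ a, ∑ k, ∑ b, ∑ c, f i j k a b c = ∑ a, ∑ b, ∑ c, ∑ i, ∑ j, ∑ k, f i j k a b c := by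
  calc _ = ∑ p : Fin N × Fin N × Fin N × Fin N × Fin N × Fin N,
        f p.1 p.2.1 p.2.2.2.1 p.2.2.1 p.2.2.2.2.1 p.2.2.2.2.2 := by
        simp only [Fintype.sum_prod_type]
    _ = ∑ p : Fin N × Fin N × Fin N × Fin N × Fin N × Fin N,
        f p.2.2.2.1 p.2.2.2.2.1 p.2.2.2.2.2 p.1 p.2.1 p.2.2.1 :=
        Fintype.sum_equiv
          ⟨fun p => (p.2.2.1, p.2.2.2.2.1, p.2.2.2.2.2, p.1, p.2.1, p.2.2.2.1),
          fun p => (p.2.2.2.1, p.2.2.2.2.1, p.1, p.2.2.2.2.2, p.2.1, p.2.2.1),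
          fun _ => rfl, fun _ => rfl⟩ _ _ fun _ => rfl
    _ = _ := by simp only [Fintype.sum_prod_type]

theorem opLeft_opRight_opLeft (w₁ w₂ w₃ : Fin N → Fin N → Fin N → Fin N → A)
    (G : Fin N → Fin N → Fin N → A) (x y z : Fin N) :
    opLeft w₁ (opRight w₂ (opLeft w₃ G)) x y z = ∑ a, ∑ b, ∑ c,
      (∑ i, ∑ j, ∑ k, w₁ x y i j * w₂ j z k c * w₃ i k a b) * G a b c := by
  simp only [opLeft, opRight, Finset.mul_sum, Finset.sum_mul, ← mul_assoc]
  exact sum_move_left fun i j k a b c => w₁ x y i j * w₂ j z k c * w₃ i k a b * G a b c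

theorem opRight_opLeft_opRight (w₁ w₂ w₃ : Fin N → Fin N → Fin N → Fin N → A)
    (G : Fin N → Fin N → Fin N → A) (x y z : Fin N) :
    opRight w₃ (opLeft w₂ (opRight w₁ G)) x y z = ∑ a, ∑ b, ∑ c,
      (∑ i, ∑ j, ∑ k, w₃ y z i j * w₂ x i a k * w₁ k j b c) * G a b c := by
  simp only [opLeft, opRight, Finset.mul_sum, Finset.sum_mul, ← mul_assoc]
  exact sum_move_right fun i j k a b c => w₃ y z i j * w₂ x i a k * w₁ k j b c * G a b c

/-- Rotation exchanges incoming and outgoing labels. It therefore makes sense for matrix entries but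
not for operators. -/
theorem isYangBaxter_iff (w₁ w₂ w₃ : Fin N → Fin N → Fin N → Fin N → A) :
    IsYangBaxter w₁ w₂ w₃ ↔ ∀ x y z a b c,
      ∑ i, ∑ j, ∑ k, w₁ x y i j * w₂ j z k c * w₃ i k a b =
        ∑ i, ∑ j, ∑ k, w₃ y z i j * w₂ x i a k * w₁ k j b c := by
  constructor
  · intro h x y z a b c
    have := congrFun (congrFun (congrFun
      (h fun a' b' c' => if a' = a then if b' = b then if c' = c then 1 else 0 else 0 else 0) x) y) z
    rw [opLeft_opRight_opLeft, opRight_opLeft_opRight] at this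
    simpa only [mul_ite, mul_one, mul_zero, Finset.sum_ite_eq', Finset.mem_univ, if_true,
      Finset.sum_ite_irrel, Finset.sum_const_zero] using this
  · intro h G
    funext x y z
    rw [opLeft_opRight_opLeft, opRight_opLeft_opRight]
    simp only [h]

/-- Bending the first strand over to the other side turns one side of move III into the other side
of its rotated form. At the inner segment of the bent strand the turning weights cancel; at its ends
they give the same factor on both sides. -/
theorem IsYangBaxter.rotate {a b c s₁ s₂ s₃ : Bool}
    (h : IsYangBaxter (weight q a b s₁ : Fin N → _) (weight q a c s₂) (weight q b c s₃)) :
    IsYangBaxter (weight q b c s₃ : Fin N → _) (weight q b (!a) (!s₁)) (weight q c (!a) (!s₂)) := by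
  rw [isYangBaxter_iff] at h ⊢
  intro x y z x' y' z'
  have hk : ∀ k : Fin N, (qpow q (capTurn a k) : A) * qpow q (-capTurn a k) = 1 :=
    fun k => qpow_mul_neg q _
  have key := h x' x y y' z' z
  calc _ = (∑ i, ∑ j, ∑ k, weight q b c s₃ x y i j * weight q a c s₂ x' i y' k *
          weight q a b s₁ k j z' z) * (qpow q (capTurn a z) * qpow q (-capTurn a x')) := by
        simp only [Finset.sum_mul]
        refine Finset.sum_congr rfl fun i _ => Finset.sum_congr rfl fun j _ =>
          Finset.sum_congr rfl fun k _ => ?_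
        rw [weight_rotate, weight_rotate]
        linear_combination (weight q b c s₃ x y i j * weight q a c s₂ x' i y' k *
          weight q a b s₁ k j z' z) * (qpow q (capTurn a z) * qpow q (-capTurn a x')) * hk k
    _ = (∑ i, ∑ j, ∑ k, weight q a b s₁ x' x i j * weight q a c s₂ j y k z *
          weight q b c s₃ i k y' z') * (qpow q (capTurn a z) * qpow q (-capTurn a x')) := by
        rw [key]
    _ = (∑ j, ∑ k, ∑ i, weight q a b s₁ x' x i j * weight q a c s₂ j y k z *
          weight q b c s₃ i k y' z') * (qpow q (capTurn a z) * qpow q (-capTurn a x')) := by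
        congr 1
        rw [Finset.sum_comm]
        refine Finset.sum_congr rfl fun i _ => Finset.sum_comm
    _ = _ := by
        simp only [Finset.sum_mul]
        refine Finset.sum_congr rfl fun i _ => Finset.sum_congr rfl fun j _ =>
          Finset.sum_congr rfl fun k _ => ?_
        rw [weight_rotate, weight_rotate]
        linear_combination -(weight q b c s₃ k j y' z' * weight q a c s₂ i y j z *
          weight q a b s₁ x' x k i) * (qpow q (capTurn a z) * qpow q (-capTurn a x')) * hk i

theorem isYangBaxter_weight (a b c s₁ s₂ s₃ : Bool) (h : s₁ = s₂ ∨ s₂ = s₃) :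
    IsYangBaxter (weight q a b s₁ : Fin N → _) (weight q a c s₂) (weight q b c s₃) := by
  have ttt : ∀ s₁ s₂ s₃, s₁ = s₂ ∨ s₂ = s₃ → IsYangBaxter (weight q true true s₁ : Fin N → _)
      (weight q true true s₂) (weight q true true s₃) := isYangBaxter_upWeight q
  -- Rotation sends the directions `(a, b, c)` to `(b, c, !a)`. The orbit of three upward strands
  -- has six elements.
  have rot : ∀ {a b c : Bool}, (∀ s₁ s₂ s₃, s₁ = s₂ ∨ s₂ = s₃ →
        IsYangBaxter (weight q a b s₁ : Fin N → _) (weight q a c s₂) (weight q b c s₃)) →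
      ∀ s₁ s₂ s₃, s₁ = s₂ ∨ s₂ = s₃ → IsYangBaxter (weight q b c s₁ : Fin N → _)
        (weight q b (!a) s₂) (weight q c (!a) s₃) := by
    intro a b c H s₁ s₂ s₃ hs
    have := (H (!s₂) (!s₃) s₁ (by revert hs; cases s₁ <;> cases s₂ <;> cases s₃ <;> simp)).rotate
    simpa using this
  have ttf := rot ttt
  have tff := rot ttf
  have fff := rot tff
  have fft := rot fff
  have ftt := rot fft
  simp only [Bool.not_true, Bool.not_false] at ttf tff fff fft ftt
  -- The two alternating patterns form an orbit of their own, which is reached by a conjugation that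
  -- exchanges two antiparallel strands.
  have tft : ∀ s₁ s₂ s₃, s₁ = s₂ ∨ s₂ = s₃ → IsYangBaxter (weight q true false s₁ : Fin N → _)
      (weight q true true s₂) (weight q false true s₃) := by
    intro s₁ s₂ s₃ hs
    refine (ftt (!s₁) s₃ s₂ (by revert hs; cases s₁ <;> cases s₂ <;> cases s₃ <;> simp)).conj_left
      (isInv_weight q true false s₁) ?_
    simpa using isInv_weight q false true (!s₁) (N := N)
  have ftf := rot tft
  simp only [Bool.not_true] at ftf
  cases a <;> cases b <;> cases c
  exacts [fff _ _ _ h, fft _ _ _ h, ftf _ _ _ h, ftt _ _ _ h, tff _ _ _ h, tft _ _ _ h,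
    ttf _ _ _ h, ttt _ _ _ h]

/-- The identity behind the first Reidemeister move at a local maximum. -/
theorem sum_weight_cap (a s : Bool) (x y : Fin N) :
    ∑ u, weight q a (!a) s x y u u * qpow q (capTurn (!a) u) =
      if x = y then qpow q (capTurn a x) else 0 := by
  cases a
  · have := sum_upWeight_right q (!s) y x
    simp only [weight, Bool.not_false, capTurn, if_true, Bool.false_eq_true, if_false, qpow_zero,
      mul_one]
    simp only [mul_right_comm _ (qpow q (turn y)), ← Finset.sum_mul, this]
    by_cases h : x = y
    · simp [h]
    · have h' : ¬ y = x := fun h' => h h'.symm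
      simp [h, h']
  · have := sum_upWeight_left q (!s) x y
    simpa [weight, capTurn] using this

/-- The identity behind the first Reidemeister move at a local minimum. -/
theorem sum_weight_cup (a s : Bool) (u v : Fin N) :
    ∑ x, qpow q (-capTurn (!a) x) * weight q a (!a) s x x u v =
      if u = v then qpow q (-capTurn a u) else 0 := by
  cases a
  · have := sum_upWeight_left q (!s) v u
    simp only [weight, Bool.not_false, capTurn, if_true, Bool.false_eq_true, if_false, neg_zero,
      qpow_zero, one_mul, ← Finset.sum_mul, this]
    by_cases h : u = v
    · simp [h]
    · have h' : ¬ v = u := fun h' => h h'.symm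
      simp [h, h']
  · have := sum_upWeight_right q (!s) u v
    simp only [weight, Bool.not_true, capTurn, if_true, Bool.false_eq_true, if_false, neg_zero,
      qpow_zero]
    simp only [mul_comm (qpow q _), this]

/-- The skein relation. -/
theorem weight_skein (x y u v : Fin N) :
    qpow q N * weight q true true true x y u v - qpow q (-N) * weight q true true false x y u v =
      (qpow q 1 - qpow q (-1)) * if x = u ∧ y = v then 1 else 0 := by
  have h1 : (qpow q N : A) * qpow q (-N) = 1 := by simp [qpow_mul]
  simp only [weight, upWeight, touchWeight, touches, sgn, Bool.false_eq_true, if_false, if_true,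
    neg_neg, one_mul, neg_mul]
  by_cases h : x = v ∧ y = u
  · obtain ⟨rfl, rfl⟩ := h
    by_cases hxy : x = y
    · subst hxy
      simp
      linear_combination (qpow q 1 - qpow q (-1)) * h1
    · have hyx : ¬ y = x := fun h => hxy h.symm
      simp [hxy, hyx]
      ring
  · by_cases h' : x = u ∧ y = v
    · obtain ⟨rfl, rfl⟩ := h'
      simp only [h, if_false, and_self, if_true]
      rcases lt_trichotomy x y with hxy | rfl | hxy
      · simp [hxy, hxy.not_gt]
        linear_combination (qpow q 1 - qpow q (-1)) * h1
      · simp at h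
      · simp [hxy, hxy.not_gt]
        linear_combination (qpow q 1 - qpow q (-1)) * h1
    · simp [h, h']

end VertexModel

end PlanarTangle
-- The state sum and its invariance under the moves
namespace PlanarTangle

section VertexModel

variable {A : Type*} [CommRing A] (q : Aˣ) {N : ℕ}

/-- The action of a slice on functions of labelled levels. -/
def act : ℕ → Piece → (List (Bool × Fin N) → A) → List (Bool × Fin N) → A
  | 0, .cup a, F, s => ∑ x, qpow q (-capTurn (!a) x) * F ((a, x) :: (!a, x) :: s)
  | 0, .cap, F, (a, x) :: (b, y) :: s =>
      if b = !a ∧ x = y then qpow q (capTurn a x) * F s else 0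
  | 0, .cross c, F, (a, x) :: (b, y) :: s =>
      ∑ u, ∑ v, weight q a b c x y u v * F ((b, u) :: (a, v) :: s)
  | 0, .cap, _, _ => 0
  | 0, .cross _, _, _ => 0
  | _ + 1, _, _, [] => 0
  | i + 1, p, F, h :: s => act i p (fun t => F (h :: t)) s

/-- The state sum of a diagram: the sum over all labellings of the weights of the pieces. -/
def stateSum : List Slice → (List (Bool × Fin N) → A) → List (Bool × Fin N) → A
  | [], F => F
  | g :: w, F => act q g.1 g.2 (stateSum w F)

theorem stateSum_append (v w : List Slice) (F : List (Bool × Fin N) → A) :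
    stateSum q (v ++ w) F = stateSum q v (stateSum q w F) := by
  induction v with
  | nil => rfl
  | cons g v ih => simp [stateSum, ih]

theorem stateSum_shift_one (w : List Slice) (F : List (Bool × Fin N) → A) (h : Bool × Fin N)
    (s : List (Bool × Fin N)) :
    stateSum q (shift 1 w) F (h :: s) = stateSum q w (fun t => F (h :: t)) s := by
  induction w generalizing s with
  | nil => rfl
  | cons g w ih =>
    simp only [shift_cons, stateSum, act]
    congr 1
    funext t
    exact ih t

theorem act_sum {ι : Type*} (S : Finset ι) (i : ℕ) (p : Piece) (c : ι → A)
    (F : ι → List (Bool × Fin N) → A) (s : List (Bool × Fin N)) :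
    act q i p (fun t => ∑ k ∈ S, c k * F k t) s = ∑ k ∈ S, c k * act q i p (F k) s := by
  induction i generalizing s F with
  | zero =>
    cases p with
    | cup a =>
      simp only [act, Finset.mul_sum]
      rw [Finset.sum_comm]
      refine Finset.sum_congr rfl fun _ _ => Finset.sum_congr rfl fun _ _ => ?_
      ring
    | cap =>
      match s with
      | [] => simp [act]
      | [_] => simp [act]
      | (a, x) :: (b, y) :: s =>
        simp only [act]
        split_ifs
        · rw [Finset.mul_sum]
          refine Finset.sum_congr rfl fun _ _ => ?_
          ring
        · simp
    | cross c =>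
      match s with
      | [] => simp [act]
      | [_] => simp [act]
      | (a, x) :: (b, y) :: s =>
        simp only [act, Finset.mul_sum]
        simp only [Finset.sum_comm (s := Finset.univ) (t := S)]
        refine Finset.sum_congr rfl fun _ _ => Finset.sum_congr rfl fun _ _ =>
          Finset.sum_congr rfl fun _ _ => ?_
        ring
  | succ i ih =>
    match s with
    | [] => simp [act]
    | h :: s => simp only [act]; exact ih (fun k t => F k (h :: t)) s

theorem act_mul (i : ℕ) (p : Piece) (c : A) (F : List (Bool × Fin N) → A)
    (s : List (Bool × Fin N)) :
    act q i p (fun t => c * F t) s = c * act q i p F s := by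
  simpa using act_sum q (Finset.univ : Finset Unit) i p (fun _ => c) (fun _ => F) s

theorem act_zero_fun (i : ℕ) (p : Piece) (s : List (Bool × Fin N)) :
    act q i p (fun _ => (0 : A)) s = 0 := by
  simpa using act_mul q i p 0 (fun _ => 0) s

/-- Only labelled levels with directions `y` occur above the slice. Hence identities that hold on
such levels alone may be used inside a state sum. -/
theorem act_congr {i : ℕ} {p : Piece} {x y : List Bool} (h : stepAt i p x = some y)
    {F G : List (Bool × Fin N) → A} (hFG : ∀ s, s.map Prod.fst = y → F s = G s)
    (s : List (Bool × Fin N)) (hs : s.map Prod.fst = x) : act q i p F s = act q i p G s := by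
  induction i generalizing s x y F G with
  | zero =>
    cases p with
    | cup a =>
      simp only [stepAt, Option.some.injEq] at h
      simp only [act]
      refine Finset.sum_congr rfl fun _ _ => ?_
      rw [hFG]
      simp [hs, h]
    | cap =>
      match s with
      | [] => simp [act]
      | [_] => simp [act]
      | (a, u) :: (b, v) :: s =>
        subst hs
        simp only [List.map_cons, stepAt, Option.ite_none_right_eq_some, Option.some.injEq] at h
        simp only [act]
        rw [hFG s h.2]
    | cross c =>
      match s with
      | [] => simp [act]
      | [_] => simp [act]
      | (a, u) :: (b, v) :: s =>
        subst hs
        simp only [List.map_cons, stepAt, Option.some.injEq] at h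
        simp only [act]
        refine Finset.sum_congr rfl fun _ _ => Finset.sum_congr rfl fun _ _ => ?_
        rw [hFG]
        simpa using h
  | succ i ih =>
    match s with
    | [] => simp [act]
    | h' :: s =>
      subst hs
      simp only [List.map_cons, stepAt, Option.map_eq_some_iff] at h
      obtain ⟨z, hz, rfl⟩ := h
      simp only [act]
      exact ih hz (fun t ht => hFG _ (by simp [ht])) s rfl

theorem stateSum_congr {w : List Slice} {x y : List Bool} (h : Runs w x y)
    {F G : List (Bool × Fin N) → A} (hFG : ∀ s, s.map Prod.fst = y → F s = G s)
    (s : List (Bool × Fin N)) (hs : s.map Prod.fst = x) :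
    stateSum q w F s = stateSum q w G s := by
  induction h generalizing s with
  | nil x => exact hFG s hs
  | cons hg _ ih => exact act_congr q ((step_iff _ _ _ _).1 hg) (ih hFG) s hs

variable (N) in
/-- The state sums of `m` and `m'` agree wherever `m` is a diagram. -/
def StateEq (m m' : List Slice) : Prop :=
  ∀ x y, Runs m x y → ∀ (F : List (Bool × Fin N) → A) (s : List (Bool × Fin N)),
    s.map Prod.fst = x → stateSum q m F s = stateSum q m' F s

variable {q} in
theorem StateEq.shift_one {m m' : List Slice} (h : StateEq q N m m') (hm : m ≠ []) :
    StateEq q N (shift 1 m) (shift 1 m') := by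
  intro x y hx F s hs
  rw [runs_iff] at hx
  match s with
  | [] =>
    subst hs
    obtain ⟨g, w, rfl⟩ := List.exists_cons_of_ne_nil hm
    simp [run, stepAt] at hx
  | h' :: s =>
    subst hs
    rw [List.map_cons, run_shift_one, Option.map_eq_some_iff] at hx
    obtain ⟨z, hz, rfl⟩ := hx
    rw [stateSum_shift_one, stateSum_shift_one]
    exact h _ _ ((runs_iff _ _ _).2 hz) _ _ rfl

variable {q} in
theorem StateEq.shift {m m' : List Slice} (h : StateEq q N m m') (hm : m ≠ []) (i : ℕ) :
    StateEq q N (shift i m) (shift i m') := by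
  induction i with
  | zero => simpa only [shift_zero]
  | succ i ih =>
    rw [← shift_shift, ← shift_shift]
    exact ih.shift_one (by simpa [PlanarTangle.shift] using hm)

theorem stateEq_interchange (k : ℕ) (p r : Piece) :
    StateEq q N [(0, p), (0 + p.upper + k, r)] [(0 + p.lower + k, r), (0, p)] := by
  intro x y _ F s _
  cases p with
  | cup a =>
    simp only [stateSum, Piece.upper, Piece.lower, Nat.add_comm (0 + 2), Nat.add_zero,
      Nat.zero_add, act]
    rw [act_sum]
  | cap =>
    simp only [stateSum, Piece.upper, Piece.lower, Nat.add_comm (0 + 2), Nat.add_zero,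
      Nat.zero_add]
    match s with
    | [] => simp [act]
    | [_] => simp [act]
    | (a, u) :: (b, v) :: s =>
      simp only [act]
      split_ifs
      · rw [act_mul]
      · rw [act_zero_fun]
  | cross c =>
    simp only [stateSum, Piece.upper, Piece.lower, Nat.add_comm (0 + 2), Nat.zero_add]
    match s with
    | [] => simp [act]
    | [_] => simp [act]
    | (a, u) :: (b, v) :: s =>
      simp only [act, ← Fintype.sum_prod_type']
      rw [act_sum]

theorem stateEq_slideCap (c : Bool) :
    StateEq q N [(0, .cross c), (1, .cap)] [(1, .cross (!c)), (0, .cap)] := by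
  intro x y h F s hs
  rw [runs_iff] at h
  match s with
  | [] => subst hs; simp [run, stepAt] at h
  | [_] => subst hs; simp [run, stepAt] at h
  | [_, _] => subst hs; simp [run, stepAt] at h
  | (a, u) :: (b, v) :: (d, w) :: s =>
    subst hs
    simp only [List.map_cons, run, stepAt, Option.bind_some] at h
    obtain rfl : d = !a := by by_contra hd; simp [hd] at h
    simp only [stateSum, act, ite_and, if_true, mul_ite, mul_zero]
    simp only [Finset.sum_ite_eq', Finset.mem_univ, if_true]
    rw [Finset.sum_comm]
    simp only [Finset.sum_ite_eq, Finset.mem_univ, if_true]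
    refine Finset.sum_congr rfl fun z _ => ?_
    rw [weight_rotate]
    have hk := qpow_mul_neg q (capTurn a u)
    linear_combination - weight q a b c u v z w * qpow q (capTurn a w) * F ((b, z) :: s) * hk

theorem stateEq_slideCup (a c : Bool) :
    StateEq q N [(1, .cup a), (0, .cross c)] [(0, .cup a), (1, .cross (!c))] := by
  intro x y h F s hs
  rw [runs_iff] at h
  match s with
  | [] => subst hs; simp [run, stepAt] at h
  | (b, v) :: s =>
    simp only [stateSum, act, Finset.mul_sum]
    rw [Finset.sum_comm]
    refine Finset.sum_congr rfl fun u _ => ?_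
    rw [Finset.sum_comm]
    refine Finset.sum_congr rfl fun z _ => Finset.sum_congr rfl fun w _ => ?_
    have hr := weight_rotate q (!a) b (!c) u v z w
    simp only [Bool.not_not] at hr
    rw [hr]
    have hk := qpow_mul_neg q (capTurn (!a) w)
    linear_combination weight q (!a) b (!c) u v z w * qpow q (-capTurn (!a) u) *
      F ((a, u) :: (b, z) :: (!a, w) :: s) * hk

theorem stateEq_capTwist (c : Bool) : StateEq q N [(0, .cross c), (0, .cap)] [(0, .cap)] := by
  intro x y h F s hs
  match s with
  | [] => simp [stateSum, act]
  | [_] => simp [stateSum, act]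
  | (a, u) :: (b, v) :: s =>
    simp only [stateSum, act, ite_and, mul_ite, mul_zero]
    by_cases hb : b = !a
    · subst hb
      have := sum_weight_cap q a c u v
      simp only [Bool.not_not, if_true, Finset.sum_ite_eq, Finset.mem_univ, ← mul_assoc]
      rw [← Finset.sum_mul, this]
      simp
    · have hb' : ¬ a = !b := fun h => hb (by simp [h])
      simp [hb, hb']

theorem stateEq_cupTwist (a c : Bool) :
    StateEq q N [(0, .cup a), (0, .cross c)] [(0, .cup (!a))] := by
  intro x y h F s hs
  simp only [stateSum, act, Finset.mul_sum, Bool.not_not]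
  rw [Finset.sum_comm]
  refine Finset.sum_congr rfl fun u _ => ?_
  rw [Finset.sum_comm]
  simp only [← mul_assoc, ← Finset.sum_mul, sum_weight_cup, ite_mul, zero_mul, Finset.sum_ite_eq,
    Finset.mem_univ, if_true]

theorem stateEq_crossCancel (c : Bool) :
    StateEq q N [(0, .cross c), (0, .cross (!c))] [] := by
  intro x y h F s hs
  rw [runs_iff] at h
  match s with
  | [] => subst hs; simp [run, stepAt] at h
  | [_] => subst hs; simp [run, stepAt] at h
  | (a, u) :: (b, v) :: s =>
    have := congrFun (congrFun (congrFun (opLeft_opLeft (isInv_weight q a b c)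
      (fun u v (_ : Fin N) => F ((a, u) :: (b, v) :: s))) u) v) u
    simpa only [opLeft, stateSum, act] using this

theorem stateEq_reidemeisterThree (a b c : Bool) (h : a = b ∨ b = c) :
    StateEq q N [(0, .cross a), (1, .cross b), (0, .cross c)]
      [(1, .cross c), (0, .cross b), (1, .cross a)] := by
  intro x y hr F s hs
  rw [runs_iff] at hr
  match s with
  | [] => subst hs; simp [run, stepAt] at hr
  | [_] => subst hs; simp [run, stepAt] at hr
  | [_, _] => subst hs; simp [run, stepAt] at hr
  | (d, u) :: (e, v) :: (f, w) :: s =>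
    have := congrFun (congrFun (congrFun (isYangBaxter_weight q d e f a b c h
      (fun u v w => F ((f, u) :: (e, v) :: (d, w) :: s))) u) v) w
    simpa only [opLeft, opRight, stateSum, act] using this

theorem stateEq_zigzagLeft (a : Bool) : StateEq q N [(1, .cup a), (0, .cap)] [] := by
  intro x y hr F s hs
  rw [runs_iff] at hr
  match s with
  | [] => subst hs; simp [run, stepAt] at hr
  | (b, u) :: s =>
    subst hs
    obtain rfl : b = !a := by
      by_contra hb
      have : ¬ a = !b := fun h => hb (by simp [h])
      simp [run, stepAt, this] at hr
    simp only [stateSum, act, Bool.not_not, true_and, mul_ite, mul_zero, Finset.sum_ite_eq,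
      Finset.mem_univ, if_true, ← mul_assoc, qpow_mul]
    simp

theorem stateEq_zigzagRight (a : Bool) : StateEq q N [(0, .cup a), (1, .cap)] [] := by
  intro x y hr F s hs
  rw [runs_iff] at hr
  match s with
  | [] => subst hs; simp [run, stepAt] at hr
  | (b, u) :: s =>
    subst hs
    obtain rfl : b = a := by
      by_contra hb
      simp [run, stepAt, hb] at hr
    simp only [stateSum, act, Bool.not_not, true_and, mul_ite, mul_zero, Finset.sum_ite_eq',
      Finset.mem_univ, if_true, ← mul_assoc, qpow_mul]
    simp

theorem Move.stateEq {m m' : List Slice} (h : Move m m') : StateEq q N m m' := by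
  cases h with
  | interchange i k p r => simpa [Nat.add_comm, Nat.add_left_comm] using
      (stateEq_interchange q (N := N) k p r).shift (by simp) i
  | zigzagLeft i a => simpa [Nat.add_comm] using
      (stateEq_zigzagLeft q (N := N) a).shift (by simp) i
  | zigzagRight i a => simpa [Nat.add_comm] using
      (stateEq_zigzagRight q (N := N) a).shift (by simp) i
  | slideCap i s => simpa [Nat.add_comm] using
      (stateEq_slideCap q (N := N) s).shift (by simp) i
  | slideCup i a s => simpa [Nat.add_comm] using
      (stateEq_slideCup q (N := N) a s).shift (by simp) i
  | reidemeisterOneCap i s => simpa using (stateEq_capTwist q (N := N) s).shift (by simp) i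
  | reidemeisterOneCup i a s => simpa using (stateEq_cupTwist q (N := N) a s).shift (by simp) i
  | reidemeisterTwo i s => simpa using (stateEq_crossCancel q (N := N) s).shift (by simp) i
  | reidemeisterThree i a b c h => simpa [Nat.add_comm] using
      (stateEq_reidemeisterThree q (N := N) a b c h).shift (by simp) i

/-- The local identities hold for every function `F` on the upper level, in particular for the state
sum of the slices above the move. The slices below it see only this function. -/
theorem Iso.stateSum_eq {x y : List Bool} {w w' : List Slice} (h : Iso x y w w')
    (F : List (Bool × Fin N) → A) (s : List (Bool × Fin N)) (hs : s.map Prod.fst = x) :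
    stateSum q w F s = stateSum q w' F s := by
  obtain ⟨hw, hw', h⟩ := h
  suffices H : ∀ D E : Diagram x y, Relation.EqvGen OneMove D E →
      stateSum q D.1 F s = stateSum q E.1 F s from H _ _ h
  intro D E h
  induction h with
  | rel D E h =>
    obtain ⟨u, m, m', v, hm, hD, hE⟩ := h
    have hr := D.2
    rw [hD] at hr
    obtain ⟨z, hr, _⟩ := (runs_append_iff _ _ _ _).1 hr
    obtain ⟨z', hu, hr⟩ := (runs_append_iff _ _ _ _).1 hr
    rw [hD, hE, List.append_assoc, List.append_assoc, stateSum_append, stateSum_append,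
      stateSum_append q u, stateSum_append q m']
    exact stateSum_congr q hu (fun t ht => hm.stateEq q z' z hr _ t ht) s hs
  | refl D => rfl
  | symm D E _ ih => exact ih.symm
  | trans D E G _ _ ih₁ ih₂ => exact ih₁.trans ih₂

end VertexModel

end PlanarTangle
namespace PlanarTangle

/-! ### The pairing of the ends -/

theorem removeTwo_insertTwo (i j : ℕ) : removeTwo i (insertTwo i j) = j := by
  unfold removeTwo insertTwo; split_ifs <;> omega

theorem insertTwo_removeTwo {i j : ℕ} (h : j ≠ i) (h' : j ≠ i + 1) :
    insertTwo i (removeTwo i j) = j := by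
  unfold removeTwo insertTwo; split_ifs <;> omega

theorem insertTwo_ne (i j : ℕ) : insertTwo i j ≠ i := by
  unfold insertTwo; split_ifs <;> omega

theorem insertTwo_ne_succ (i j : ℕ) : insertTwo i j ≠ i + 1 := by
  unfold insertTwo; split_ifs <;> omega

theorem insertTwo_lt {i j n : ℕ} (h : j < n) : insertTwo i j < n + 2 := by
  unfold insertTwo; split_ifs <;> omega

theorem removeTwo_lt {i j n : ℕ} (h : j < n + 2) (hi : j ≠ i) (hi' : j ≠ i + 1) (hn : i ≤ n) :
    removeTwo i j < n := by
  unfold removeTwo; split_ifs <;> omega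

theorem getElem?_insertTwo {α : Type*} (l r : List α) (a b : α) (k : ℕ) :
    (l ++ a :: b :: r)[insertTwo l.length k]? = (l ++ r)[k]? := by
  unfold insertTwo
  split_ifs with h
  · rw [List.getElem?_append_left h, List.getElem?_append_left h]
  · rw [List.getElem?_append_right (by omega), List.getElem?_append_right (by omega),
      show k + 2 - l.length = (k - l.length) + 1 + 1 by omega]
    simp

theorem getElem?_swap {α : Type*} (l r : List α) (a b : α) (k : ℕ) :
    (l ++ b :: a :: r)[Equiv.swap l.length (l.length + 1) k]? = (l ++ a :: b :: r)[k]? := by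
  by_cases h1 : k = l.length
  · subst h1; simp
  · by_cases h2 : k = l.length + 1
    · subst h2; simp
    · rw [Equiv.swap_apply_of_ne_of_ne h1 h2]
      rcases lt_or_ge k l.length with h | h
      · rw [List.getElem?_append_left h, List.getElem?_append_left h]
      · obtain ⟨m, rfl⟩ : ∃ m, k = l.length + (m + 2) := ⟨k - l.length - 2, by omega⟩
        simp [List.getElem?_append_right]

theorem swap_lt {i n k : ℕ} (hi : i + 1 < n) (hk : k < n) : Equiv.swap i (i + 1) k < n := by
  by_cases h1 : k = i
  · subst h1; simpa using hi
  · by_cases h2 : k = i + 1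
    · subst h2; simp; omega
    · rwa [Equiv.swap_apply_of_ne_of_ne h1 h2]

theorem partner_cup_left {i j : ℕ} {w : List Slice} (a : Bool)
    (h : partner w (insertTwo i j) = i) :
    partner ((i, .cup a) :: w) j = removeTwo i (partner w (i + 1)) := by
  simp [partner, h]

theorem partner_cup_right {i j : ℕ} {w : List Slice} (a : Bool)
    (h : partner w (insertTwo i j) = i + 1) :
    partner ((i, .cup a) :: w) j = removeTwo i (partner w i) := by
  simp [partner, h]

theorem partner_cup_of_ne {i j : ℕ} {w : List Slice} (a : Bool)
    (h : partner w (insertTwo i j) ≠ i) (h' : partner w (insertTwo i j) ≠ i + 1) :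
    partner ((i, .cup a) :: w) j = removeTwo i (partner w (insertTwo i j)) := by
  simp [partner, h, h']

/-- By induction from the top: a cap joins two ends, a crossing exchanges two positions, and a cup
links the strands through its legs. Opposite directions at the two ends express that a strand is
oriented from one to the other. -/
theorem partner_spec {w : List Slice} {x z : List Bool} (h : Runs w x z) (hz : z = []) :
    ∀ j < x.length, partner w j < x.length ∧ partner w j ≠ j ∧ partner w (partner w j) = j ∧
      x[partner w j]? = (x[j]?).map not := by
  induction h with
  | nil x => subst hz; simp
  | cons hg _ ih =>
    specialize ih hz
    rename_i g w x y z _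
    cases hg with
    | cup l r a =>
      intro j hj
      have hlen : (l ++ a :: (!a) :: r).length = (l ++ r).length + 2 := by simp; omega
      have hl : l.length ≤ (l ++ r).length := by simp
      generalize hn : (l ++ r).length = n at *
      generalize hi : l.length = i at *
      have hel : ∀ k, (l ++ a :: (!a) :: r)[insertTwo i k]? = (l ++ r)[k]? := by
        subst hi; exact getElem?_insertTwo l r a _
      have hei : (l ++ a :: (!a) :: r)[i]? = some a := by
        subst hi; simp
      have hei' : (l ++ a :: (!a) :: r)[i + 1]? = some (!a) := by
        subst hi; simp
      generalize (l ++ a :: (!a) :: r) = X at *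
      rw [hlen] at ih
      have hJ := ih (insertTwo i j) (insertTwo_lt hj)
      have h0 := ih i (by omega)
      have h1 := ih (i + 1) (by omega)
      have hJ1 := insertTwo_ne i j
      have hJ2 := insertTwo_ne_succ i j
      -- A strand that reaches one leg of the cup continues from the other. Since `partner w` is an
      -- involution, that other leg is not joined to the first one above the cup.
      by_cases c1 : partner w (insertTwo i j) = i
      · rw [partner_cup_left a c1]
        have e0 : partner w i = insertTwo i j := by
          have := hJ.2.2.1
          rwa [c1] at this
        have n1 : partner w (i + 1) ≠ i := by
          intro e; rw [e, e0] at h1; exact hJ2 h1.2.2.1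
        have n2 : partner w (i + 1) ≠ i + 1 := h1.2.1
        refine ⟨removeTwo_lt h1.1 n1 n2 hl, ?_, ?_, ?_⟩
        · intro e
          have : partner w (i + 1) = insertTwo i j := by rw [← e, insertTwo_removeTwo n1 n2]
          rw [this, c1] at h1; omega
        · rw [partner_cup_right a (by rw [insertTwo_removeTwo n1 n2, h1.2.2.1]), e0,
            removeTwo_insertTwo]
        · rw [← hel, ← hel, insertTwo_removeTwo n1 n2, h1.2.2.2, hei']
          have := hJ.2.2.2
          rw [c1, hei] at this
          cases hx : X[insertTwo i j]? with
          | none => simp [hx] at this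
          | some b => rw [hx] at this; simp at this ⊢; exact this
      · by_cases c2 : partner w (insertTwo i j) = i + 1
        · rw [partner_cup_right a c2]
          have e0 : partner w (i + 1) = insertTwo i j := by
            have := hJ.2.2.1
            rwa [c2] at this
          have n1 : partner w i ≠ i := h0.2.1
          have n2 : partner w i ≠ i + 1 := by
            intro e; rw [e, e0] at h0; exact hJ1 h0.2.2.1
          refine ⟨removeTwo_lt h0.1 n1 n2 hl, ?_, ?_, ?_⟩
          · intro e
            have : partner w i = insertTwo i j := by rw [← e, insertTwo_removeTwo n1 n2]
            rw [this, c2] at h0; omega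
          · rw [partner_cup_left a (by rw [insertTwo_removeTwo n1 n2, h0.2.2.1]), e0,
              removeTwo_insertTwo]
          · rw [← hel, ← hel, insertTwo_removeTwo n1 n2, h0.2.2.2, hei]
            have := hJ.2.2.2
            rw [c2, hei'] at this
            cases hx : X[insertTwo i j]? with
            | none => simp [hx] at this
            | some b => rw [hx] at this; simp at this ⊢; exact this
        · rw [partner_cup_of_ne a c1 c2]
          refine ⟨removeTwo_lt hJ.1 c1 c2 hl, ?_, ?_, ?_⟩
          · intro e
            exact hJ.2.1 (by rw [← insertTwo_removeTwo c1 c2, e])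
          · rw [partner_cup_of_ne a, insertTwo_removeTwo c1 c2, hJ.2.2.1, removeTwo_insertTwo]
            · rw [insertTwo_removeTwo c1 c2, hJ.2.2.1]; exact hJ1
            · rw [insertTwo_removeTwo c1 c2, hJ.2.2.1]; exact hJ2
          · rw [← hel, ← hel, insertTwo_removeTwo c1 c2, hJ.2.2.2]
    | cap l r a =>
      intro j hj
      have hlen : (l ++ a :: (!a) :: r).length = (l ++ r).length + 2 := by simp; omega
      have hl : l.length ≤ (l ++ r).length := by simp
      generalize hn : (l ++ r).length = n at *
      generalize hi : l.length = i at *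
      have hel : ∀ k, (l ++ a :: (!a) :: r)[insertTwo i k]? = (l ++ r)[k]? := by
        subst hi; exact getElem?_insertTwo l r a _
      have hei : (l ++ a :: (!a) :: r)[i]? = some a := by
        subst hi; simp
      have hei' : (l ++ a :: (!a) :: r)[i + 1]? = some (!a) := by
        subst hi; simp
      generalize (l ++ a :: (!a) :: r) = X at *
      rw [hlen] at hj ⊢
      simp only [partner]
      by_cases c1 : j = i
      · subst c1
        simp only [if_true, hei, hei']
        refine ⟨by omega, by omega, by simp, by simp⟩
      · by_cases c2 : j = i + 1
        · subst c2
          simp only [if_true, hei']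
          refine ⟨by simp; omega, by simp, by simp, by simp [hei]⟩
        · simp only [c1, c2, if_false]
          have hJ := ih (removeTwo i j) (removeTwo_lt hj c1 c2 hl)
          refine ⟨insertTwo_lt hJ.1, ?_, ?_, ?_⟩
          · intro e
            exact hJ.2.1 (by conv_rhs => rw [← e, removeTwo_insertTwo])
          · rw [if_neg (insertTwo_ne _ _), if_neg (insertTwo_ne_succ _ _), removeTwo_insertTwo,
              hJ.2.2.1, insertTwo_removeTwo c1 c2]
          · rw [hel, hJ.2.2.2, ← hel, insertTwo_removeTwo c1 c2]
    | cross l r a b s =>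
      intro j hj
      have hlen : (l ++ a :: b :: r).length = (l ++ b :: a :: r).length := by simp
      have hl : l.length + 1 < (l ++ b :: a :: r).length := by simp
      rw [hlen] at hj ⊢
      have hJ := ih _ (swap_lt hl hj)
      simp only [partner]
      refine ⟨swap_lt hl hJ.1, ?_, ?_, ?_⟩
      · intro e
        exact hJ.2.1 (by conv_rhs => rw [← e, Equiv.swap_apply_self])
      · rw [Equiv.swap_apply_self, hJ.2.2.1, Equiv.swap_apply_self]
      · rw [getElem?_swap, hJ.2.2.2, getElem?_swap]

theorem Runs.partner_lt {w : List Slice} {x : List Bool} (h : Runs w x []) {j : ℕ}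
    (hj : j < x.length) : partner w j < x.length := (partner_spec h rfl j hj).1

theorem Runs.partner_ne {w : List Slice} {x : List Bool} (h : Runs w x []) {j : ℕ}
    (hj : j < x.length) : partner w j ≠ j := (partner_spec h rfl j hj).2.1

theorem Runs.partner_partner {w : List Slice} {x : List Bool} (h : Runs w x []) {j : ℕ}
    (hj : j < x.length) : partner w (partner w j) = j := (partner_spec h rfl j hj).2.2.1

theorem Runs.getElem?_partner {w : List Slice} {x : List Bool} (h : Runs w x []) {j : ℕ}
    (hj : j < x.length) : x[partner w j]? = (x[j]?).map not := (partner_spec h rfl j hj).2.2.2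

/-- A labelling of the ends that is constant along the strands of `w`. -/
def Matched (w : List Slice) {α : Type*} (s : List α) : Prop :=
  ∀ j < s.length, s[j]? = s[partner w j]?

theorem matched_cap {α : Type*} (w : List Slice) (l r : List α) (u v : α) :
    Matched ((l.length, .cap) :: w) (l ++ u :: v :: r) ↔ u = v ∧ Matched w (l ++ r) := by
  have hi : (l ++ u :: v :: r)[l.length]? = some u := by simp
  have hi' : (l ++ u :: v :: r)[l.length + 1]? = some v := by simp
  have hlen : (l ++ u :: v :: r).length = (l ++ r).length + 2 := by simp; omega
  constructor
  · intro h
    constructor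
    · have := h l.length (by simp)
      simp only [partner, if_true, hi, hi'] at this
      simpa using this
    · intro j hj
      have := h (insertTwo l.length j) (by rw [hlen]; exact insertTwo_lt hj)
      simpa only [partner, insertTwo_ne, insertTwo_ne_succ, if_false, removeTwo_insertTwo,
        getElem?_insertTwo] using this
  · rintro ⟨rfl, h⟩ j hj
    simp only [partner]
    by_cases c1 : j = l.length
    · subst c1; simp only [if_true, hi, hi']
    · by_cases c2 : j = l.length + 1
      · subst c2; simp
      · simp only [c1, c2, if_false]
        have := h _ (removeTwo_lt (by rw [← hlen]; exact hj) c1 c2 (by simp))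
        rw [getElem?_insertTwo, ← this, ← getElem?_insertTwo l r u u, insertTwo_removeTwo c1 c2]

theorem matched_cross {α : Type*} (w : List Slice) (l r : List α) (u v : α) (c : Bool) :
    Matched ((l.length, .cross c) :: w) (l ++ u :: v :: r) ↔ Matched w (l ++ v :: u :: r) := by
  have hlen : (l ++ u :: v :: r).length = (l ++ v :: u :: r).length := by simp
  have hl : l.length + 1 < (l ++ v :: u :: r).length := by simp
  constructor
  · intro h j hj
    have := h _ (by rw [hlen]; exact swap_lt hl hj)
    simpa only [partner, Equiv.swap_apply_self, getElem?_swap] using this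
  · intro h j hj
    have := h _ (swap_lt hl (by rw [← hlen]; exact hj))
    simpa only [partner, getElem?_swap] using this

theorem Matched.of_cup {α : Type*} {w : List Slice} {l r : List α} {z : α} {a : Bool}
    (hr : ∀ j < (l ++ r).length + 2, partner w j ≠ j ∧ partner w (partner w j) = j ∧
      partner w j < (l ++ r).length + 2)
    (h : Matched w (l ++ z :: z :: r)) : Matched ((l.length, .cup a) :: w) (l ++ r) := by
  intro j hj
  have hlen : (l ++ z :: z :: r).length = (l ++ r).length + 2 := by simp; omega
  have hl : l.length ≤ (l ++ r).length := by simp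
  have hi : (l ++ z :: z :: r)[l.length]? = some z := by simp
  have hi' : (l ++ z :: z :: r)[l.length + 1]? = some z := by simp
  have hJ := h (insertTwo l.length j) (by rw [hlen]; exact insertTwo_lt hj)
  have h0 := h l.length (by omega)
  have h1 := h (l.length + 1) (by omega)
  have pJ := hr (insertTwo l.length j) (insertTwo_lt hj)
  have p0 := hr l.length (by omega)
  have p1 := hr (l.length + 1) (by omega)
  have hJ1 := insertTwo_ne l.length j
  have hJ2 := insertTwo_ne_succ l.length j
  rw [getElem?_insertTwo] at hJ
  rw [hi] at h0
  rw [hi'] at h1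
  by_cases c1 : partner w (insertTwo l.length j) = l.length
  · have n1 : partner w (l.length + 1) ≠ l.length := by
      intro e
      have e1 := p1.2.1
      have e2 := pJ.2.1
      rw [e] at e1; rw [c1] at e2; omega
    rw [partner_cup_left a c1, ← getElem?_insertTwo l r z z (removeTwo _ _), insertTwo_removeTwo n1 p1.1, ← h1, hJ,
      c1, hi]
  · by_cases c2 : partner w (insertTwo l.length j) = l.length + 1
    · have n1 : partner w l.length ≠ l.length + 1 := by
        intro e
        have e1 := p0.2.1
        have e2 := pJ.2.1
        rw [e] at e1; rw [c2] at e2; omega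
      rw [partner_cup_right a c2, ← getElem?_insertTwo l r z z (removeTwo _ _), insertTwo_removeTwo p0.1 n1, ← h0,
        hJ, c2, hi']
    · rw [partner_cup_of_ne a c1 c2, ← getElem?_insertTwo l r z z (removeTwo _ _), insertTwo_removeTwo c1 c2, hJ]

/-- The label `z` of the cup must agree with the label at the far end of the strand through its left
leg. If the cup closes a component, that end is the right leg and `z` is free. -/
theorem Matched.cup {α : Type*} {w : List Slice} {l r : List α} {z : α} {a : Bool}
    (hr : ∀ j < (l ++ r).length + 2, partner w j ≠ j ∧ partner w (partner w j) = j ∧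
      partner w j < (l ++ r).length + 2)
    (h : Matched ((l.length, .cup a) :: w) (l ++ r))
    (hz : (l ++ z :: z :: r)[partner w l.length]? = some z) : Matched w (l ++ z :: z :: r) := by
  have hlen : (l ++ z :: z :: r).length = (l ++ r).length + 2 := by simp; omega
  have hl : l.length ≤ (l ++ r).length := by simp
  have hi : (l ++ z :: z :: r)[l.length]? = some z := by simp
  have hi' : (l ++ z :: z :: r)[l.length + 1]? = some z := by simp
  have p0 := hr l.length (by omega)
  have p1 := hr (l.length + 1) (by omega)
  have hz' : (l ++ z :: z :: r)[partner w (l.length + 1)]? = some z := by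
    by_cases c : partner w l.length = l.length + 1
    · rw [← c, p0.2.1, hi]
    · have n2 : partner w (l.length + 1) ≠ l.length := by
        intro e; have := p1.2.1; rw [e] at this; exact c this
      have hj := removeTwo_lt p0.2.2 p0.1 c hl
      have := h _ hj
      rw [partner_cup_left a (by rw [insertTwo_removeTwo p0.1 c, p0.2.1]),
        ← getElem?_insertTwo l r z z, ← getElem?_insertTwo l r z z, insertTwo_removeTwo p0.1 c,
        insertTwo_removeTwo n2 p1.1, hz] at this
      exact this.symm
  intro j hj
  by_cases c1 : j = l.length
  · rw [c1, hz, hi]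
  · by_cases c2 : j = l.length + 1
    · rw [c2, hz', hi']
    · rw [hlen] at hj
      have pj := hr j hj
      have := h _ (removeTwo_lt hj c1 c2 hl)
      rw [← getElem?_insertTwo l r z z, insertTwo_removeTwo c1 c2] at this
      rw [this]
      by_cases d1 : partner w j = l.length
      · have e := pj.2.1
        rw [d1] at e
        rw [e, this] at hz
        rw [d1, hi, hz]
      · by_cases d2 : partner w j = l.length + 1
        · have e := pj.2.1
          rw [d2] at e
          rw [e, this] at hz'
          rw [d2, hi', hz']
        · rw [partner_cup_of_ne a, ← getElem?_insertTwo l r z z, insertTwo_removeTwo c1 c2,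
            insertTwo_removeTwo d1 d2]
          · rwa [insertTwo_removeTwo c1 c2]
          · rwa [insertTwo_removeTwo c1 c2]

theorem weight_one {N : ℕ} (a b c : Bool) (x y u v : Fin N) :
    weight (1 : ℤˣ) a b c x y u v = if x = v ∧ y = u then 1 else 0 := by
  have hq : ∀ k, qpow (1 : ℤˣ) k = 1 := by intro k; simp [qpow]
  have ht : ∀ (c : Bool) (x y : Fin N), touchWeight (1 : ℤˣ) c x y = 0 := by
    intro c x y; simp [touchWeight, hq]
  cases a <;> cases b <;>
    simp only [weight, upWeight, hq, ht, ite_self, add_zero, one_mul, mul_one]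
  · simp only [eq_comm]
  · simp only [eq_comm, and_comm]
  · simp only [eq_comm, and_comm]

theorem act_append {N : ℕ} (l r : List (Bool × Fin N)) (p : Piece)
    (F : List (Bool × Fin N) → ℤ) :
    act (1 : ℤˣ) l.length p F (l ++ r) = act (1 : ℤˣ) 0 p (fun t => F (l ++ t)) r := by
  induction l generalizing F with
  | nil => rfl
  | cons h l ih =>
    simp only [List.length_cons, List.cons_append, act]
    exact ih _

open Classical in
/-- At `q = 1`, the state sum counts labellings that are constant along the strands. -/
theorem stateSum_one {w : List Slice} {x z : List Bool} (h : Runs w x z) (hz : z = [])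
    (s : List (Bool × Fin 2)) (hs : s.map Prod.fst = x) :
    stateSum (1 : ℤˣ) w (fun _ => 1) s =
      if Matched w (s.map Prod.snd) then 2 ^ loops w else 0 := by
  have hq : ∀ k, qpow (1 : ℤˣ) k = 1 := by intro k; simp [qpow]
  induction h generalizing s with
  | nil x =>
    subst hz
    obtain rfl : s = [] := by simpa using hs
    simp [stateSum, loops, Matched]
  | cons hg hw ih =>
    specialize ih hz
    rename_i g w x y z
    subst hz
    cases hg with
    | cup l r a =>
      obtain ⟨sl, sr, rfl, hsl, hsr⟩ := List.map_eq_append_iff.1 hs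
      have hll : l.length = sl.length := by simp [← hsl]
      have hlen : (sl.map Prod.snd ++ sr.map Prod.snd).length + 2 =
          (l ++ a :: (!a) :: r).length := by simp [← hsl, ← hsr]; omega
      have hr : ∀ j < (sl.map Prod.snd ++ sr.map Prod.snd).length + 2,
          partner w j ≠ j ∧ partner w (partner w j) = j ∧
          partner w j < (sl.map Prod.snd ++ sr.map Prod.snd).length + 2 := by
        rw [hlen]
        exact fun j hj => ⟨hw.partner_ne hj, hw.partner_partner hj, hw.partner_lt hj⟩
      rw [stateSum, hll, act_append, act]
      simp only [hq, one_mul]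
      have hih : ∀ u : Fin 2, stateSum (1 : ℤˣ) w (fun _ => 1) (sl ++ (a, u) :: (!a, u) :: sr) =
          if Matched w (sl.map Prod.snd ++ u :: u :: sr.map Prod.snd) then 2 ^ loops w else 0 := by
        intro u
        rw [ih _ (by simp [hsl, hsr])]
        simp
      simp only [hih, List.map_append]
      have hsl' : sl.length = (sl.map Prod.snd).length := by simp
      generalize sl.map Prod.snd = L at *
      generalize sr.map Prod.snd = R at *
      rw [hsl']
      have p0 := hr L.length (by simp; omega)
      by_cases hm : Matched ((L.length, .cup a) :: w) (L ++ R)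
      · rw [if_pos hm]
        -- A cup that closes a component may carry either of the two labels, whence a factor `2`.
        -- Otherwise its label is forced to be the one at the far end of the strand.
        by_cases c : partner w L.length = L.length + 1
        · have : ∀ u, Matched w (L ++ u :: u :: R) := fun u => hm.cup hr (by rw [c]; simp)
          simp [this, loops, c, pow_succ, mul_comm]
        · have hj := removeTwo_lt p0.2.2 p0.1 c (by simp)
          obtain ⟨v, hv⟩ : ∃ v, (L ++ R)[removeTwo L.length (partner w L.length)]? = some v :=
            ⟨_, List.getElem?_eq_getElem hj⟩
          have hv' : ∀ u, (L ++ u :: u :: R)[partner w L.length]? = some v := by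
            intro u
            rw [← hv, ← getElem?_insertTwo L R u u, insertTwo_removeTwo p0.1 c]
          have : ∀ u, Matched w (L ++ u :: u :: R) ↔ u = v := by
            intro u
            constructor
            · intro h
              have := h L.length (by simp)
              rw [hv'] at this
              simpa using this
            · rintro rfl; exact hm.cup hr (hv' u)
          simp [this, loops, c]
      · have : ∀ u, ¬ Matched w (L ++ u :: u :: R) := fun u h => hm (h.of_cup hr)
        simp [this, hm]
    | cap l r a =>
      obtain ⟨sl, sr, rfl, hsl, hsr⟩ := List.map_eq_append_iff.1 hs
      match sr, hsr with
      | (a', u) :: (b', v) :: sr, hsr =>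
        simp only [List.map_cons, List.cons.injEq] at hsr
        obtain ⟨rfl, rfl, hsr'⟩ := hsr
        have hll : l.length = sl.length := by simp [← hsl]
        have hll' : sl.length = (sl.map Prod.snd).length := by simp
        have hm := matched_cap w (sl.map Prod.snd) (sr.map Prod.snd) u v
        rw [stateSum, hll, act_append, act, ih (sl ++ sr) (by simp [hsl, hsr']), hq]
        rw [← hll'] at hm
        simp only [List.map_append, List.map_cons, hm, loops, true_and, one_mul]
        by_cases huv : u = v <;> simp [huv]
    | cross l r a b c =>
      obtain ⟨sl, sr, rfl, hsl, hsr⟩ := List.map_eq_append_iff.1 hs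
      match sr, hsr with
      | (a', u) :: (b', v) :: sr, hsr =>
        simp only [List.map_cons, List.cons.injEq] at hsr
        obtain ⟨rfl, rfl, hsr'⟩ := hsr
        have hll : l.length = sl.length := by simp [← hsl]
        have hll' : sl.length = (sl.map Prod.snd).length := by simp
        have hm := matched_cross w (sl.map Prod.snd) (sr.map Prod.snd) u v c
        rw [stateSum, hll, act_append, act]
        simp only [weight_one, ite_and, ite_mul, one_mul, zero_mul, Finset.sum_ite_eq,
          Finset.mem_univ, if_true]
        rw [ih _ (by simp [hsl, hsr'])]
        rw [← hll'] at hm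
        simp only [List.map_append, List.map_cons, hm, loops]

/-- Both parts are read off from the invariant state sum at `q = 1`: a constant labelling always
matches, so it gives `2 ^ loops`, and a labelling matches if and only if its state sum is nonzero.
-/
theorem Iso.matched_loops {x : List Bool} {w w' : List Slice} (h : Iso x [] w w') :
    loops w = loops w' ∧ ∀ s : List (Fin 2), s.length = x.length → (Matched w s → Matched w' s) := by
  classical
  have key : ∀ s : List (Fin 2), s.length = x.length →
      (if Matched w s then (2 : ℤ) ^ loops w else 0) = if Matched w' s then 2 ^ loops w' else 0 := by
    intro s hs
    have h1 : (x.zip s).map Prod.fst = x := List.map_fst_zip (by omega)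
    have h2 : (x.zip s).map Prod.snd = s := List.map_snd_zip (by omega)
    have := h.stateSum_eq (1 : ℤˣ) (fun _ => 1) (x.zip s) h1
    rwa [stateSum_one h.1 rfl _ h1, stateSum_one h.2.1 rfl _ h1, h2] at this
  constructor
  · have hm : ∀ v : List Slice, Runs v x [] → Matched v (List.replicate x.length (0 : Fin 2)) := by
      intro v hv j hj
      rw [List.length_replicate] at hj
      simp [hj, hv.partner_lt hj]
    have := key (List.replicate x.length 0) (by simp)
    rw [if_pos (hm _ h.1), if_pos (hm _ h.2.1)] at this
    exact Nat.pow_right_injective le_rfl (by exact_mod_cast this)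
  · intro s hs hm
    have := key s hs
    rw [if_pos hm] at this
    by_contra hm'
    rw [if_neg hm'] at this
    simp at this

theorem Iso.loops_eq {x : List Bool} {w w' : List Slice} (h : Iso x [] w w') :
    loops w = loops w' := h.matched_loops.1

/-- The two ends of the strand of `w` through `j` get the label `1`, all other ends the label `0`.
This labelling matches `w`, hence `w'`, which leaves only one possible partner. -/
theorem Iso.partner_eq {x : List Bool} {w w' : List Slice} (h : Iso x [] w w') {j : ℕ}
    (hj : j < x.length) : partner w j = partner w' j := by
  classical
  let s : List (Fin 2) := (List.range x.length).map fun k => if k = j ∨ k = partner w j then 1 else 0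
  have hs : s.length = x.length := by simp [s]
  have hget : ∀ k < x.length, s[k]? = some (if k = j ∨ k = partner w j then 1 else 0) := by
    intro k hk
    simp [s, hk]
  have hm : Matched w s := by
    intro k hk
    rw [hs] at hk
    rw [hget k hk, hget _ (h.1.partner_lt hk)]
    congr 2
    refine propext ⟨?_, ?_⟩
    · rintro (rfl | rfl)
      · exact Or.inr rfl
      · exact Or.inl (h.1.partner_partner hj)
    · rintro (e | e)
      · right; rw [← e, h.1.partner_partner hk]
      · left; rw [← h.1.partner_partner hk, e, h.1.partner_partner hj]
  have := h.matched_loops.2 s hs hm j (by rw [hs]; exact hj)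
  rw [hget j hj, hget _ (h.2.1.partner_lt hj)] at this
  simp only [true_or, if_true, Option.some.injEq] at this
  have h3 : partner w' j = j ∨ partner w' j = partner w j := by
    by_contra hc
    rw [if_neg hc] at this
    exact absurd this (by decide)
  rcases h3 with h3 | h3
  · exact absurd h3 (h.2.1.partner_ne hj)
  · exact h3.symm

end PlanarTangle
namespace PlanarTangle

/-! ### Crossing changes and descending diagrams -/

/-- A slice, up to the sign of its crossing. -/
def Slice.forget : Slice → Slice
  | (i, .cross _) => (i, .cross true)
  | (i, .cup a) => (i, .cup a)
  | (i, .cap) => (i, .cap)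

/-- A diagram, up to crossing changes. -/
def shadow (w : List Slice) : List Slice := w.map Slice.forget

@[simp] theorem shadow_nil : shadow [] = [] := rfl

@[simp] theorem shadow_cons (g : Slice) (w : List Slice) :
    shadow (g :: w) = g.forget :: shadow w := rfl

theorem forget_eq {i : ℕ} {p : Piece} {g : Slice} (h : g.forget = Slice.forget (i, p)) :
    ∃ p', g = (i, p') ∧ p'.lower = p.lower ∧ p'.upper = p.upper ∧
      ∀ i', Slice.forget (i', p') = Slice.forget (i', p) := by
  obtain ⟨j, q⟩ := g
  cases q <;> cases p <;> simp only [Slice.forget, Prod.mk.injEq, reduceCtorEq, and_false] at h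
  · obtain ⟨rfl, h⟩ := h
    simp only [Piece.cup.injEq] at h
    subst h
    exact ⟨_, rfl, rfl, rfl, fun _ => rfl⟩
  · obtain ⟨rfl, _⟩ := h
    exact ⟨_, rfl, rfl, rfl, fun _ => rfl⟩
  · obtain ⟨rfl, _⟩ := h
    exact ⟨_, rfl, rfl, rfl, fun _ => rfl⟩

theorem shadow_eq_cons {v w : List Slice} {g : Slice} (h : shadow v = shadow (g :: w)) :
    ∃ g' v', v = g' :: v' ∧ g'.forget = g.forget ∧ shadow v' = shadow w := by
  obtain ⟨g', v', rfl, h1, h2⟩ := List.map_eq_cons_iff.1 h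
  exact ⟨g', v', rfl, h1, h2⟩

theorem stepAt_forget (g : Slice) : stepAt g.forget.1 g.forget.2 = stepAt g.1 g.2 := by
  obtain ⟨i, p⟩ := g
  cases p <;> try rfl
  rename_i s
  funext x
  simp only [Slice.forget]
  induction i generalizing x with
  | zero =>
    match x with
    | [] => rfl
    | [_] => rfl
    | _ :: _ :: _ => rfl
  | succ i ih =>
    match x with
    | [] => rfl
    | a :: x => simp [stepAt, ih]

theorem run_shadow (w : List Slice) (x : List Bool) : run (shadow w) x = run w x := by
  induction w generalizing x with
  | nil => rfl
  | cons g w ih => simp only [shadow_cons, run, stepAt_forget, ih]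

theorem partner_shadow (w : List Slice) : partner (shadow w) = partner w := by
  induction w with
  | nil => rfl
  | cons g w ih => obtain ⟨i, _ | _ | _⟩ := g <;> funext j <;> simp [Slice.forget, partner, ih]

theorem loops_shadow (w : List Slice) : loops (shadow w) = loops w := by
  induction w with
  | nil => rfl
  | cons g w ih => obtain ⟨i, _ | _ | _⟩ := g <;> simp [Slice.forget, loops, ih, partner_shadow]

theorem crossings_shadow (w : List Slice) : crossings (shadow w) = crossings w := by
  induction w with
  | nil => rfl
  | cons g w ih => obtain ⟨i, _ | _ | _⟩ := g <;> simp [Slice.forget, crossings, ih]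

theorem crossings_append (v w : List Slice) :
    crossings (v ++ w) = crossings v + crossings w := by
  induction v with
  | nil => simp [crossings]
  | cons g v ih =>
    obtain ⟨i, _ | _ | _⟩ := g <;> simp [crossings, ih]; omega

section
variable {v w : List Slice} (h : shadow v = shadow w)
include h

theorem runs_iff_of_shadow (x y : List Bool) : Runs v x y ↔ Runs w x y := by
  rw [runs_iff, runs_iff, ← run_shadow, h, run_shadow]

theorem partner_eq_of_shadow : partner v = partner w := by
  rw [← partner_shadow, h, partner_shadow]

theorem loops_eq_of_shadow : loops v = loops w := by
  rw [← loops_shadow, h, loops_shadow]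

theorem crossings_eq_of_shadow : crossings v = crossings w := by
  rw [← crossings_shadow, h, crossings_shadow]

end

/-! ### Pulling off a strand -/

/-- Positions of the other strands after the strands `j` and `j + k + 1` have been removed. -/
def removePair (j k m : ℕ) : ℕ := if m < j then m else if m < j + k + 1 then m - 1 else m - 2

theorem partner_pull_left (j k : ℕ) (v : List Slice) : partner (pull j k ++ v) j = j + k + 1 := by
  induction k generalizing j with
  | zero => simp [pull, overRight, partner]
  | succ k ih =>
    rw [pull_succ, List.cons_append, partner, Equiv.swap_apply_left, ih,
      Equiv.swap_apply_of_ne_of_ne (by omega) (by omega)]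
    omega

theorem partner_pull (j k : ℕ) (v : List Slice) {m : ℕ} (h : m ≠ j) (h' : m ≠ j + k + 1) :
    partner (pull j k ++ v) m ≠ j ∧ partner (pull j k ++ v) m ≠ j + k + 1 ∧
      removePair j k (partner (pull j k ++ v) m) = partner v (removePair j k m) := by
  induction k generalizing j m with
  | zero =>
    have hr : ∀ m, m ≠ j → m ≠ j + 1 → removePair j 0 m = removeTwo j m := by
      intro m h h'
      unfold removePair removeTwo
      split_ifs <;> omega
    have e : partner (pull j 0 ++ v) m = insertTwo j (partner v (removeTwo j m)) := by
      have h'' : m ≠ j + 1 := h'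
      simp [pull, overRight, partner, h, h'']
    rw [e, hr m h h', hr _ (insertTwo_ne _ _) (insertTwo_ne_succ _ _), removeTwo_insertTwo]
    exact ⟨insertTwo_ne _ _, insertTwo_ne_succ _ _, rfl⟩
  | succ k ih =>
    have hr : ∀ m, m ≠ j → removePair j (k + 1) m =
        removePair (j + 1) k (Equiv.swap j (j + 1) m) := by
      intro m h
      by_cases h2 : m = j + 1
      · subst h2
        rw [Equiv.swap_apply_right]
        unfold removePair
        split_ifs <;> omega
      · rw [Equiv.swap_apply_of_ne_of_ne h h2]
        unfold removePair
        split_ifs <;> omega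
    have hs : ∀ a b, a = Equiv.swap j (j + 1) b ↔ b = Equiv.swap j (j + 1) a := by
      intro a b
      constructor <;> rintro rfl <;> simp
    have hM : Equiv.swap j (j + 1) m ≠ j + 1 := by
      intro e
      apply h
      rw [← Equiv.swap_apply_self j (j + 1) m, e, Equiv.swap_apply_right]
    have hM' : Equiv.swap j (j + 1) m ≠ j + 1 + k + 1 := by
      intro e
      apply h'
      rw [← Equiv.swap_apply_self j (j + 1) m, e,
        Equiv.swap_apply_of_ne_of_ne (by omega) (by omega)]
      omega
    obtain ⟨i1, i2, i3⟩ := ih (j + 1) hM hM'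
    have e : partner (pull j (k + 1) ++ v) m =
        Equiv.swap j (j + 1) (partner (pull (j + 1) k ++ v) (Equiv.swap j (j + 1) m)) := by
      rw [pull_succ]; rfl
    rw [e]
    generalize partner (pull (j + 1) k ++ v) (Equiv.swap j (j + 1) m) = P at *
    have n1 : Equiv.swap j (j + 1) P ≠ j := by
      intro e
      apply i1
      rw [← Equiv.swap_apply_self j (j + 1) P, e, Equiv.swap_apply_left]
    refine ⟨n1, ?_, ?_⟩
    · intro e
      apply i2
      rw [← Equiv.swap_apply_self j (j + 1) P, e,
        Equiv.swap_apply_of_ne_of_ne (by omega) (by omega)]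
      omega
    · rw [hr _ n1, Equiv.swap_apply_self, i3, hr _ h]

theorem loops_pull (j k : ℕ) (v : List Slice) : loops (pull j k ++ v) = loops v := by
  induction k generalizing j with
  | zero => simp [pull, overRight, loops]
  | succ k ih => rw [pull_succ]; exact ih (j + 1)

theorem Step.length_eq {g : Slice} {x y : List Bool} (h : Step g x y) :
    g.1 + g.2.lower ≤ x.length ∧ x.length + g.2.upper = y.length + g.2.lower :=
  stepAt_length_le ((step_iff g.1 g.2 x y).1 h)

theorem runs_pull_length {j k : ℕ} {x y : List Bool} (h : Runs (pull j k) x y) :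
    x.length = y.length + 2 := by
  induction k generalizing j x with
  | zero =>
    obtain ⟨z, hz, h⟩ := (runs_cons_iff _ _ _ _).1 h
    cases h
    simpa [Piece.lower, Piece.upper] using hz.length_eq.2
  | succ k ih =>
    rw [pull_succ] at h
    obtain ⟨z, hz, h⟩ := (runs_cons_iff _ _ _ _).1 h
    have := hz.length_eq.2
    have := ih h
    simp only [Piece.lower, Piece.upper] at *
    omega

/-- For a suitable choice of the crossings of `w`, and for every choice of the crossings of `v`,
the strand of `w` that joins the ends `j` and `j + k + 1` can be pulled off, and `v` remains. -/
def Pulls (w v : List Slice) (j k : ℕ) : Prop :=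
  ∀ v', shadow v' = shadow v → ∃ w', shadow w' = shadow w ∧ Red w' (pull j k ++ v')

/-- A slice that survives in `v` takes whatever sign `v'` prescribes, so the isotopy is required for
every piece `p'` with as many ends as `p`. -/
theorem Pulls.slice {w v : List Slice} {i i' j j' k k' : ℕ} {p : Piece} (h : Pulls w v j' k')
    (hr : ∀ p' : Piece, p'.lower = p.lower → p'.upper = p.upper →
      Red ((i, p') :: pull j' k') (pull j k ++ [(i', p')])) :
    Pulls ((i, p) :: w) ((i', p) :: v) j k := by
  intro v' hv'
  obtain ⟨g, v', rfl, hg, hv⟩ := shadow_eq_cons hv'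
  obtain ⟨p', rfl, h1, h2, h3⟩ := forget_eq hg
  obtain ⟨w', hw, hr'⟩ := h v' hv
  refine ⟨(i, p') :: w', by simp [hw, h3], ?_⟩
  calc Red _ ((i, p') :: (pull j' k' ++ v')) := hr'.cons _
    Red _ ((pull j k ++ [(i', p')]) ++ v') := (hr p' h1 h2).append_right v'
    Red _ _ := .of_eq (by simp)

theorem Pulls.slice_left {w v : List Slice} {i j j' k : ℕ} {p : Piece} (h : Pulls w v j' k)
    (h1 : i + p.upper ≤ j') (h2 : j + p.upper = j' + p.lower) :
    Pulls ((i, p) :: w) ((i, p) :: v) j k :=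
  h.slice fun p' hl hu => red_pull_left k (by rwa [hu]) (by rwa [hl, hu])

/-- A crossing that is swallowed by the pulled strand does not occur in `v`; its sign can be chosen
so that the strand lies on top. -/
theorem Pulls.absorb {w v : List Slice} {i j j' k k' : ℕ} {p : Piece} (p' : Piece)
    (hp : Slice.forget (i, p') = Slice.forget (i, p)) (h : Pulls w v j' k')
    (hr : Red ((i, p') :: pull j' k') (pull j k)) : Pulls ((i, p) :: w) v j k := by
  intro v' hv'
  obtain ⟨w', hw, hr'⟩ := h v' hv'
  refine ⟨(i, p') :: w', by simp [hw, hp], ?_⟩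
  exact (hr'.cons _).trans (hr.append_right v')

/-- The strand through the cup consists of two strands above it, which are pulled off in succession.
The second one prescribes crossings of the intermediate diagram `v₁`, which the quantifier in
`Pulls` allows. -/
theorem Pulls.cup {w v v₁ : List Slice} {i j j₁ j₂ k k₁ k₂ : ℕ} {a : Bool} {m : List Slice}
    (h : Pulls w v₁ j₁ k₁) (h' : Pulls v₁ v j₂ k₂)
    (hr : Red ((i, .cup a) :: pull j₁ k₁) m) (hr' : Red (m ++ pull j₂ k₂) (pull j k)) :
    Pulls ((i, .cup a) :: w) v j k := by
  intro v' hv'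
  obtain ⟨v₁', hv₁, hr₁⟩ := h' v' hv'
  obtain ⟨w', hw, hr₂⟩ := h v₁' hv₁
  refine ⟨(i, .cup a) :: w', by simp [hw], ?_⟩
  calc Red _ ((i, .cup a) :: (pull j₁ k₁ ++ v₁')) := hr₂.cons _
    Red _ (m ++ v₁') := hr.append_right v₁'
    Red _ (m ++ (pull j₂ k₂ ++ v')) := hr₁.append_left m
    Red _ ((m ++ pull j₂ k₂) ++ v') := .of_eq (by simp)
    Red _ _ := hr'.append_right v'

theorem Pulls.iso {w v : List Slice} {x : List Bool} {j k : ℕ} (h : Pulls w v j k)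
    (hw : Runs w x []) : ∃ w', shadow w' = shadow w ∧ Iso x [] w' (pull j k ++ v) := by
  obtain ⟨w', h1, h2⟩ := h v rfl
  exact ⟨w', h1, h2 x [] ((runs_iff_of_shadow h1 _ _).2 hw)⟩

theorem Pulls.runs {w v : List Slice} {x : List Bool} {j k : ℕ} (h : Pulls w v j k)
    (hw : Runs w x []) : ∃ y, Runs (pull j k) x y ∧ Runs v y [] ∧ x.length = y.length + 2 := by
  obtain ⟨w', _, h2⟩ := h.iso hw
  obtain ⟨y, hy, hv⟩ := (runs_append_iff _ _ _ _).1 h2.2.1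
  exact ⟨y, hy, hv, runs_pull_length hy⟩

theorem Pulls.partner_eq {w v : List Slice} {x : List Bool} {j k : ℕ} (h : Pulls w v j k)
    (hw : Runs w x []) {m : ℕ} (hm : m < x.length) :
    partner w m = partner (pull j k ++ v) m := by
  obtain ⟨w', h1, h2⟩ := h.iso hw
  rw [← partner_eq_of_shadow h1, h2.partner_eq hm]

theorem Pulls.loops_eq {w v : List Slice} {x : List Bool} {j k : ℕ} (h : Pulls w v j k)
    (hw : Runs w x []) : loops v = loops w := by
  obtain ⟨w', h1, h2⟩ := h.iso hw
  rw [← loops_eq_of_shadow h1, h2.loops_eq, loops_pull]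

theorem Pulls.partner_removePair {w v : List Slice} {x : List Bool} {j k : ℕ} (h : Pulls w v j k)
    (hw : Runs w x []) {m : ℕ} (hm : m < x.length) (hj : m ≠ j) (hk : m ≠ j + k + 1) :
    partner v (removePair j k m) = removePair j k (partner w m) := by
  rw [h.partner_eq hw hm, (partner_pull j k v hj hk).2.2]

/-- The strand is put on top of all others and shrunk towards the lower boundary. The induction
removes the lowest slice and distinguishes its position relative to the two ends. A cup on the
strand needs the induction hypothesis twice, first for `w` and then for what is left of it; the
bound on the length makes this possible. The bound on crossings is for later inductions. -/
theorem exists_pulls (w : List Slice) (x : List Bool) (hx : Runs w x []) (j k : ℕ)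
    (hj : j + k + 1 < x.length) (hp : partner w j = j + k + 1) :
    ∃ v, v.length < w.length ∧ crossings v ≤ crossings w ∧ Pulls w v j k := by
  induction hn : w.length using Nat.strong_induction_on generalizing w x j k with
  | _ n IH =>
  subst hn
  match w, hx with
  | [], hx => cases hx; simp at hj
  | (i, .cap) :: w, hx =>
    obtain ⟨y, hs, hw⟩ := (runs_cons_iff _ _ _ _).1 hx
    obtain ⟨hl1, hl2⟩ := hs.length_eq
    simp only [Piece.lower, Piece.upper] at hl1 hl2
    by_cases c1 : j = i
    · subst c1
      obtain rfl : k = 0 := by simp [partner] at hp; omega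
      exact ⟨w, by simp, by simp [crossings], fun v' hv' =>
        ⟨(j, .cap) :: v', by simp [hv'], .refl _⟩⟩
    have c2 : j ≠ i + 1 := by rintro rfl; simp [partner] at hp; omega
    have hp' : insertTwo i (partner w (removeTwo i j)) = j + k + 1 := by
      simpa [partner, c1, c2] using hp
    have e1 : j + k + 1 ≠ i := by rw [← hp']; exact insertTwo_ne _ _
    have e2 : j + k + 1 ≠ i + 1 := by rw [← hp']; exact insertTwo_ne_succ _ _
    have hp'' : partner w (removeTwo i j) = removeTwo i (j + k + 1) := by
      rw [← hp', removeTwo_insertTwo]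
    unfold removeTwo at hp''
    by_cases c3 : i < j
    · rw [if_neg (by omega), if_neg (by omega)] at hp''
      obtain ⟨v, hv1, hv2, hv3⟩ := IH w.length (by simp) w y hw (j - 2) k (by omega)
        (by rw [hp'']; omega) rfl
      refine ⟨(i, .cap) :: v, by simpa using hv1, by simpa [crossings] using hv2,
        hv3.slice_left (by simp only [Piece.upper]; omega)
          (by simp only [Piece.lower, Piece.upper]; omega)⟩
    · by_cases c4 : j + k + 1 < i
      · rw [if_pos (by omega), if_pos (by omega)] at hp''
        obtain ⟨v, hv1, hv2, hv3⟩ := IH w.length (by simp) w y hw j k (by omega) hp'' rfl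
        obtain ⟨i', rfl⟩ : ∃ i', i = i' + 2 := ⟨i - 2, by omega⟩
        exact ⟨(i', .cap) :: v, by simpa using hv1, by simpa [crossings] using hv2,
          hv3.slice fun p' h1 h2 => red_pull_right p' (by omega)⟩
      · rw [if_pos (by omega), if_neg (by omega)] at hp''
        obtain ⟨d, rfl⟩ : ∃ d, i = j + d + 1 := ⟨i - j - 1, by omega⟩
        obtain ⟨e, rfl⟩ : ∃ e, k = d + 2 + e := ⟨k - d - 2, by omega⟩
        obtain ⟨v, hv1, hv2, hv3⟩ := IH w.length (by simp) w y hw j (d + 0 + e) (by omega)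
          (by rw [hp'']; omega) rfl
        refine ⟨(j + d, .cap) :: v, by simpa using hv1, by simpa [crossings] using hv2,
          hv3.slice fun p' h1 h2 => ?_⟩
        have := red_pull_middle j d e p'
        rwa [h1, h2] at this
  | (i, .cross s) :: w, hx =>
    obtain ⟨y, hs, hw⟩ := (runs_cons_iff _ _ _ _).1 hx
    obtain ⟨hl1, hl2⟩ := hs.length_eq
    simp only [Piece.lower, Piece.upper] at hl1 hl2
    have hp' : partner w (Equiv.swap i (i + 1) j) = Equiv.swap i (i + 1) (j + k + 1) := by
      rw [← hp, partner, Equiv.swap_apply_self]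
    have hlen : ∀ v : List Slice, v.length < w.length → v.length < (w.length + 1) :=
      fun v h => by omega
    have hcr : ∀ v, crossings v ≤ crossings w → crossings v ≤ crossings ((i, .cross s) :: w) :=
      fun v h => by simp only [crossings]; omega
    by_cases c1 : i + 1 < j
    · rw [Equiv.swap_apply_of_ne_of_ne (by omega) (by omega),
        Equiv.swap_apply_of_ne_of_ne (by omega) (by omega)] at hp'
      obtain ⟨v, hv1, hv2, hv3⟩ := IH w.length (by simp) w y hw j k (by omega) hp' rfl
      refine ⟨(i, .cross s) :: v, by simpa using hv1, by simpa [crossings] using hv2,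
        hv3.slice_left (by simp only [Piece.upper]; omega)
          (by simp only [Piece.lower, Piece.upper])⟩
    by_cases c2 : j = i + 1
    · subst c2
      rw [Equiv.swap_apply_right, Equiv.swap_apply_of_ne_of_ne (by omega) (by omega)] at hp'
      obtain ⟨v, hv1, hv2, hv3⟩ := IH w.length (by simp) w y hw i (k + 1) (by omega)
        (by rw [hp']; omega) rfl
      exact ⟨v, hlen v hv1, hcr v hv2, hv3.absorb (.cross false) rfl (red_pull_crossLeft i k)⟩
    by_cases c3 : j = i
    · subst c3
      match k, hj, hp, hp' with
      | 0, hj, hp, hp' =>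
        rw [Equiv.swap_apply_left, add_zero, Equiv.swap_apply_right] at hp'
        have := hw.partner_partner (j := j + 1) (by omega)
        rw [hp'] at this
        obtain ⟨v, hv1, hv2, hv3⟩ := IH w.length (by simp) w y hw j 0 (by omega) this rfl
        exact ⟨v, hlen v hv1, hcr v hv2, hv3.absorb (.cross s) rfl (red_pull_cross j s)⟩
      | k + 1, hj, hp, hp' =>
        rw [Equiv.swap_apply_left, Equiv.swap_apply_of_ne_of_ne (by omega) (by omega)] at hp'
        obtain ⟨v, hv1, hv2, hv3⟩ := IH w.length (by simp) w y hw (j + 1) k (by omega)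
          (by rw [hp']; omega) rfl
        exact ⟨v, hlen v hv1, hcr v hv2, hv3.absorb (.cross true) rfl
          (.of_eq (pull_succ j k).symm)⟩
    rw [Equiv.swap_apply_of_ne_of_ne (a := i) (b := i + 1) (x := j) (by omega) (by omega)] at hp'
    by_cases c4 : i + 1 < j + k + 1
    · rw [Equiv.swap_apply_of_ne_of_ne (by omega) (by omega)] at hp'
      obtain ⟨d, rfl⟩ : ∃ d, i = j + d + 1 := ⟨i - j - 1, by omega⟩
      obtain ⟨e, rfl⟩ : ∃ e, k = d + 2 + e := ⟨k - d - 2, by omega⟩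
      obtain ⟨v, hv1, hv2, hv3⟩ := IH w.length (by simp) w y hw j (d + 2 + e) (by omega) hp' rfl
      refine ⟨(j + d, .cross s) :: v, by simpa using hv1, by simpa [crossings] using hv2,
        hv3.slice fun p' h1 h2 => ?_⟩
      have := red_pull_middle j d e p'
      rwa [h1, h2] at this
    by_cases c5 : i = j + k
    · obtain ⟨k, rfl⟩ : ∃ k', k = k' + 1 := ⟨k - 1, by omega⟩
      rw [show j + (k + 1) + 1 = i + 1 by omega, Equiv.swap_apply_right] at hp'
      obtain ⟨v, hv1, hv2, hv3⟩ := IH w.length (by simp) w y hw j k (by omega)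
        (by rw [hp']; omega) rfl
      subst c5
      exact ⟨v, hlen v hv1, hcr v hv2, hv3.absorb (.cross false) rfl (red_pull_crossIn j k)⟩
    by_cases c6 : i = j + k + 1
    · subst c6
      rw [Equiv.swap_apply_left] at hp'
      obtain ⟨v, hv1, hv2, hv3⟩ := IH w.length (by simp) w y hw j (k + 1) (by omega)
        (by rw [hp']; omega) rfl
      exact ⟨v, hlen v hv1, hcr v hv2, hv3.absorb (.cross true) rfl (red_pull_crossOut j k)⟩
    rw [Equiv.swap_apply_of_ne_of_ne (by omega) (by omega)] at hp'
    obtain ⟨v, hv1, hv2, hv3⟩ := IH w.length (by simp) w y hw j k (by omega) hp' rfl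
    obtain ⟨i', rfl⟩ : ∃ i', i = i' + 2 := ⟨i - 2, by omega⟩
    exact ⟨(i', .cross s) :: v, by simpa using hv1, by simpa [crossings] using hv2,
      hv3.slice fun p' h1 h2 => red_pull_right p' (by omega)⟩
  | (i, .cup a) :: w, hx =>
    obtain ⟨y, hs, hw⟩ := (runs_cons_iff _ _ _ _).1 hx
    obtain ⟨hl1, hl2⟩ := hs.length_eq
    simp only [Piece.lower, Piece.upper] at hl1 hl2
    have q0 := hw.partner_partner (j := i) (by omega)
    have q1 := hw.partner_partner (j := i + 1) (by omega)
    have qJ := hw.partner_partner (j := insertTwo i j) (by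
      rw [show y.length = x.length + 2 from hl2.symm]; exact insertTwo_lt (by omega))
    have m0 := hw.partner_ne (j := i) (by omega)
    have m1 := hw.partner_ne (j := i + 1) (by omega)
    have hJ1 := insertTwo_ne i j
    have hJ2 := insertTwo_ne_succ i j
    -- The two strands of `w` of which the strand through `j` consists.
    have two : ∀ {j₁ k₁ j₂ k₂ : ℕ} {m : List Slice}, j₁ + k₁ + 1 < y.length →
        partner w j₁ = j₁ + k₁ + 1 → j₂ + k₂ + 3 < y.length → (∃ b c, partner w b = c ∧
          b < y.length ∧ b ≠ j₁ ∧ b ≠ j₁ + k₁ + 1 ∧ removePair j₁ k₁ b = j₂ ∧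
          removePair j₁ k₁ c = j₂ + k₂ + 1) →
        Red ((i, .cup a) :: pull j₁ k₁) m → Red (m ++ pull j₂ k₂) (pull j k) →
        ∃ v, v.length < ((i, .cup a) :: w).length ∧ crossings v ≤ crossings ((i, .cup a) :: w) ∧
          Pulls ((i, .cup a) :: w) v j k := by
      rintro j₁ k₁ j₂ k₂ m h1 h2 h3 ⟨b, c, hbc, hb, hb1, hb2, rb, rc⟩ hm hm'
      obtain ⟨v₁, hv1, hv2, hv3⟩ := IH w.length (by simp) w y hw j₁ k₁ h1 h2 rfl
      obtain ⟨y', _, hrv, hy'⟩ := hv3.runs hw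
      have hpv := hv3.partner_removePair hw hb hb1 hb2
      rw [rb, hbc, rc] at hpv
      obtain ⟨v, hu1, hu2, hu3⟩ := IH v₁.length (by simp; omega) v₁ y' hrv j₂ k₂ (by omega) hpv rfl
      exact ⟨v, by simp; omega, by simp only [crossings]; omega, hv3.cup hu3 hm hm'⟩
    by_cases c1 : partner w (insertTwo i j) = i ∨ partner w (insertTwo i j) = i + 1
    · -- The leg `b` belongs to the strand through `j`, the leg `c` to the one through `j + k + 1`.
      obtain ⟨b, c, hbc, hb, hc⟩ : ∃ b c, ((b = i ∧ c = i + 1) ∨ (b = i + 1 ∧ c = i)) ∧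
          partner w (insertTwo i j) = b ∧ partner w c = insertTwo i (j + k + 1) := by
        rcases c1 with c1 | c1
        · refine ⟨i, i + 1, Or.inl ⟨rfl, rfl⟩, c1, ?_⟩
          have n1 : partner w (i + 1) ≠ i := by
            intro e; rw [e] at q1; rw [c1, q1] at qJ; exact hJ2 qJ.symm
          rw [← hp, partner_cup_left a c1, insertTwo_removeTwo n1 m1]
        · refine ⟨i + 1, i, Or.inr ⟨rfl, rfl⟩, c1, ?_⟩
          have n1 : partner w i ≠ i + 1 := by
            intro e; rw [e] at q0; rw [c1, q0] at qJ; exact hJ1 qJ.symm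
          rw [← hp, partner_cup_right a c1, insertTwo_removeTwo m0 n1]
      have hb' : partner w b = insertTwo i j := by rw [← hb, qJ]
      have hc' : partner w (insertTwo i (j + k + 1)) = c := by
        rcases hbc with ⟨rfl, rfl⟩ | ⟨rfl, rfl⟩
        · rw [← hc, q1]
        · rw [← hc, q0]
      unfold insertTwo at hb hb' hc hc'
      -- The cup lies to the left of both ends. The strand to the right end is pulled off first; it
      -- runs to the cup and back over the strands in between, and the detour cancels.
      by_cases c2 : i ≤ j
      · rw [if_neg (by omega)] at hb hb' hc hc'
        rcases hbc with ⟨rfl, rfl⟩ | ⟨rfl, rfl⟩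
        · refine two (j₁ := b + 1) (k₁ := j - b + (k + 1)) (j₂ := b) (k₂ := j - b) (by omega)
            (by rw [hc]; omega) (by omega) ⟨b, _, hb', by omega, by omega, by omega, ?_, ?_⟩
            (red_cup_pull_right b _ a) ?_
          · unfold removePair; split_ifs <;> omega
          · unfold removePair; split_ifs <;> omega
          · have := red_overLeft_pull_of_lt b (j - b) k
            rwa [show b + (j - b) = j by omega] at this
        · refine two (j₁ := c) (k₁ := j - c + (k + 1) + 1) (j₂ := c) (k₂ := j - c) (by omega)
            (by rw [hc]; omega) (by omega) ⟨c + 1, _, hb', by omega, by omega, by omega, ?_, ?_⟩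
            (red_cup_pull_right' c _ a) ?_
          · unfold removePair; split_ifs <;> omega
          · unfold removePair; split_ifs <;> omega
          · have := red_overLeft_pull_of_lt c (j - c) k
            rwa [show c + (j - c) = j by omega] at this
      · rw [if_pos (by omega)] at hb hb'
        obtain ⟨m, rfl⟩ : ∃ m, i = j + m + 1 := ⟨i - j - 1, by omega⟩
        -- A cup between the ends is met on the way from `j` to its partner, and the two passages
        -- add up. A cup beyond the right end gives an overshoot that cancels.
        by_cases c3 : j + m + 1 ≤ j + k + 1
        · rw [if_neg (by omega)] at hc hc'
          have hpull : overRight j m ++ pull (j + m) (k - m) = pull j k := by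
            rw [overRight_pull, show m + (k - m) = k by omega]
          rcases hbc with ⟨rfl, rfl⟩ | ⟨rfl, rfl⟩
          · refine two (j₁ := j) (k₁ := m) (j₂ := j + m) (k₂ := k - m) (by omega)
              hb (by omega) ⟨_, _, hc, by omega, by omega, by omega, ?_, ?_⟩
              (red_cup_pull_left j m a) (.of_eq hpull)
            · unfold removePair; split_ifs <;> omega
            · unfold removePair; split_ifs <;> omega
          · refine two (j₁ := j) (k₁ := m + 1) (j₂ := j + m) (k₂ := k - m) (by omega)
              (by rw [hb]; omega) (by omega) ⟨_, _, hc, by omega, by omega, by omega, ?_, ?_⟩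
              (red_cup_pull_left' j m a) (.of_eq hpull)
            · unfold removePair; split_ifs <;> omega
            · unfold removePair; split_ifs <;> omega
        · rw [if_pos (by omega)] at hc hc'
          have hpull : Red (overRight j m ++ pull (j + k) (m - k - 1)) (pull j k) := by
            have := red_overRight_pull j k (m - k - 1)
            rwa [show k + 1 + (m - k - 1) = m by omega] at this
          rcases hbc with ⟨rfl, rfl⟩ | ⟨rfl, rfl⟩
          · refine two (j₁ := j) (k₁ := m) (j₂ := j + k) (k₂ := m - k - 1) (by omega)
              hb (by omega) ⟨_, _, hc', by omega, by omega, by omega, ?_, ?_⟩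
              (red_cup_pull_left j m a) hpull
            · unfold removePair; split_ifs <;> omega
            · unfold removePair; split_ifs <;> omega
          · refine two (j₁ := j) (k₁ := m + 1) (j₂ := j + k) (k₂ := m - k - 1) (by omega)
              (by rw [hb]; omega) (by omega) ⟨_, _, hc', by omega, by omega, by omega, ?_, ?_⟩
              (red_cup_pull_left' j m a) hpull
            · unfold removePair; split_ifs <;> omega
            · unfold removePair; split_ifs <;> omega
    · push Not at c1
      have hpJ : partner w (insertTwo i j) = insertTwo i (j + k + 1) := by
        rw [← hp, partner_cup_of_ne a c1.1 c1.2, insertTwo_removeTwo c1.1 c1.2]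
      unfold insertTwo at hpJ
      by_cases c2 : i ≤ j
      · rw [if_neg (by omega), if_neg (by omega)] at hpJ
        obtain ⟨v, hv1, hv2, hv3⟩ := IH w.length (by simp) w y hw (j + 2) k (by omega)
          (by rw [hpJ]; omega) rfl
        refine ⟨(i, .cup a) :: v, by simpa using hv1, by simpa [crossings] using hv2,
          hv3.slice_left (by simp only [Piece.upper]; omega)
          (by simp only [Piece.lower, Piece.upper])⟩
      by_cases c3 : i ≤ j + k + 1
      · rw [if_pos (by omega), if_neg (by omega)] at hpJ
        obtain ⟨d, rfl⟩ : ∃ d, i = j + d + 1 := ⟨i - j - 1, by omega⟩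
        obtain ⟨e, rfl⟩ : ∃ e, k = d + 0 + e := ⟨k - d, by omega⟩
        obtain ⟨v, hv1, hv2, hv3⟩ := IH w.length (by simp) w y hw j (d + 2 + e) (by omega)
          (by rw [hpJ]; omega) rfl
        refine ⟨(j + d, .cup a) :: v, by simpa using hv1, by simpa [crossings] using hv2,
          hv3.slice fun p' h1 h2 => ?_⟩
        have := red_pull_middle j d e p'
        rwa [h1, h2] at this
      · rw [if_pos (by omega), if_pos (by omega)] at hpJ
        obtain ⟨v, hv1, hv2, hv3⟩ := IH w.length (by simp) w y hw j k (by omega) hpJ rfl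
        obtain ⟨i', rfl⟩ : ∃ i', i = i' + 2 := ⟨i - 2, by omega⟩
        exact ⟨(i', .cup a) :: v, by simpa using hv1, by simpa [crossings] using hv2,
          hv3.slice fun p' h1 h2 => red_pull_right p' (by omega)⟩

end PlanarTangle

/-! ### Diagrams up to crossing changes, and closed components -/

namespace PlanarTangle

theorem Runs.exists_cup {w : List Slice} (h : Runs w [] []) (hw : w ≠ []) :
    ∃ a v, w = (0, .cup a) :: v ∧ Runs v [a, !a] [] ∧ partner v 0 = 1 := by
  match w, h with
  | [], _ => exact absurd rfl hw
  | (i, p) :: v, h =>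
    obtain ⟨y, hy, hv⟩ := (runs_cons_iff _ _ _ _).1 h
    have hl := (Step.length_eq hy).1
    cases p with
    | cap => simp [Piece.lower] at hl
    | cross s => simp [Piece.lower] at hl
    | cup a =>
      obtain rfl : i = 0 := by simpa [Piece.lower] using hl
      have hy' : y = [a, !a] := by
        have := (step_iff _ _ _ _).1 hy
        simpa [stepAt, eq_comm] using this
      subst hy'
      refine ⟨a, v, rfl, hv, ?_⟩
      have h1 := hv.partner_lt (j := 0) (by simp)
      have h2 := hv.partner_ne (j := 0) (by simp)
      simp only [List.length_cons, List.length_nil] at h1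
      omega

theorem Runs.loops_pos {w : List Slice} (h : Runs w [] []) (hw : w ≠ []) : 0 < loops w := by
  obtain ⟨a, v, rfl, -, hv⟩ := h.exists_cup hw
  simp [loops, hv]

theorem runs_unique {w : List Slice} {x y y' : List Bool} (h : Runs w x y) (h' : Runs w x y') :
    y = y' := by
  rw [runs_iff] at h h'
  simpa [h] using h'

theorem Runs.partner_zero {w : List Slice} {x : List Bool} (h : Runs w x []) (hx : x ≠ []) :
    ∃ k, k + 1 < x.length ∧ partner w 0 = k + 1 := by
  have hp := List.length_pos_iff.2 hx
  have h1 := h.partner_lt hp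
  have h2 := h.partner_ne hp
  exact ⟨partner w 0 - 1, by omega, by omega⟩

/-- Up to crossing changes, a diagram without closed components is determined by the way in which
it connects its ends. -/
theorem exists_iso_of_partner_eq (x : List Bool) (w w' : List Slice) (hw : Runs w x [])
    (hw' : Runs w' x []) (hl : loops w = 0) (hl' : loops w' = 0)
    (hp : ∀ j < x.length, partner w j = partner w' j) :
    ∃ w₁ w₁', shadow w₁ = shadow w ∧ shadow w₁' = shadow w' ∧ Iso x [] w₁ w₁' := by
  induction hn : x.length using Nat.strong_induction_on generalizing x w w' with
  | _ n IH =>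
  subst hn
  by_cases hx : x = []
  · subst hx
    have h1 : w = [] := by
      by_contra h
      exact absurd (hw.loops_pos h) (by omega)
    have h2 : w' = [] := by
      by_contra h
      exact absurd (hw'.loops_pos h) (by omega)
    subst h1 h2
    exact ⟨[], [], rfl, rfl, .refl (.nil _)⟩
  · obtain ⟨k, hk, hk'⟩ := hw.partner_zero hx
    -- In both diagrams the strand through the leftmost end is pulled off. The pulled part is the
    -- same, so the remainders have the same ends, two fewer than before.
    obtain ⟨v, -, -, hv⟩ := exists_pulls w x hw 0 k (by omega) (by omega)
    obtain ⟨v', -, -, hv'⟩ := exists_pulls w' x hw' 0 k (by omega)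
      (by rw [← hp _ (by omega)]; omega)
    obtain ⟨y, hy, hvy, hxy⟩ := hv.runs hw
    obtain ⟨y', hy', hvy', -⟩ := hv'.runs hw'
    obtain rfl := runs_unique hy hy'
    obtain ⟨v₁, v₁', h1, h1', h2⟩ := IH y.length (by omega) y v v' hvy hvy'
      ((hv.loops_eq hw).trans hl) ((hv'.loops_eq hw').trans hl') (by
        intro m hm
        -- `m₀` is the position of the end `m` before the two ends of the pulled strand were
        -- removed.
        obtain ⟨m₀, h1, h2, h3, rfl⟩ : ∃ m₀, m₀ < x.length ∧ m₀ ≠ 0 ∧ m₀ ≠ 0 + k + 1 ∧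
            m = removePair 0 k m₀ := by
          by_cases h : m < k
          · refine ⟨m + 1, by omega, by omega, by omega, ?_⟩
            simp [removePair, h]
          · refine ⟨m + 2, by omega, by omega, by omega, ?_⟩
            unfold removePair
            split_ifs <;> omega
        rw [hv.partner_removePair hw h1 h2 h3, hv'.partner_removePair hw' h1 h2 h3, hp _ h1]) rfl
    -- The induction hypothesis has fixed the crossings of the remainders; the strand can be pulled
    -- off for any such choice.
    obtain ⟨w₁, hw₁, hr⟩ := hv v₁ h1
    obtain ⟨w₁', hw₁', hr'⟩ := hv' v₁' h1'
    refine ⟨w₁, w₁', hw₁, hw₁', ?_⟩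
    exact (hr x [] ((runs_iff_of_shadow hw₁ _ _).2 hw)).trans
      (((Iso.refl hy).append h2).trans
        (hr' x [] ((runs_iff_of_shadow hw₁' _ _).2 hw')).symm)

/-- The slices of a round circle. -/
def circle : List Slice := [(0, .cup true), (0, .cap)]

/-- A kink inserted at the maximum and removed at the minimum reverses the orientation of a round
circle. -/
theorem red_cup_cap (i : ℕ) (a b : Bool) : Red [(i, .cup a), (i, .cap)] [(i, .cup b), (i, .cap)] := by
  by_cases h : b = a
  · exact .of_eq (by rw [h])
  · obtain rfl : b = !a := by cases a <;> cases b <;> simp_all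
    calc
      Red [(i, .cup a), (i, .cap)] [(i, .cup a), (i, .cross true), (i, .cap)] :=
          (Move.red_symm (.reidemeisterOneCap i true) (by simp)).cons _
      Red _ [(i, .cup !a), (i, .cap)] := (red_cupTwist i a true).append_right [(i, .cap)]

theorem red_circle_append (v : List Slice) : Red (circle ++ v) (v ++ circle) := by
  induction v with
  | nil => exact .of_eq (by simp)
  | cons g v ih =>
    obtain ⟨i, p⟩ := g
    have h1 : Red [(0, Piece.cap), (i, p)] [(i + 2, p), (0, .cap)] :=
      red_interchange (i + 2) (by simp [Piece.upper]) (by simp [Piece.lower, Piece.upper])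
    have h2 : Red [(0, Piece.cup true), (i + 2, p)] [(i, p), (0, .cup true)] :=
      red_interchange i (by simp [Piece.upper]) (by simp [Piece.lower, Piece.upper])
    calc Red (circle ++ (i, p) :: v) ((0, .cup true) :: ([(0, .cap), (i, p)] ++ v)) := .of_eq rfl
      Red _ ((0, .cup true) :: ([(i + 2, p), (0, .cap)] ++ v)) := (h1.append_right v).cons _
      Red _ ([(0, .cup true), (i + 2, p)] ++ (0, .cap) :: v) := .of_eq rfl
      Red _ ([(i, p), (0, .cup true)] ++ (0, .cap) :: v) := h2.append_right _
      Red _ ((i, p) :: (circle ++ v)) := .of_eq rfl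
      Red _ ((i, p) :: v ++ circle) := ih.cons _

/-- Up to crossing changes, a closed component splits off as a round circle. -/
theorem exists_iso_circle_of_closed {w : List Slice} (h : Runs w [] []) (hw : w ≠ []) :
    ∃ w₁ v, shadow w₁ = shadow w ∧ crossings v ≤ crossings w ∧ v.length < w.length ∧
      Iso [] [] w₁ (v ++ circle) := by
  obtain ⟨a, w', rfl, h', hp⟩ := h.exists_cup hw
  -- The lowest slice is a cup whose legs are joined above it. After the joining strand is pulled
  -- off, it forms a round circle with the cup.
  obtain ⟨v, hlen, hcr, hv⟩ := exists_pulls w' _ h' 0 0 (by simp) (by simpa using hp)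
  obtain ⟨w₁, hw₁, hr⟩ := hv v rfl
  refine ⟨(0, .cup a) :: w₁, v, ?_, by simpa [crossings] using hcr, by simp; omega, ?_⟩
  · rw [shadow_cons, shadow_cons, hw₁]
  · have hs : shadow ((0, .cup a) :: w₁) = shadow ((0, .cup a) :: w') := by
      rw [shadow_cons, shadow_cons, hw₁]
    have hred : Red ((0, .cup a) :: w₁) (v ++ circle) :=
      calc Red ((0, .cup a) :: w₁) ((0, .cup a) :: (pull 0 0 ++ v)) := hr.cons _
        Red _ ([(0, .cup a), (0, .cap)] ++ v) := .of_eq rfl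
        Red _ (circle ++ v) := (red_cup_cap 0 a true).append_right v
        Red _ (v ++ circle) := red_circle_append v
    exact hred _ _ ((runs_iff_of_shadow hs _ _).2 h)

/-- The strands with ends are pulled off one after the other, which preserves the closed components.
When no ends are left, the closed case applies. -/
theorem exists_iso_circle (x : List Bool) (w : List Slice) (h : Runs w x []) (hw : 0 < loops w) :
    ∃ w₁ v, shadow w₁ = shadow w ∧ Iso x [] w₁ (v ++ circle) := by
  induction hn : x.length using Nat.strong_induction_on generalizing x w with
  | _ n IH =>
  subst hn
  by_cases hx : x = []
  · subst hx
    obtain ⟨w₁, v, h1, -, -, h2⟩ := exists_iso_circle_of_closed h (by rintro rfl; simp [loops] at hw)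
    exact ⟨w₁, v, h1, h2⟩
  · obtain ⟨k, hk, hk'⟩ := h.partner_zero hx
    obtain ⟨v, -, -, hv⟩ := exists_pulls w x h 0 k (by omega) (by omega)
    obtain ⟨y, hy, hvy, hxy⟩ := hv.runs h
    obtain ⟨v₁, v', h1, h2⟩ := IH y.length (by omega) y v hvy (by rwa [hv.loops_eq h]) rfl
    obtain ⟨w₁, hw₁, hr⟩ := hv v₁ h1
    refine ⟨w₁, pull 0 k ++ v', hw₁, (hr x [] ((runs_iff_of_shadow hw₁ _ _).2 h)).trans ?_⟩
    simpa using (Iso.refl hy).append h2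

theorem step_cup_cap {i : ℕ} {a : Bool} {x y z : List Bool} (h : Step (i, .cup a) x y)
    (h' : Step (i, .cap) y z) : z = x := by
  cases h with
  | cup l r a =>
    generalize hy : l ++ a :: (!a) :: r = y at h'
    generalize hi : l.length = i at h'
    cases h' with
    | cap l' r' b =>
      obtain ⟨rfl, h2⟩ := List.append_inj hy hi
      simp_all

/-- Closed components can be removed without changing the way in which the ends are connected. -/
theorem exists_loops_lt (w : List Slice) (x : List Bool) (h : Runs w x []) (hw : 0 < loops w) :
    ∃ v, Runs v x [] ∧ (∀ j < x.length, partner v j = partner w j) ∧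
      crossings v ≤ crossings w ∧ loops v < loops w := by
  induction w generalizing x with
  | nil => simp [loops] at hw
  | cons g w ih =>
    obtain ⟨i, p⟩ := g
    obtain ⟨y, hy, hwy⟩ := (runs_cons_iff _ _ _ _).1 h
    have hlen := Step.length_eq hy
    by_cases hw' : 0 < loops w
    · obtain ⟨v, h1, h2, h3, h4⟩ := ih y hwy hw'
      refine ⟨(i, p) :: v, .cons hy h1, ?_, ?_, ?_⟩
      · intro j hj
        cases p with
        | cap =>
          simp only [Piece.lower, Piece.upper] at hlen
          simp only [partner]
          by_cases hj1 : j = i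
          · simp [hj1]
          by_cases hj2 : j = i + 1
          · simp [hj2]
          rw [if_neg hj1, if_neg hj2, if_neg hj1, if_neg hj2,
            h2 _ (removeTwo_lt (by omega) hj1 hj2 (by omega))]
        | cross s =>
          simp only [Piece.lower, Piece.upper] at hlen
          simp only [partner]
          rw [h2 _ (swap_lt (by omega) (by omega))]
        | cup a =>
          simp only [Piece.lower, Piece.upper] at hlen
          have hj' : insertTwo i j < y.length := by
            have := insertTwo_lt (i := i) hj
            omega
          simp only [partner]
          rw [h2 _ hj', h2 i (by omega), h2 (i + 1) (by omega)]
      · cases p <;> simpa [crossings] using h3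
      · cases p with
        | cap => simpa [loops] using h4
        | cross s => simpa [loops] using h4
        | cup a =>
          simp only [Piece.lower, Piece.upper] at hlen
          simp only [loops, h2 i (by omega)]
          omega
    · cases p with
      | cap => simp [loops] at hw; omega
      | cross s => simp [loops] at hw; omega
      | cup a =>
        simp only [Piece.lower, Piece.upper] at hlen
        have hp : partner w i = i + 1 := by
          by_contra hp
          simp [loops, hp] at hw
          omega
        -- The lowest cup itself closes a component. The strand joining its legs is pulled off and
        -- discarded together with the cup, so the remainder `v` starts at the level `x`.
        obtain ⟨v, -, hcr, hv⟩ := exists_pulls w y hwy i 0 (by omega) (by simpa using hp)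
        obtain ⟨z, hz, hvz, -⟩ := hv.runs hwy
        have hxz : z = x := by
          obtain ⟨z', hz', hn⟩ := (runs_cons_iff _ _ _ _).1 (show Runs [(i, .cap)] y z from hz)
          obtain rfl : z' = z := runs_unique hn (.nil _) |>.symm
          exact step_cup_cap hy hz'
        subst hxz
        refine ⟨v, hvz, ?_, by simpa [crossings] using hcr, ?_⟩
        · intro j hj
          have hj' : insertTwo i j < y.length := by
            have := insertTwo_lt (i := i) hj
            omega
          have h3 := hv.partner_removePair hwy hj' (insertTwo_ne _ _)
            (by simpa using insertTwo_ne_succ i j)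
          have hr : ∀ m, m ≠ i → m ≠ i + 1 → removePair i 0 m = removeTwo i m := by
            intro m h h'
            unfold removePair removeTwo; split_ifs <;> omega
          have hpp : partner w (i + 1) = i := by
            rw [← hp]; exact hwy.partner_partner (by omega)
          have h4 : partner w (insertTwo i j) ≠ i := by
            intro h4
            have := hwy.partner_partner hj'
            rw [h4, hp] at this
            exact insertTwo_ne_succ i j this.symm
          have h5 : partner w (insertTwo i j) ≠ i + 1 := by
            intro h5
            have := hwy.partner_partner hj'
            rw [h5, hpp] at this
            exact insertTwo_ne i j this.symm
          rw [hr _ (insertTwo_ne _ _) (insertTwo_ne_succ _ _), removeTwo_insertTwo,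
            hr _ h4 h5] at h3
          rw [h3, partner_cup_of_ne a h4 h5]
        · simp [loops, hp, hv.loops_eq hwy]

end PlanarTangle

/-! ### Skein triples for crossings of arbitrary directions -/

namespace PlanarTangle

/-- `a`, `b` and `c` are isotopic to the links of a skein triple; `a` contains the positive or the
negative crossing. -/
def Skein (a b c : List Slice) : Prop :=
  ∃ P N Z : Diagram [] [], IsSkeinTriple P N Z ∧ Iso [] [] c Z.1 ∧
    ((Iso [] [] a P.1 ∧ Iso [] [] b N.1) ∨ (Iso [] [] a N.1 ∧ Iso [] [] b P.1))

theorem Skein.congr {a b c a' b' c' : List Slice} (h : Skein a b c) (ha : Iso [] [] a' a)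
    (hb : Iso [] [] b' b) (hc : Iso [] [] c' c) : Skein a' b' c' := by
  obtain ⟨P, N, Z, ht, h1, h2⟩ := h
  refine ⟨P, N, Z, ht, hc.trans h1, ?_⟩
  rcases h2 with h2 | h2
  · exact .inl ⟨ha.trans h2.1, hb.trans h2.2⟩
  · exact .inr ⟨ha.trans h2.1, hb.trans h2.2⟩

theorem skein_up {u v : List Slice} {l r : List Bool} (s : Bool)
    (hu : Runs u [] (l ++ true :: true :: r)) (hv : Runs v (l ++ true :: true :: r) []) :
    Skein (u ++ (l.length, .cross s) :: v) (u ++ (l.length, .cross !s) :: v) (u ++ v) := by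
  have hc : ∀ s, Runs (u ++ (l.length, .cross s) :: v) [] [] := fun s =>
    hu.append (.cons (.cross l r true true s) hv)
  refine ⟨⟨_, hc true⟩, ⟨_, hc false⟩, ⟨_, hu.append hv⟩, ⟨u, v, l, r, hu, rfl, rfl, rfl⟩,
    .refl (hu.append hv), ?_⟩
  cases s
  · exact .inr ⟨.refl (hc _), .refl (hc _)⟩
  · exact .inl ⟨.refl (hc _), .refl (hc _)⟩

/-- A crossing of strands of directions `p` and `q` can be smoothed. -/
def Smoothable (p q : Bool) : Prop :=
  ∀ (u v : List Slice) (l r : List Bool) (s : Bool), Runs u [] (l ++ p :: q :: r) →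
    Runs v (l ++ q :: p :: r) [] → ∃ m, crossings m = 0 ∧
      Runs m (l ++ p :: q :: r) (l ++ q :: p :: r) ∧
      Skein (u ++ (l.length, .cross s) :: v) (u ++ (l.length, .cross !s) :: v) (u ++ (m ++ v))

theorem red_rotate (i : ℕ) (a s : Bool) :
    Red [(i, .cup a), (i + 1, .cross !s), (i + 2, .cap)] [(i, .cross s)] := by
  calc
    Red [(i, .cup a), (i + 1, .cross !s), (i + 2, .cap)]
        ([(i, .cup a)] ++ [(i + 2, .cross s), (i + 1, .cap)]) := by
      simpa using (red_slideCap (i + 1) (!s)).append_left [(i, .cup a)]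
    Red _ ([(i, .cup a), (i + 2, .cross s)] ++ [(i + 1, .cap)]) := .of_eq rfl
    Red _ ([(i, .cross s), (i, .cup a)] ++ [(i + 1, .cap)]) :=
      (red_interchange i (by simp [Piece.upper])
        (by simp [Piece.lower, Piece.upper])).append_right _
    Red _ ([(i, .cross s)] ++ [(i, .cup a), (i + 1, .cap)]) := .of_eq rfl
    Red _ [(i, .cross s)] := by simpa using (red_zigzagRight i a).append_left [(i, .cross s)]

/-- By `red_rotate` a crossing is a quarter turn of another one, framed by a cup on its left and a
cap on its right. The frame has no crossings and is kept in the smoothing. Starting from two upward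
strands, the rotations reach all four pairs of directions. -/
theorem Smoothable.rotate {p q : Bool} (h : Smoothable (!q) p) : Smoothable p q := by
  intro u v l r s hu hv
  have hcup : Runs [(l.length, .cup q)] (l ++ p :: q :: r) ((l ++ [q]) ++ (!q) :: p :: q :: r) := by
    refine .cons ?_ (.nil _)
    simpa using Step.cup l (p :: q :: r) q
  have hcap : Runs [(l.length + 2, .cap)] ((l ++ [q]) ++ p :: (!q) :: q :: r) (l ++ q :: p :: r) := by
    refine .cons ?_ (.nil _)
    simpa using Step.cap (l ++ [q, p]) r (!q)
  obtain ⟨m, h1, h2, h3⟩ := h (u ++ [(l.length, .cup q)]) ([(l.length + 2, .cap)] ++ v) (l ++ [q])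
    (q :: r) (!s) (hu.append hcup) (hcap.append hv)
  refine ⟨[(l.length, .cup q)] ++ (m ++ [(l.length + 2, .cap)]), ?_, hcup.append (h2.append hcap), ?_⟩
  · simp [crossings_append, crossings, h1]
  · have hs : ∀ s, Runs (u ++ [(l.length, .cup q)] ++
        ((l ++ [q]).length, .cross !s) :: ([(l.length + 2, .cap)] ++ v)) [] [] := fun s =>
      (hu.append hcup).append (.cons (.cross _ _ _ _ _) (hcap.append hv))
    have hr : ∀ s, Iso [] [] (u ++ (l.length, .cross s) :: v) (u ++ [(l.length, .cup q)] ++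
        ((l ++ [q]).length, .cross !s) :: ([(l.length + 2, .cap)] ++ v)) := by
      intro s
      refine Iso.symm (Red.trans (w' := u ++ ([(l.length, .cup q), (l.length + 1, .cross !s),
        (l.length + 2, .cap)] ++ v)) (.of_eq (by simp))
        (Red.congr u v (red_rotate l.length q s)) _ _ (hs s))
    refine h3.congr (hr _) (hr _) ?_
    refine (Red.of_eq (by simp)) _ _ (hu.append ((hcup.append (h2.append hcap)).append hv))

theorem smoothable (p q : Bool) : Smoothable p q := by
  have h1 : Smoothable true true := fun u v l r s hu hv =>
    ⟨[], rfl, .nil _, skein_up s hu hv⟩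
  have h2 : Smoothable true false := .rotate h1
  have h3 : Smoothable false false := .rotate h2
  have h4 : Smoothable false true := .rotate h3
  cases p <;> cases q <;> assumption

/-- The skein relation at an arbitrary crossing. -/
theorem exists_skein {u v : List Slice} {i : ℕ} {s : Bool} {x : List Bool}
    (hu : Runs u [] x) (hv : Runs ((i, .cross s) :: v) x []) :
    ∃ m, crossings m = 0 ∧ Runs (m ++ v) x [] ∧
      Skein (u ++ (i, .cross s) :: v) (u ++ (i, .cross !s) :: v) (u ++ (m ++ v)) := by
  obtain ⟨y, hy, hv⟩ := (runs_cons_iff _ _ _ _).1 hv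
  cases hy with
  | cross l r a b =>
    obtain ⟨m, h1, h2, h3⟩ := smoothable a b u v l r s hu hv
    exact ⟨m, h1, h2.append hv, h3⟩

theorem Runs.exists_cap {w : List Slice} (h : Runs w [] []) (hw : w ≠ []) :
    ∃ v d, w = v ++ [(0, .cap)] ∧ Runs v [] [d, !d] := by
  obtain ⟨v, g, rfl⟩ : ∃ v g, w = v ++ [g] := ⟨_, _, (List.dropLast_append_getLast hw).symm⟩
  obtain ⟨y, hv, hg⟩ := (runs_append_iff _ _ _ _).1 h
  obtain ⟨z, hz, hn⟩ := (runs_cons_iff _ _ _ _).1 hg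
  obtain rfl : z = [] := runs_unique (.nil _) hn
  generalize hz' : ([] : List Bool) = z at hz
  cases hz with
  | cup l r a => simp at hz'
  | cross l r a => simp at hz'
  | cap l r a =>
    obtain ⟨rfl, rfl⟩ : l = [] ∧ r = [] := by simpa using hz'.symm
    exact ⟨v, a, rfl, hv⟩

/-- A split circle is the smoothing of a kink. -/
theorem skein_circle {w : List Slice} (h : Runs w [] []) (hw : w ≠ []) : Skein w w (w ++ circle) := by
  obtain ⟨v, d, rfl, hv⟩ := h.exists_cap hw
  have hcirc : Runs circle [] [] := circleDiagram.2
  -- The kink is added to the last maximum, on the side for which the two strands of its crossing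
  -- point up. It then sits at position `1` of the level down, up, up, down in both cases.
  cases d
  · have hu : Runs (v ++ [(2, .cup true)]) [] ([false] ++ true :: true :: [false]) :=
      hv.append (.cons (.cup [false, true] [] true) (.nil _))
    have hv' : Runs [(0, .cap), (0, .cap)] ([false] ++ true :: true :: [false]) [] :=
      .cons (.cap [] [true, false] false) (.cons (.cap [] [] true) (.nil _))
    have hk : ∀ s, Iso [] [] (v ++ [(0, .cap)])
        (v ++ [(2, .cup true)] ++ (1, .cross s) :: [(0, .cap), (0, .cap)]) := by
      intro s
      have hm : Red [(2, .cup true), (1, .cross s), (0, .cap), (0, .cap)] [(0, .cap)] := by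
        calc
          Red [(2, .cup true), (1, .cross s), (0, .cap), (0, .cap)]
              ([(2, Piece.cup true)] ++ ([(0, Piece.cross !s), (1, Piece.cap)] ++ [(0, Piece.cap)])) :=
            ((red_slideCap' 0 s).append_right [(0, .cap)]).append_left [(2, .cup true)]
          Red _ ([(2, .cup true), (0, .cross !s)] ++ [(1, .cap), (0, .cap)]) := .of_eq rfl
          Red _ ([(0, .cross !s), (2, .cup true)] ++ [(1, .cap), (0, .cap)]) :=
            (red_interchange' 2 (by simp [Piece.lower])
              (by simp [Piece.lower, Piece.upper])).append_right _
          Red _ ([(0, .cross !s)] ++ ([(1 + 1, .cup true), (1, .cap)] ++ [(0, .cap)])) := .of_eq rfl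
          Red _ ([(0, .cross !s)] ++ ([] ++ [(0, .cap)])) :=
            ((red_zigzagLeft 1 true).append_right _).append_left _
          Red _ [(0, .cap)] := red_capTwist 0 (!s)
      exact Iso.symm (Red.trans (w' := v ++
        [(2, .cup true), (1, .cross s), (0, .cap), (0, .cap)]) (.of_eq (by simp))
        (hm.append_left v) _ _ (hu.append (.cons (.cross [false] _ _ _ _) hv')))
    have hz : Red (v ++ [(0, .cap)] ++ circle) (v ++ [(2, .cup true)] ++ [(0, .cap), (0, .cap)]) := by
      have := Red.congr v [(0, .cap)] (red_interchange (i := 0) (j := 0) (p := .cap) (q := .cup true) 2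
        (by simp [Piece.upper]) (by simp [Piece.lower, Piece.upper]))
      simpa [circle] using this
    exact (skein_up true hu hv').congr (hk _) (hk _) (hz _ _ (h.append hcirc))
  · have hu : Runs (v ++ [(0, .cup false)]) [] ([false] ++ true :: true :: [false]) :=
      hv.append (.cons (.cup [] [true, false] false) (.nil _))
    have hv' : Runs [(2, .cap), (0, .cap)] ([false] ++ true :: true :: [false]) [] :=
      .cons (.cap [false, true] [] true) (.cons (.cap [] [] false) (.nil _))
    have hk : ∀ s, Iso [] [] (v ++ [(0, .cap)])
        (v ++ [(0, .cup false)] ++ (1, .cross s) :: [(2, .cap), (0, .cap)]) := by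
      intro s
      have hm : Red [(0, .cup false), (1, .cross s), (2, .cap), (0, .cap)] [(0, .cap)] := by
        calc
          Red [(0, .cup false), (1, .cross s), (2, .cap), (0, .cap)]
              ([(0, .cross !s)] ++ [(0, .cap)]) := by
            simpa using (red_rotate 0 false (!s)).append_right [(0, .cap)]
          Red _ [(0, .cap)] := red_capTwist 0 (!s)
      exact Iso.symm (Red.trans (w' := v ++
        [(0, .cup false), (1, .cross s), (2, .cap), (0, .cap)]) (.of_eq (by simp))
        (hm.append_left v) _ _ (hu.append (.cons (.cross [false] _ _ _ _) hv')))
    have hz : Red (v ++ [(0, .cap)] ++ circle) (v ++ [(0, .cup false)] ++ [(2, .cap), (0, .cap)]) := by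
      have h1 := Red.congr v [(0, .cap)] (red_interchange' (i := 0) (j := 0) (p := .cup false) (q := .cap) 2
        (by simp [Piece.lower]) (by simp [Piece.lower, Piece.upper]))
      have h2 : Red (v ++ [(0, .cap)] ++ circle) (v ++ [(0, .cap)] ++ [(0, .cup false), (0, .cap)]) :=
        (red_cup_cap 0 true false).append_left _
      refine h2.trans ?_
      simpa using h1
    exact (skein_up true hu hv').congr (hk _) (hk _) (hz _ _ (h.append hcirc))

end PlanarTangle

/-! ### Consistency of skein resolutions -/

namespace PlanarTangle

section LinkSum

variable {A : Type*} [CommRing A] (q : Aˣ) (N : ℕ)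

theorem act_skein {y : List Bool} (l r : List Bool) (hy : y = l ++ true :: true :: r)
    (F : List (Bool × Fin N) → A) (s : List (Bool × Fin N)) (hs : s.map Prod.fst = y) :
    qpow q N * act q l.length (.cross true) F s - qpow q (-N) * act q l.length (.cross false) F s =
      (qpow q 1 - qpow q (-1)) * F s := by
  induction l generalizing s F y with
  | nil =>
    subst hy
    match s, hs with
    | (a, x) :: (b, y) :: s, hs =>
      obtain ⟨rfl, rfl, -⟩ : a = true ∧ b = true ∧ s.map Prod.fst = r := by simpa using hs
      simp only [List.length_nil, act, Finset.mul_sum, ← Finset.sum_sub_distrib, ← mul_assoc,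
        ← sub_mul, weight_skein]
      simp [ite_and]
  | cons c l ih =>
    subst hy
    match s, hs with
    | (a, x) :: s, hs =>
      exact ih rfl (fun t => F ((a, x) :: t)) s (by simpa using (List.cons.inj hs).2)

theorem stateSum_mul {N : ℕ} (w : List Slice) (c : A) (F : List (Bool × Fin N) → A)
    (s : List (Bool × Fin N)) : stateSum q w (fun t => c * F t) s = c * stateSum q w F s := by
  induction w generalizing s with
  | nil => rfl
  | cons g w ih => simp only [stateSum, funext ih, act_mul]

theorem act_sub {N : ℕ} (i : ℕ) (p : Piece) (F G : List (Bool × Fin N) → A)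
    (s : List (Bool × Fin N)) :
    act q i p (fun t => F t - G t) s = act q i p F s - act q i p G s := by
  simpa [← sub_eq_add_neg, sub_eq_neg_add] using act_sum q (Finset.univ : Finset Bool) i p
    (fun b => if b then 1 else -1) (fun b => if b then F else G) s

theorem stateSum_sub {N : ℕ} (w : List Slice) (F G : List (Bool × Fin N) → A)
    (s : List (Bool × Fin N)) :
    stateSum q w (fun t => F t - G t) s = stateSum q w F s - stateSum q w G s := by
  induction w generalizing s with
  | nil => rfl
  | cons g w ih => simp only [stateSum, funext ih, act_sub]

/-- The state sum as an invariant of links. -/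
def linkSum : OrientedLink → A :=
  Quotient.lift (fun D : Diagram [] [] => stateSum q D.1 (fun _ : List (Bool × Fin N) => 1) [])
    (fun D E h => Iso.stateSum_eq q (N := N) ⟨D.2, E.2, h⟩ _ [] rfl)

theorem linkSum_toTangle (D : Diagram [] []) :
    linkSum q N D.toTangle = stateSum q D.1 (fun _ : List (Bool × Fin N) => 1) [] := rfl

theorem linkSum_skein {P M Z : Diagram [] []} (h : IsSkeinTriple P M Z) :
    qpow q N * linkSum q N P.toTangle - qpow q (-N) * linkSum q N M.toTangle =
      (qpow q 1 - qpow q (-1)) * linkSum q N Z.toTangle := by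
  obtain ⟨u, v, l, r, hu, hP, hM, hZ⟩ := h
  simp only [linkSum_toTangle, hP, hM, hZ, stateSum_append, stateSum]
  rw [← stateSum_mul, ← stateSum_mul, ← stateSum_mul, ← stateSum_sub]
  exact stateSum_congr q hu (fun s hs => act_skein q N l r rfl _ s hs) [] rfl

theorem linkSum_circle :
    (qpow q 1 - qpow q (-1)) * linkSum q N circleDiagram.toTangle = qpow q N - qpow q (-N) := by
  have h := sum_qpow q⁻¹ (N := N) 0 N (by omega) le_rfl (N - 1)
  have hq : ∀ k, qpow q⁻¹ k = qpow q (-k) := by intro k; simp [qpow]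
  have hN : -((N : ℤ) - 2 * N) = N := by ring
  simp only [zero_le, Fin.is_lt, and_self, if_true, hq, ← Finset.mul_sum, neg_neg,
    Nat.cast_zero, mul_zero, sub_zero, sub_add_cancel, hN] at h
  have he : linkSum q N circleDiagram.toTangle = ∑ x : Fin N, qpow q (-turn x) := by
    rw [linkSum_toTangle]
    simp [circleDiagram, stateSum, act, capTurn]
  simp only [turn] at he
  rw [he]
  linear_combination -h

end LinkSum

/-- Resolution trees: `Resolves t p` says that repeated application of the skein relation leads to
the value `p` for the link `t`. -/
inductive Resolves : OrientedLink → Polynomial ℤ → Prop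
  | circle : Resolves circleDiagram.toTangle 1
  | pos {P N Z : Diagram [] []} {a b : Polynomial ℤ} (h : IsSkeinTriple P N Z)
      (hN : Resolves N.toTangle a) (hZ : Resolves Z.toTangle b) :
      Resolves P.toTangle (a + Polynomial.X * b)
  | neg {P N Z : Diagram [] []} {a b : Polynomial ℤ} (h : IsSkeinTriple P N Z)
      (hP : Resolves P.toTangle a) (hZ : Resolves Z.toTangle b) :
      Resolves N.toTangle (a - Polynomial.X * b)
  | split {P N Z : Diagram [] []} {a : Polynomial ℤ} (h : IsSkeinTriple P N Z)
      (hPN : P.toTangle = N.toTangle) (hP : Resolves P.toTangle a) : Resolves Z.toTangle 0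

theorem Resolves.eq_of_isAlexanderConway {t : OrientedLink} {p : Polynomial ℤ} (h : Resolves t p)
    {f : OrientedLink → Polynomial ℤ} (hf : IsAlexanderConway f) : f t = p := by
  induction h with
  | circle => exact hf.circle
  | pos h _ _ h1 h2 => rw [← h1, ← h2]; linear_combination hf.skein _ _ _ h
  | neg h _ _ h1 h2 => rw [← h1, ← h2]; linear_combination -hf.skein _ _ _ h
  | split h hPN _ h1 =>
    have := hf.skein _ _ _ h
    rw [hPN, sub_self, eq_comm] at this
    simpa using this

/-- By `hq`, `q ^ N` and its inverse act as `1` on multiples of the value of the circle, where the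
skein relation of the state sum thus becomes that of Conway. For a split link the relation only
gives a product with `q - q⁻¹`, which is cancelled by `hz`. -/
theorem Resolves.linkSum_eq {A : Type*} [CommRing A] (q : Aˣ) (N : ℕ) {t : OrientedLink}
    {p : Polynomial ℤ} (h : Resolves t p) (hq : linkSum q N circleDiagram.toTangle * (qpow q N - 1) = 0)
    (hz : IsUnit (qpow q 1 - qpow q (-1))) :
    linkSum q N t =
      linkSum q N circleDiagram.toTangle * Polynomial.eval₂ (Int.castRingHom _) (qpow q 1 - qpow q (-1)) p := by
  have hq' := qpow_mul_neg q (N : ℤ)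
  set e := linkSum q N circleDiagram.toTangle
  set z : A := qpow q 1 - qpow q (-1)
  have hs : ∀ {P M Z}, IsSkeinTriple P M Z → _ := fun h => linkSum_skein q N h
  have he : e * (qpow q (-N) - 1) = 0 := by linear_combination -qpow q (-N) * hq + e * hq'
  induction h with
  | circle => simp [e]
  | pos h _ _ h1 h2 =>
    have := hs h
    rw [h1, h2] at this
    rename_i P M Z a b _ _
    simp only [Polynomial.eval₂_add, Polynomial.eval₂_mul, Polynomial.eval₂_X]
    linear_combination qpow q (-N) * this - linkSum q N P.toTangle * hq' +
      he * (qpow q (-N) + 1) * Polynomial.eval₂ (Int.castRingHom A) z a + he * z * Polynomial.eval₂ (Int.castRingHom A) z b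
  | neg h _ _ h1 h2 =>
    have := hs h
    rw [h1, h2] at this
    simp only [Polynomial.eval₂_sub, Polynomial.eval₂_mul, Polynomial.eval₂_X]
    rename_i P M Z a b _ _
    linear_combination -qpow q N * this - linkSum q N M.toTangle * hq' +
      hq * (qpow q N + 1) * Polynomial.eval₂ (Int.castRingHom A) z a - hq * z * Polynomial.eval₂ (Int.castRingHom A) z b
  | split h hPN _ h1 =>
    have := hs h
    rw [← hPN, h1] at this
    rename_i a _
    rw [Polynomial.eval₂_zero, mul_zero, ← hz.mul_right_eq_zero, ← this]
    linear_combination (hq - he) * Polynomial.eval₂ (Int.castRingHom A) z a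

section DualNumbers

open TrivSqZeroExt DualNumber

/-- The deformation `ζ (1 + ε)` of `ζ`. -/
def deform (ζ : ℂˣ) : (DualNumber ℂ)ˣ where
  val := inl (ζ : ℂ) * (1 + ε)
  inv := inl ((ζ⁻¹ : ℂˣ) : ℂ) * (1 - ε)
  val_inv := by ext <;> simp
  inv_val := by ext <;> simp

theorem qpow_deform (ζ : ℂˣ) (n : ℕ) :
    qpow (deform ζ) n = inl ((ζ ^ n : ℂˣ) : ℂ) * (1 + inr (n : ℂ)) := by
  induction n with
  | zero => simp
  | succ n ih =>
    have h : qpow (deform ζ) 1 = inl (ζ : ℂ) * (1 + ε) := by simp [qpow, deform]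
    rw [Nat.cast_succ, ← qpow_mul, ih, h]
    ext <;> simp <;> ring

theorem qpow_deform_neg (ζ : ℂˣ) (n : ℕ) :
    qpow (deform ζ) (-n) = inl (((ζ⁻¹) ^ n : ℂˣ) : ℂ) * (1 - inr (n : ℂ)) := by
  have h := qpow_mul_neg (deform ζ) (n : ℤ)
  have h2 : (inl (((ζ⁻¹) ^ n : ℂˣ) : ℂ) * (1 - inr (n : ℂ)) : DualNumber ℂ) *
      qpow (deform ζ) n = 1 := by
    rw [qpow_deform]
    ext
    · simp
    · simp; field_simp; ring
  linear_combination (inl (((ζ⁻¹) ^ n : ℂˣ) : ℂ) * (1 - inr (n : ℂ)) : DualNumber ℂ) * h -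
    qpow (deform ζ) (-n) * h2

end DualNumbers

/-- For `q = ζ (1 + ε)` one has `q ^ N = 1 + N ε`, so the value `e` of the circle is a nonzero
multiple of `ε` and is annihilated by `q ^ N - 1`. Multiplication by `e` sees only the constant part
of the other factor, and this is the value of the polynomial at `ζ - ζ⁻¹`. -/
theorem Resolves.eval₂_eq {t : OrientedLink} {p p' : Polynomial ℤ} (h : Resolves t p)
    (h' : Resolves t p') {N : ℕ} (hN : N ≠ 0) {ζ : ℂˣ} (hζ : ζ ^ N = 1)
    (hz : (ζ : ℂ) - (ζ⁻¹ : ℂˣ) ≠ 0) :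
    Polynomial.eval₂ (Int.castRingHom ℂ) ((ζ : ℂ) - (ζ⁻¹ : ℂˣ)) p = Polynomial.eval₂ (Int.castRingHom ℂ) ((ζ : ℂ) - (ζ⁻¹ : ℂˣ)) p' := by
  set q := deform ζ
  set e := linkSum q N circleDiagram.toTangle
  have hqN : qpow q N = 1 + TrivSqZeroExt.inr (N : ℂ) := by simp [q, qpow_deform, hζ]
  have hqN' : qpow q (-N) = 1 - TrivSqZeroExt.inr (N : ℂ) := by simp [q, qpow_deform_neg, hζ]
  have h1 : (qpow q 1 - qpow q (-1)).fst = (ζ : ℂ) - (ζ⁻¹ : ℂˣ) := by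
    have h1 := qpow_deform ζ 1
    have h2 := qpow_deform_neg ζ 1
    rw [Nat.cast_one] at h1 h2
    simp [q, h1, h2]
  have he : (qpow q 1 - qpow q (-1)) * e = TrivSqZeroExt.inr (2 * N : ℂ) := by
    rw [linkSum_circle, hqN, hqN', two_mul, TrivSqZeroExt.inr_add]; ring
  have he0 : e.fst = 0 := by
    have := congrArg TrivSqZeroExt.fst he
    rw [TrivSqZeroExt.fst_mul, h1, TrivSqZeroExt.fst_inr] at this
    exact (mul_eq_zero.1 this).resolve_left hz
  have he1 : e.snd ≠ 0 := by
    intro h0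
    have : e = 0 := by ext <;> simp [he0, h0]
    rw [this, mul_zero] at he
    have := congrArg TrivSqZeroExt.snd he
    simp [hN] at this
  have hq : e * (qpow q N - 1) = 0 := by
    rw [hqN]
    ext <;> simp [he0]
  have hu : IsUnit (qpow q 1 - qpow q (-1)) := by
    rw [TrivSqZeroExt.isUnit_iff_isUnit_fst, h1]
    exact hz.isUnit
  have key := (h.linkSum_eq q N hq hu).symm.trans (h'.linkSum_eq q N hq hu)
  have hf : ∀ p : Polynomial ℤ, (Polynomial.eval₂ (Int.castRingHom _) (qpow q 1 - qpow q (-1)) p).fst =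
      Polynomial.eval₂ (Int.castRingHom ℂ) ((ζ : ℂ) - (ζ⁻¹ : ℂˣ)) p := by
    intro p
    rw [← h1]
    exact Polynomial.hom_eval₂ p _ (TrivSqZeroExt.fstHom ℂ ℂ ℂ).toRingHom _
  have := congrArg TrivSqZeroExt.snd (show e * _ = e * _ from key)
  rw [DualNumber.snd_mul, DualNumber.snd_mul, he0, zero_mul, zero_mul, zero_add, zero_add, hf,
    hf] at this
  exact mul_left_cancel₀ he1 this

theorem Resolves.unique {t : OrientedLink} {p p' : Polynomial ℤ} (h : Resolves t p)
    (h' : Resolves t p') : p = p' := by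
  -- Denominators of at least `5` keep the angle strictly between `0` and `π / 2`, where the sine is
  -- positive and injective. This makes the evaluation points nonzero and pairwise distinct.
  let θ : ℕ → ℝ := fun n => 2 * Real.pi / (n + 5)
  let ζ : ℕ → ℂˣ := fun n => Units.mk0 (Complex.exp (θ n * Complex.I)) (Complex.exp_ne_zero _)
  let z : ℕ → ℂ := fun n => (ζ n : ℂ) - ((ζ n)⁻¹ : ℂˣ)
  have hpi := Real.pi_pos
  have hθ : ∀ n, θ n ∈ Set.Ioo 0 (Real.pi / 2) := by
    intro n
    refine ⟨by positivity, ?_⟩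
    rw [div_lt_div_iff₀ (by positivity) (by norm_num)]
    have : (0 : ℝ) ≤ n := by positivity
    nlinarith
  have hz : ∀ n, z n = 2 * Real.sin (θ n) * Complex.I := by
    intro n
    simp only [z, ζ, Units.val_inv_eq_inv_val, Units.val_mk0, ← Complex.exp_neg]
    rw [Complex.ofReal_sin, Complex.sin, neg_mul]
    linear_combination (Complex.exp (θ n * Complex.I) - Complex.exp (-(θ n * Complex.I))) *
      Complex.I_sq
  have hz0 : ∀ n, z n ≠ 0 := by
    intro n
    have := Real.sin_pos_of_pos_of_lt_pi (hθ n).1 (by linarith [(hθ n).2])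
    rw [hz]
    exact mul_ne_zero (mul_ne_zero two_ne_zero (Complex.ofReal_ne_zero.2 this.ne')) Complex.I_ne_zero
  have hinj : Function.Injective z := by
    intro m n hmn
    simp only [hz, mul_eq_mul_right_iff, Complex.I_ne_zero, or_false, mul_eq_mul_left_iff,
      Complex.ofReal_inj] at hmn
    have h1 : Real.sin (θ m) = Real.sin (θ n) := by simpa using hmn
    have h2 := Real.injOn_sin ⟨by linarith [(hθ m).1], (hθ m).2.le⟩
      ⟨by linarith [(hθ n).1], (hθ n).2.le⟩ h1
    have h3 : ((m : ℝ) + 5) = n + 5 := by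
      have := hpi.ne'
      simp only [θ] at h2
      field_simp at h2
      linarith
    exact_mod_cast add_right_cancel h3
  have hpow : ∀ n, (ζ n) ^ (n + 5) = 1 := by
    intro n
    ext
    simp only [ζ, Units.val_pow_eq_pow_val, Units.val_mk0, Units.val_one, ← Complex.exp_nat_mul]
    rw [← Complex.exp_two_pi_mul_I]
    congr 1
    have : (n : ℂ) + 5 ≠ 0 := by exact_mod_cast (by positivity : (n : ℝ) + 5 ≠ 0)
    simp only [θ]
    push_cast
    field_simp
  have hroot : ∀ n, ((p - p').map (Int.castRingHom ℂ)).IsRoot (z n) := by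
    intro n
    have := h.eval₂_eq h' (by omega) (hpow n) (hz0 n)
    rw [Polynomial.IsRoot, Polynomial.map_sub, Polynomial.eval_sub, sub_eq_zero]
    simpa [Polynomial.eval_map, z] using this
  have h0 : (p - p').map (Int.castRingHom ℂ) = 0 :=
    Polynomial.eq_zero_of_infinite_isRoot _
      ((Set.infinite_range_of_injective hinj).mono (by rintro _ ⟨n, rfl⟩; exact hroot n))
  rw [← sub_eq_zero]
  exact (Polynomial.map_eq_zero_iff (Int.castRingHom ℂ).injective_int).1 h0

end PlanarTangle

/-! ### Existence and uniqueness of the Alexander-Conway polynomial -/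

namespace PlanarTangle

/-- A property that is invariant under single crossing changes depends on the shadow only. -/
theorem shadow_induction {w w' : List Slice} {Q : List Slice → Prop}
    (h : ∀ u v i s, shadow (u ++ (i, .cross s) :: v) = shadow w → Q (u ++ (i, .cross s) :: v) →
      Q (u ++ (i, .cross !s) :: v)) (hs : shadow w' = shadow w) (hw : Q w) : Q w' := by
  suffices H : ∀ v v' u, shadow v = shadow v' → shadow (u ++ v) = shadow w → Q (u ++ v) →
      Q (u ++ v') from H w w' [] hs.symm rfl hw
  intro v
  induction v with
  | nil =>
    intro v' u hv _ hQ
    obtain rfl : v' = [] := by simpa [shadow] using hv.symm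
    exact hQ
  | cons g v ih =>
    intro v' u hv hu hQ
    obtain ⟨g', v', rfl, hg, hv'⟩ := shadow_eq_cons hv.symm
    obtain ⟨i, p⟩ := g
    obtain ⟨p', rfl, -, -, -⟩ := forget_eq hg
    have hQ' : Q (u ++ (i, p') :: v) := by
      cases p <;> cases p' <;> simp [Slice.forget] at hg
      · subst hg; exact hQ
      · exact hQ
      · rename_i s s'
        by_cases hss : s' = s
        · rwa [hss]
        · obtain rfl : s' = !s := by cases s <;> cases s' <;> simp_all
          exact h _ _ _ _ hu hQ
    have := ih v' (u ++ [(i, p')]) hv'.symm (by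
      rw [← hu]; simp [shadow, hg]) (by simpa using hQ')
    simpa using this

theorem iso_nil_iff {w : List Slice} : Iso [] [] w [] ↔ w = [] := by
  constructor
  · intro h
    by_contra hw
    have := h.1.loops_pos hw
    rw [h.loops_eq] at this
    simp [loops] at this
  · rintro rfl
    exact .refl (.nil _)

theorem toTangle_eq_empty_iff {D : Diagram [] []} :
    D.toTangle = emptyDiagram.toTangle ↔ D.1 = [] := by
  constructor
  · intro h
    exact iso_nil_iff.1 (iso_of_toTangle_eq h)
  · intro h
    exact Iso.toTangle_eq (iso_nil_iff.2 h)

/-- Some resolution tree starts from the link diagram `w`. -/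
def HasResolution (w : List Slice) : Prop :=
  ∃ (h : Runs w [] []) (p : Polynomial ℤ), Resolves (Diagram.toTangle ⟨w, h⟩) p

theorem HasResolution.of_iso {w w' : List Slice} (h : HasResolution w) (hw : Iso [] [] w w') :
    HasResolution w' := by
  obtain ⟨h, p, hp⟩ := h
  refine ⟨hw.2.1, p, ?_⟩
  rwa [← Iso.toTangle_eq (D := ⟨w, h⟩) (E := ⟨w', hw.2.1⟩) hw]

theorem Skein.hasResolution {a b c : List Slice} (h : Skein a b c) (hb : HasResolution b)
    (hc : HasResolution c) : HasResolution a := by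
  obtain ⟨P, N, Z, ht, h1, h2 | h2⟩ := h
  · obtain ⟨_, p, hp⟩ := hb.of_iso h2.2
    obtain ⟨_, r, hr⟩ := hc.of_iso h1
    exact HasResolution.of_iso ⟨P.2, _, .pos ht hp hr⟩ h2.1.symm
  · obtain ⟨_, p, hp⟩ := hb.of_iso h2.2
    obtain ⟨_, r, hr⟩ := hc.of_iso h1
    exact HasResolution.of_iso ⟨N.2, _, .neg ht hp hr⟩ h2.1.symm

theorem Skein.hasResolution_of_eq {a c : List Slice} (h : Skein a a c) (ha : HasResolution a) :
    HasResolution c := by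
  obtain ⟨P, N, Z, ht, h1, h2⟩ := h
  have h3 : Iso [] [] a P.1 ∧ Iso [] [] a N.1 := by tauto
  obtain ⟨_, p, hp⟩ := ha.of_iso h3.1
  exact HasResolution.of_iso ⟨Z.2, _, .split ht (Iso.toTangle_eq (h3.1.symm.trans h3.2)) hp⟩
    h1.symm

/-- Crossing changes lead to a diagram with a split circle, and each costs a smoothing with fewer
crossings. The remainder `v` of the diagram with the circle has no more crossings and fewer slices.
As smoothings may have more slices, the induction is on crossings first and on slices second. -/
theorem hasResolution {w : List Slice} (h : Runs w [] []) (hw : w ≠ []) : HasResolution w := by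
  induction hn : crossings w using Nat.strong_induction_on generalizing w with
  | _ n IH =>
  induction hm : w.length using Nat.strong_induction_on generalizing w with
  | _ m IH' =>
  obtain ⟨w₁, v, h1, h2, h3, h4⟩ := exists_iso_circle_of_closed h hw
  have hv : HasResolution (v ++ circle) := by
    by_cases hv : v = []
    · subst hv
      exact ⟨circleDiagram.2, _, .circle⟩
    · obtain ⟨y, hy, hc⟩ := (runs_append_iff _ _ _ _).1 h4.2.1
      obtain rfl : y = [] := by
        match y with
        | [] => rfl
        | [_] => rw [runs_iff] at hc; simp [circle, run, stepAt] at hc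
        | _ :: _ :: _ => rw [runs_iff] at hc; simp [circle, run, stepAt] at hc
      -- `v` with a split circle is the smoothing of a kink in `v`, so it gets the value `0` once
      -- `v` has a resolution.
      refine (skein_circle hy hv).hasResolution_of_eq ?_
      by_cases hlt : crossings v < n
      · exact IH _ hlt hy hv rfl
      · exact IH' v.length (by omega) hy hv (by omega) rfl
  refine shadow_induction (w := w₁) ?_ h1.symm (hv.of_iso h4.symm)
  intro u v i s hs hQ
  rw [h1] at hs
  have hr := (runs_iff_of_shadow hs [] []).2 h
  obtain ⟨x, hu, hv⟩ := (runs_append_iff _ _ _ _).1 hr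
  obtain ⟨m, hm1, hm2, hm3⟩ := exists_skein hu hv
  have hcr := crossings_eq_of_shadow hs
  rw [crossings_append] at hcr
  simp only [crossings] at hcr
  have hm3' : Skein (u ++ (i, .cross !s) :: v) (u ++ (i, .cross s) :: v) (u ++ (m ++ v)) := by
    obtain ⟨P, N, Z, ht, h1, h2⟩ := hm3
    exact ⟨P, N, Z, ht, h1, by tauto⟩
  refine hm3'.hasResolution hQ (IH _ ?_ (hu.append hm2) ?_ rfl)
  · rw [crossings_append, crossings_append]
    omega
  · intro h0
    have hu0 : u = [] := by simp_all
    subst hu0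
    rw [runs_iff] at hu hv
    obtain rfl : x = [] := by simpa [run, eq_comm] using hu
    cases i <;> simp [run, stepAt] at hv

/-- The value is that of any resolution. The diagrams of a skein triple are nonempty, since two
strands have to be created below the crossing, so the convention for the empty link does not
interfere. -/
theorem existsUnique_isAlexanderConway :
    ∃! f : OrientedLink → Polynomial ℤ, IsAlexanderConway f := by
  classical
  have hres : ∀ t : OrientedLink, t ≠ emptyDiagram.toTangle → ∃ p, Resolves t p := by
    intro t ht
    obtain ⟨D, rfl⟩ : ∃ D : Diagram [] [], D.toTangle = t := Quotient.exists_rep t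
    obtain ⟨_, p, hp⟩ := hasResolution D.2 (fun h => ht (toTangle_eq_empty_iff.2 h))
    exact ⟨p, hp⟩
  let f : OrientedLink → Polynomial ℤ := fun t =>
    if h : t = emptyDiagram.toTangle then 0 else (hres t h).choose
  have hf : ∀ t p, t ≠ emptyDiagram.toTangle → Resolves t p → f t = p := by
    intro t p ht hp
    simp only [f, dif_neg ht]
    exact (hres t ht).choose_spec.unique hp
  have hne : ∀ u v : List Slice, ∀ D : Diagram [] [], D.1 = u ++ v → u ≠ [] →
      D.toTangle ≠ emptyDiagram.toTangle := by
    intro u v D hD hu h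
    rw [toTangle_eq_empty_iff, hD] at h
    simp_all
  refine ⟨f, ⟨by simp [f], hf _ _ ?_ .circle, ?_⟩, ?_⟩
  · exact hne circle [] _ (by simp [circle, circleDiagram]) (by simp [circle])
  · intro P N Z h
    obtain ⟨u, v, l, r, hu, hP, hN, hZ⟩ := id h
    have hu0 : u ≠ [] := by
      rintro rfl
      rw [runs_iff] at hu
      simp [run] at hu
    have hP' := hne _ _ P hP hu0
    have hN' := hne _ _ N hN hu0
    have hZ' := hne _ _ Z hZ hu0
    obtain ⟨a, ha⟩ := hres _ hN'
    obtain ⟨b, hb⟩ := hres _ hZ'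
    rw [hf _ _ hN' ha, hf _ _ hZ' hb, hf _ _ hP' (.pos h ha hb)]
    ring
  · intro g hg
    funext t
    by_cases ht : t = emptyDiagram.toTangle
    · rw [ht, hg.empty]; simp [f]
    · obtain ⟨p, hp⟩ := hres t ht
      rw [hp.eq_of_isAlexanderConway hg, hf t p ht hp]

theorem isAlexanderConway_alexanderConway : IsAlexanderConway alexanderConway :=
  Classical.epsilon_spec existsUnique_isAlexanderConway.exists

theorem Skein.sub_eq {a b c : List Slice} (h : Skein a b c) (ha : Runs a [] []) (hb : Runs b [] [])
    (hc : Runs c [] []) {f : OrientedLink → Polynomial ℤ} (hf : IsAlexanderConway f) :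
    f (Diagram.toTangle ⟨a, ha⟩) - f (Diagram.toTangle ⟨b, hb⟩) =
        Polynomial.X * f (Diagram.toTangle ⟨c, hc⟩) ∨
      f (Diagram.toTangle ⟨b, hb⟩) - f (Diagram.toTangle ⟨a, ha⟩) =
        Polynomial.X * f (Diagram.toTangle ⟨c, hc⟩) := by
  obtain ⟨P, N, Z, ht, h1, h2⟩ := h
  rw [Iso.toTangle_eq (D := ⟨c, hc⟩) (E := Z) h1, ← hf.skein _ _ _ ht]
  rcases h2 with h2 | h2
  · rw [Iso.toTangle_eq (D := ⟨a, ha⟩) (E := P) h2.1, Iso.toTangle_eq (D := ⟨b, hb⟩) (E := N) h2.2]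
    exact .inl rfl
  · rw [Iso.toTangle_eq (D := ⟨a, ha⟩) (E := N) h2.1, Iso.toTangle_eq (D := ⟨b, hb⟩) (E := P) h2.2]
    exact .inr rfl

/-! ### The ideal of the minimal closures -/

/-- The diagrams `h` connect the ends in all ways in which diagrams can connect them, each with
fewest possible crossings and without closed components. -/
def IsMinimalFamily {ι : Type*} (x : List Bool) (h : ι → List Slice) : Prop :=
  (∀ k, Runs (h k) x [] ∧ loops (h k) = 0) ∧ ∀ H, Runs H x [] → ∃ k,
    (∀ j < x.length, partner H j = partner (h k) j) ∧ crossings (h k) ≤ crossings H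

/-- Induction on the crossings of `H` makes membership invariant under crossing changes in `H`.
These turn `H` into a diagram isotopic to a crossing-changed member of the family, or split off a
circle. -/
theorem alexanderConway_mem_span {ι : Type*} {x : List Bool} (hx : x ≠ []) (T : Diagram [] x)
    (h : ι → Diagram x []) (hh : IsMinimalFamily x fun k => (h k).1) (H : Diagram x [])
    {f : OrientedLink → Polynomial ℤ} (hf : IsAlexanderConway f) :
    f (T.comp H).toTangle ∈ Ideal.span (Set.range fun k => f (T.comp (h k)).toTangle) := by
  set I := Ideal.span (Set.range fun k => f (T.comp (h k)).toTangle)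
  suffices key : ∀ n, ∀ H : Diagram x [], crossings H.1 = n → f (T.comp H).toTangle ∈ I from
    key _ H rfl
  intro n
  induction n using Nat.strong_induction_on with
  | _ n IH =>
  let Q : List Slice → Prop := fun w =>
    ∀ hw : Runs w x [], f (T.comp ⟨w, hw⟩).toTangle ∈ I
  -- The two closures differ by `X` times the closure of a smoothing, which has fewer than `n`
  -- crossings outside `T`.
  have hQ : ∀ w w', Runs w x [] → crossings w ≤ n → shadow w' = shadow w → Q w → Q w' := by
    intro w w' hw hn hs
    refine shadow_induction ?_ hs
    intro u v i s hs hQ hw'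
    have hr := (runs_iff_of_shadow hs x []).2 hw
    obtain ⟨y, hu, hv⟩ := (runs_append_iff _ _ _ _).1 hr
    obtain ⟨m, hm1, hm2, hm3⟩ := exists_skein (T.2.append hu) hv
    have hcr := crossings_eq_of_shadow hs
    rw [crossings_append] at hcr
    simp only [crossings] at hcr
    have hZ := IH (crossings (u ++ (m ++ v)))
      (by rw [crossings_append, crossings_append]; omega) ⟨_, hu.append hm2⟩ rfl
    simp only [List.append_assoc] at hm3
    have hA := hQ hr
    rcases hm3.sub_eq (T.comp ⟨_, hr⟩).2 (T.comp ⟨_, hw'⟩).2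
      (T.comp ⟨_, hu.append hm2⟩).2 hf with h1 | h1
    · have := I.sub_mem hA (I.mul_mem_left Polynomial.X hZ)
      change f (T.comp ⟨_, hr⟩).toTangle - f (T.comp ⟨_, hw'⟩).toTangle =
        Polynomial.X * f (T.comp ⟨_, hu.append hm2⟩).toTangle at h1
      rwa [← h1, sub_sub_cancel] at this
    · have := I.add_mem hA (I.mul_mem_left Polynomial.X hZ)
      convert this using 1
      exact eq_add_of_sub_eq' h1
  intro H hH
  -- There must be something besides the split circle: a circle alone has the value `1`, not `0`.
  have hTne : ∀ v, Runs v x [] → T.1 ++ v ≠ [] := by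
    intro v hv h0
    have : T.1 = [] := by simp_all
    have hT := T.2
    rw [this, runs_iff] at hT
    exact hx (by simpa [run, eq_comm] using hT)
  by_cases hl : loops H.1 = 0
  · obtain ⟨k, hk1, hk2⟩ := hh.2 H.1 H.2
    have hk2 : crossings (h k).1 ≤ crossings H.1 := hk2
    obtain ⟨w₁, w₁', h1, h2, h3⟩ := exists_iso_of_partner_eq x _ _ H.2 (h k).2 hl (hh.1 k).2 hk1
    have hk : Q (h k).1 := fun _ => Ideal.subset_span ⟨k, rfl⟩
    -- Here the minimality of the family enters: its member has at most `n` crossings, so its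
    -- crossings may be changed as well.
    have hw' : Q w₁' := hQ _ _ (h k).2 (by omega) h2 hk
    have hw : Q w₁ := by
      intro hr
      have := hw' h3.2.1
      rwa [Iso.toTangle_eq (D := T.comp ⟨w₁, hr⟩) (E := T.comp ⟨w₁', h3.2.1⟩)
        ((Iso.refl T.2).append h3)]
    exact hQ w₁ H.1 h3.1 (by rw [crossings_eq_of_shadow h1]; omega) h1.symm hw H.2
  · obtain ⟨w₁, v, h1, h2⟩ := exists_iso_circle x H.1 H.2 (by omega)
    obtain ⟨y, hy, hc⟩ := (runs_append_iff _ _ _ _).1 h2.2.1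
    obtain rfl : y = [] := by
      match y with
      | [] => rfl
      | [_] => rw [runs_iff] at hc; simp [circle, run, stepAt] at hc
      | _ :: _ :: _ => rw [runs_iff] at hc; simp [circle, run, stepAt] at hc
    have hw : Q w₁ := by
      intro hr
      -- The two crossings of a kink give the same link, so `X` times the polynomial of the split
      -- link is `0`.
      have hs := skein_circle (T.2.append hy) (hTne v hy)
      have h3 := hs.sub_eq (T.2.append hy) (T.2.append hy) ((T.2.append hy).append hc) hf
      rw [or_self, sub_self, eq_comm, mul_eq_zero, or_iff_right Polynomial.X_ne_zero] at h3
      have h4 : Iso [] [] (T.1 ++ w₁) (T.1 ++ v ++ circle) := by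
        simpa using (Iso.refl T.2).append h2
      rw [Iso.toTangle_eq (D := T.comp ⟨w₁, hr⟩) (E := ⟨_, (T.2.append hy).append hc⟩) h4, h3]
      exact I.zero_mem
    exact hQ w₁ H.1 h2.1 (by rw [crossings_eq_of_shadow h1]; omega) h1.symm hw H.2

end PlanarTangle

/-! ### Links that contain a tangle are closures of it -/

namespace PlanarTangle

theorem Step.shift {g : Slice} {a b : List Bool} (h : Step g a b) (l r : List Bool) :
    Step (g.1 + l.length, g.2) (l ++ a ++ r) (l ++ b ++ r) := by
  cases h with
  | cup l' r' c =>
    simpa [Nat.add_comm] using Step.cup (l ++ l') (r' ++ r) c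
  | cap l' r' c =>
    simpa [Nat.add_comm] using Step.cap (l ++ l') (r' ++ r) c
  | cross l' r' c d s =>
    simpa [Nat.add_comm] using Step.cross (l ++ l') (r' ++ r) c d s

theorem Runs.shift {w : List Slice} {a b : List Bool} (h : Runs w a b) (l r : List Bool) :
    Runs (PlanarTangle.shift l.length w) (l ++ a ++ r) (l ++ b ++ r) := by
  induction h with
  | nil => exact .nil _
  | cons hg _ ih => exact .cons (hg.shift l r) ih

theorem runs_overRight (l : List Bool) (c : Bool) (y r : List Bool) :
    Runs (overRight l.length y.length) (l ++ c :: (y ++ r)) (l ++ y ++ c :: r) := by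
  induction y generalizing l with
  | nil => simpa [overRight] using Runs.nil _
  | cons a y ih =>
    refine .cons (.cross l (y ++ r) c a true) ?_
    simpa using ih (l ++ [a])

theorem runs_overLeft (l : List Bool) (c : Bool) (y r : List Bool) :
    Runs (overLeft l.length y.length) (l ++ y ++ c :: r) (l ++ c :: (y ++ r)) := by
  induction y generalizing l with
  | nil => simpa [overLeft] using Runs.nil _
  | cons a y ih =>
    have := ih (l ++ [a])
    simp only [List.length_append, List.length_cons, List.length_nil, List.append_assoc,
      List.cons_append, List.nil_append] at this
    rw [List.length_cons, overLeft_succ']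
    simpa using this.append (.cons (.cross l (y ++ r) a c false) (.nil _))

/-- A strand to the left of a whole diagram passes over it slice by slice, from the top to the
bottom. -/
theorem red_shift_overRight {w : List Slice} {x y : List Bool} (h : Runs w x y) (k : ℕ) :
    Red (shift (k + 1) w ++ overRight k y.length) (overRight k x.length ++ shift k w) := by
  induction h with
  | nil x => exact .of_eq (by simp)
  | @cons g w x y z hg hw ih =>
    obtain ⟨i, p⟩ := g
    obtain ⟨h1, h2⟩ := hg.length_eq
    simp only at h1 h2
    have hm := red_overRight_middle k i (x.length - (i + p.lower)) p
    rw [show i + p.upper + (x.length - (i + p.lower)) = y.length by omega,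
      show i + p.lower + (x.length - (i + p.lower)) = x.length by omega] at hm
    calc
      Red (shift (k + 1) ((i, p) :: w) ++ overRight k z.length)
          ((i + (k + 1), p) :: (shift (k + 1) w ++ overRight k z.length)) := .of_eq (by simp)
      Red _ ((i + (k + 1), p) :: (overRight k y.length ++ shift k w)) := ih.cons _
      Red _ (((k + i + 1, p) :: overRight k y.length) ++ shift k w) :=
        .of_eq (by simp; omega)
      Red _ ((overRight k x.length ++ [(k + i, p)]) ++ shift k w) := hm.append_right _
      Red _ (overRight k x.length ++ shift k ((i, p) :: w)) := .of_eq (by simp [Nat.add_comm])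

theorem red_slide_right {w : List Slice} {x y : List Bool} (h : Runs w x y) (i : ℕ) (p : Piece) :
    Red ((i + x.length, p) :: w) (w ++ [(i + y.length, p)]) := by
  induction h with
  | nil x => exact .refl _
  | @cons g w x y z hg hw ih =>
    obtain ⟨j, r⟩ := g
    obtain ⟨h1, h2⟩ := hg.length_eq
    simp only at h1 h2
    have hi : Red [(i + x.length, p), (j, r)] [(j, r), (i + y.length, p)] :=
      red_interchange' _ (by omega) (by omega)
    exact (hi.append_right w).trans (ih.cons _)

/-- A diagram without lower ends at the left edge can be slid down past everything below it, which
is thereby displaced to the right by its upper ends. -/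
theorem red_append_closed {T : List Slice} {ε : List Bool} (hT : Runs T [] ε) (u : List Slice) :
    Red (u ++ T) (T ++ shift ε.length u) := by
  induction u with
  | nil => exact .of_eq (by simp)
  | cons g u ih =>
    obtain ⟨i, p⟩ := g
    refine (ih.cons _).trans ?_
    have := (red_slide_right hT i p).append_right (shift ε.length u)
    simpa using this

/-- The strands to the left of `T` are removed one at a time. Above `T` such a strand goes over the
ends of `T` to the right and back. The first passage slides down over `T` and disappears, because
`T` has no lower ends; the passage back becomes part of `m`. -/
theorem exists_iso_shift {T : List Slice} {ε : List Bool} (hT : Runs T [] ε) (k : ℕ)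
    (x y : List Bool) (h : Runs (shift k T) x y) (hk : k ≤ x.length) :
    ∃ m, Iso x y (shift k T) (T ++ m) := by
  induction k generalizing x y with
  | zero =>
    rw [shift_zero] at h ⊢
    exact ⟨[], by simpa using Iso.refl h⟩
  | succ k ih =>
    obtain ⟨l, c, r, rfl, rfl⟩ : ∃ l c r, x = l ++ c :: r ∧ l.length = k :=
      ⟨x.take k, x[k], x.drop (k + 1), by simp, by simp; omega⟩
    obtain rfl : y = l ++ c :: (ε ++ r) := by
      refine runs_unique h ?_
      simpa using hT.shift (l ++ [c]) r
    have h1 : Runs (shift l.length T) (l ++ c :: r) (l ++ ε ++ c :: r) := by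
      simpa using hT.shift l (c :: r)
    obtain ⟨m, hm⟩ := ih _ _ h1 (by simp)
    have hR := runs_overRight l c ε r
    have hL := runs_overLeft l c ε r
    have hred := (red_shift_overRight hT l.length).append_right (overLeft l.length ε.length)
    have hred' := (red_overRight_overLeft l.length ε.length).append_left (shift (l.length + 1) T)
    have hW := (h.append hR).append hL
    have e1 := hred _ _ hW
    have e2 := hred' _ _ (by simpa using hW)
    refine ⟨m ++ overLeft l.length ε.length, ?_⟩
    have e3 := hm.append (Iso.refl hL)
    simp only [List.append_nil, List.append_assoc] at e1 e2 e3
    exact (e2.symm.trans e1).trans e3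

/-- A link in which a tangle embeds is a closure of the tangle. -/
theorem Tangle.Embeds.exists_close {ε : List Bool} {t : Tangle [] ε} {ℓ : OrientedLink}
    (h : t.Embeds ℓ) (hε : ε ≠ []) :
    ∃ (T : Diagram [] ε) (H : Diagram ε []), T.toTangle = t ∧ (T.comp H).toTangle = ℓ := by
  obtain ⟨T, L, k, u, v, rfl, rfl, hL⟩ := h
  have hLr := L.2
  rw [hL] at hLr
  obtain ⟨y, hus, hv⟩ := (runs_append_iff _ _ _ _).1 hLr
  obtain ⟨x, hu, hs⟩ := (runs_append_iff _ _ _ _).1 hus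
  -- As `ε` is nonempty, `T` has a slice, and its position shows that there are `k` strands to its
  -- left.
  have hk : k ≤ x.length := by
    have hT := T.2
    match hT' : T.1 with
    | [] =>
      rw [hT', runs_iff] at hT
      exact absurd (by simpa [run, eq_comm] using hT) hε
    | g :: w =>
      rw [hT'] at hs
      obtain ⟨z, hz, -⟩ := (runs_cons_iff _ _ _ _).1 hs
      have := hz.length_eq.1
      simp only at this
      omega
  obtain ⟨m, hm⟩ := exists_iso_shift T.2 k x y hs hk
  have e1 : Iso [] [] L.1 ((u ++ (T.1 ++ m)) ++ v) := by
    rw [hL]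
    exact ((Iso.refl hu).append hm).append (.refl hv)
  rw [show u ++ (T.1 ++ m) ++ v = u ++ T.1 ++ (m ++ v) by simp] at e1
  have e2 := e1.trans (((red_append_closed T.2 u).append_right (m ++ v)).trans
    (.of_eq (List.append_assoc _ _ _)) _ _ e1.2.1)
  obtain ⟨z, hz, hH⟩ := (runs_append_iff _ _ _ _).1 e2.2.1
  obtain rfl := runs_unique T.2 hz
  exact ⟨T, ⟨_, hH⟩, rfl, (Iso.toTangle_eq e2).symm⟩

end PlanarTangle

/-! ### Existence and number of the minimal closures -/

namespace PlanarTangle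

/-- Inverse of `removePair 0 k`. -/
def insertPair (k j : ℕ) : ℕ := if j < k then j + 1 else j + 2

theorem removePair_insertPair (k j : ℕ) : removePair 0 k (insertPair k j) = j := by
  unfold removePair insertPair; split_ifs <;> omega

theorem insertPair_removePair {k j : ℕ} (h : j ≠ 0) (h' : j ≠ k + 1) :
    insertPair k (removePair 0 k j) = j := by
  unfold removePair insertPair; split_ifs <;> omega

theorem insertPair_ne (k j : ℕ) : insertPair k j ≠ 0 ∧ insertPair k j ≠ k + 1 := by
  unfold insertPair; split_ifs <;> omega

theorem removePair_lt {k j n : ℕ} (h : j < n + 2) (h0 : j ≠ 0) (h' : j ≠ k + 1) (hk : k ≤ n) :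
    removePair 0 k j < n := by
  unfold removePair; split_ifs <;> omega

theorem insertPair_lt {k j n : ℕ} (h : j < n) : insertPair k j < n + 2 := by
  unfold insertPair; split_ifs <;> omega

theorem getElem?_insertPair {α : Type*} (m r : List α) (a b : α) (j : ℕ) :
    (a :: (m ++ b :: r))[insertPair m.length j]? = (m ++ r)[j]? := by
  unfold insertPair
  split_ifs with h
  · rw [List.getElem?_cons_succ, List.getElem?_append_left h, List.getElem?_append_left h]
  · rw [List.getElem?_cons_succ, List.getElem?_append_right (by omega),
      List.getElem?_append_right (by omega), show j + 1 - m.length = (j - m.length) + 1 by omega,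
      List.getElem?_cons_succ]

theorem runs_pull (c : Bool) (m r : List Bool) :
    Runs (pull 0 m.length) (c :: (m ++ (!c) :: r)) (m ++ r) := by
  have h1 : Runs (overRight 0 m.length) (c :: (m ++ (!c) :: r)) (m ++ c :: (!c) :: r) :=
    runs_overRight [] c m ((!c) :: r)
  exact h1.append (.cons (by simpa using Step.cap m r c) (.nil _))

/-- Every direction-reversing pairing of the ends is realized by a diagram. -/
theorem exists_runs_of_pairing (x : List Bool) (π : ℕ → ℕ)
    (hπ : ∀ j < x.length, π j < x.length ∧ π j ≠ j ∧ π (π j) = j ∧ x[π j]? = (x[j]?).map not) :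
    ∃ w, Runs w x [] ∧ ∀ j < x.length, partner w j = π j := by
  induction hn : x.length using Nat.strong_induction_on generalizing x π with
  | _ n IH =>
  subst hn
  match x with
  | [] => exact ⟨[], .nil _, by simp⟩
  | c :: x =>
    -- The leftmost end is joined to its partner by `pull`, below a diagram for the remaining ends,
    -- whose pairing is `π` conjugated by the renumbering.
    obtain ⟨h1, h2, h3, h4⟩ := hπ 0 (by simp)
    obtain ⟨k, hk⟩ : ∃ k, π 0 = k + 1 := ⟨π 0 - 1, by omega⟩
    rw [hk] at h1 h3 h4
    simp only [List.length_cons] at h1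
    obtain ⟨m, d, r, rfl, rfl⟩ : ∃ m d r, x = m ++ d :: r ∧ m.length = k :=
      ⟨x.take k, x[k]'(by omega), x.drop (k + 1), by simp, by simp; omega⟩
    obtain rfl : d = !c := by simpa using h4
    have hlen : (c :: (m ++ (!c) :: r)).length = (m ++ r).length + 2 := by simp; omega
    have hm : m.length ≤ (m ++ r).length := by simp
    have hins : ∀ j < (m ++ r).length, π (insertPair m.length j) ≠ 0 ∧
        π (insertPair m.length j) ≠ m.length + 1 := by
      intro j hj
      have hp := hπ (insertPair m.length j) (by rw [hlen]; exact insertPair_lt hj)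
      have hne := insertPair_ne m.length j
      constructor
      · intro h; rw [h, hk] at hp; exact hne.2 hp.2.2.1.symm
      · intro h; rw [h, h3] at hp; exact hne.1 hp.2.2.1.symm
    obtain ⟨w, hw, hp⟩ := IH (m ++ r).length (by omega) (m ++ r)
      (fun j => removePair 0 m.length (π (insertPair m.length j))) (by
        intro j hj
        have hi : insertPair m.length j < (c :: (m ++ (!c) :: r)).length := by
          rw [hlen]; exact insertPair_lt hj
        obtain ⟨p1, p2, p3, p4⟩ := hπ _ hi
        obtain ⟨q1, q2⟩ := hins j hj
        refine ⟨removePair_lt (by omega) q1 q2 hm, ?_, ?_, ?_⟩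
        · intro h
          apply p2
          conv_rhs => rw [← h]
          rw [insertPair_removePair q1 q2]
        · rw [insertPair_removePair q1 q2, p3, removePair_insertPair]
        · rw [← getElem?_insertPair m r c (!c), insertPair_removePair q1 q2, p4,
            getElem?_insertPair]) rfl
    have hrun := (runs_pull c m r).append hw
    have hp0 : partner (pull 0 m.length ++ w) 0 = m.length + 1 := by
      simpa using partner_pull_left 0 m.length w
    refine ⟨_, hrun, ?_⟩
    intro j hj
    by_cases hj0 : j = 0
    · rw [hj0, hk, hp0]
    by_cases hj1 : j = m.length + 1
    · subst hj1
      rw [h3]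
      have := hrun.partner_partner (j := 0) (by simp)
      rwa [hp0] at this
    · obtain ⟨s1, s2, s3⟩ := partner_pull 0 m.length w hj0 (by simpa using hj1)
      have hlt := removePair_lt (by omega) hj0 hj1 hm
      obtain ⟨t1, t2⟩ := hins _ hlt
      rw [hp _ hlt] at s3
      simp only [insertPair_removePair hj0 hj1] at s3 t1 t2
      rw [← insertPair_removePair s1 (by simpa using s2), s3, insertPair_removePair t1 t2]

variable {ε : List Bool}

/-- The pairing of all ends that belongs to a bijection. -/
def EndPairing.perm (σ : EndPairing ε) (j : ℕ) : ℕ :=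
  if h : j < ε.length then
    if h' : ε.get ⟨j, h⟩ = true then (σ ⟨⟨j, h⟩, h'⟩).1
    else (σ.symm ⟨⟨j, h⟩, by simpa using h'⟩).1
  else j

theorem EndPairing.perm_apply (σ : EndPairing ε) (i) : σ.perm (i.1 : ℕ) = (σ i).1 := by
  obtain ⟨⟨i, h⟩, hi⟩ := i
  simp only [perm, dif_pos h, dif_pos hi]

theorem EndPairing.perm_symm_apply (σ : EndPairing ε) (i) :
    σ.perm (i.1 : ℕ) = (σ.symm i).1 := by
  obtain ⟨⟨i, h⟩, hi⟩ := i
  have h' : ¬ ε.get ⟨i, h⟩ = true := by rw [hi]; exact Bool.false_ne_true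
  simp only [perm, dif_pos h, dif_neg h']

theorem EndPairing.perm_spec (σ : EndPairing ε) (j : ℕ) (hj : j < ε.length) :
    σ.perm j < ε.length ∧ σ.perm j ≠ j ∧ σ.perm (σ.perm j) = j ∧
      ε[σ.perm j]? = (ε[j]?).map not := by
  suffices h : σ.perm j < ε.length ∧ σ.perm (σ.perm j) = j ∧
      ε[σ.perm j]? = (ε[j]?).map not by
    refine ⟨h.1, ?_, h.2⟩
    intro h'
    have h2 := h.2.2
    rw [h', List.getElem?_eq_getElem hj] at h2
    simp at h2
  by_cases hb : ε.get ⟨j, hj⟩ = true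
  · have h1 := σ.perm_apply ⟨⟨j, hj⟩, hb⟩
    simp only at h1
    rw [h1, σ.perm_symm_apply]
    have h2 := (σ ⟨⟨j, hj⟩, hb⟩).2
    simp only [List.get_eq_getElem] at h2 hb
    simp [h2, hb, hj]
  · have hb : ε.get ⟨j, hj⟩ = false := by simpa using hb
    have h1 := σ.perm_symm_apply ⟨⟨j, hj⟩, hb⟩
    simp only at h1
    rw [h1, σ.perm_apply]
    have h2 := (σ.symm ⟨⟨j, hj⟩, hb⟩).2
    simp only [List.get_eq_getElem] at h2 hb
    simp [h2, hb, hj]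

theorem connects_iff {σ : EndPairing ε} {H : Diagram ε []} :
    Connects σ H ↔ ∀ j < ε.length, partner H.1 j = σ.perm j := by
  constructor
  · intro h j hj
    by_cases hb : ε.get ⟨j, hj⟩ = true
    · exact (h ⟨⟨j, hj⟩, hb⟩).trans (σ.perm_apply ⟨⟨j, hj⟩, hb⟩).symm
    · have hb : ε.get ⟨j, hj⟩ = false := by simpa using hb
      have h1 := h (σ.symm ⟨⟨j, hj⟩, hb⟩)
      rw [Equiv.apply_symm_apply] at h1
      have h2 := H.2.partner_partner (σ.symm ⟨⟨j, hj⟩, hb⟩).1.2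
      rw [h1] at h2
      exact h2.trans (σ.perm_symm_apply ⟨⟨j, hj⟩, hb⟩).symm
  · intro h i
    rw [h _ i.1.2, σ.perm_apply]

/-- Crossings are minimized first, and closed components among the diagrams that have no more
crossings. By `exists_loops_lt` a closed component could be removed without adding crossings. -/
theorem exists_isMinimalClosure (σ : EndPairing ε) : ∃ H, IsMinimalClosure σ H := by
  obtain ⟨w, hw, hp⟩ := exists_runs_of_pairing ε σ.perm σ.perm_spec
  obtain ⟨H₁, h1, hmin⟩ := exists_minimalFor_of_wellFoundedLT
    (fun H : Diagram ε [] => Connects σ H) (fun H => crossings H.1) ⟨⟨w, hw⟩, connects_iff.2 hp⟩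
  obtain ⟨H, ⟨h2, h3⟩, hmin'⟩ := exists_minimalFor_of_wellFoundedLT
    (fun H : Diagram ε [] => Connects σ H ∧ crossings H.1 ≤ crossings H₁.1)
    (fun H => loops H.1) ⟨H₁, h1, le_rfl⟩
  refine ⟨H, h2, ?_, ?_⟩
  · by_contra hl
    obtain ⟨v, hv, hpv, hcr, hlt⟩ := exists_loops_lt H.1 ε H.2 (by omega)
    have := hmin' (j := ⟨v, hv⟩) ⟨connects_iff.2 fun j hj => (hpv j hj).trans
      (connects_iff.1 h2 j hj), hcr.trans h3⟩ hlt.le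
    exact absurd hlt (not_lt.2 this)
  · intro H' h'
    refine h3.trans ?_
    by_contra hlt
    exact hlt (hmin h' (not_le.1 hlt).le)

/-- The way in which a diagram connects its ends. -/
theorem exists_connects (H : Diagram ε []) : ∃ σ : EndPairing ε, Connects σ H := by
  have hb : ∀ (c : Bool) (j : Fin ε.length), ε.get j = c →
      ε.get ⟨partner H.1 j, H.2.partner_lt j.2⟩ = !c := by
    intro c j hj
    have h1 := H.2.getElem?_partner j.2
    rw [List.getElem?_eq_getElem (H.2.partner_lt j.2), List.getElem?_eq_getElem j.2] at h1
    simpa [← hj] using h1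
  refine ⟨⟨fun i => ⟨⟨partner H.1 i.1, H.2.partner_lt i.1.2⟩, hb true i.1 i.2⟩,
    fun i => ⟨⟨partner H.1 i.1, H.2.partner_lt i.1.2⟩, hb false i.1 i.2⟩, ?_, ?_⟩, ?_⟩
  · intro i; ext; exact H.2.partner_partner i.1.2
  · intro i; ext; exact H.2.partner_partner i.1.2
  · intro i; rfl

/-- One pairing is needed as input: without it the numbers of upward and downward ends could differ,
and then there would be no bijections at all. -/
theorem card_endPairing {n : ℕ} (hε : ε.length = 2 * n) (σ : EndPairing ε) :
    Nat.card (EndPairing ε) = n.factorial := by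
  classical
  have h1 := Fintype.card_congr σ
  have h2 := Fintype.card_congr (Equiv.sumCompl fun i : Fin ε.length => ε.get i = true)
  have h3 : Fintype.card {i : Fin ε.length // ¬ ε.get i = true} =
      Fintype.card {i : Fin ε.length // ε.get i = false} :=
    Fintype.card_congr (Equiv.subtypeEquivRight fun i => by simp)
  rw [Fintype.card_sum, h3, ← h1, Fintype.card_fin] at h2
  rw [Nat.card_eq_fintype_card, Fintype.card_equiv σ]
  congr 1
  omega

theorem isMinimalFamily {ι : Type*} (s : ι → EndPairing ε) (hs : Function.Surjective s)
    (h : ι → Diagram ε []) (hh : ∀ k, IsMinimalClosure (s k) (h k)) :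
    IsMinimalFamily ε fun k => (h k).1 := by
  refine ⟨fun k => ⟨(h k).2, (hh k).noLoops⟩, fun H hH => ?_⟩
  obtain ⟨σ, hσ⟩ := exists_connects ⟨H, hH⟩
  obtain ⟨k, rfl⟩ := hs σ
  refine ⟨k, fun j hj => ?_, (hh k).minimal ⟨H, hH⟩ hσ⟩
  rw [connects_iff.1 (hh k).connects j hj]
  exact connects_iff.1 hσ j hj

/-- Membership in `ℤ[z]` is stronger and is mapped to Laurent polynomials. An arbitrary index type
allows both the family of all pairings and a family of two. -/
theorem nabla_mem_span {ι : Type*} (hε : ε ≠ []) {t : Tangle [] ε} {ℓ : OrientedLink}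
    (ht : t.Embeds ℓ) (s : ι → EndPairing ε) (hs : Function.Surjective s)
    (h : ι → Diagram ε []) (hh : ∀ k, IsMinimalClosure (s k) (h k)) :
    nabla ℓ ∈ Ideal.span (Set.range fun k => nabla (t.close (h k))) := by
  obtain ⟨T, H, rfl, rfl⟩ := ht.exists_close hε
  have h1 := alexanderConway_mem_span hε T h (isMinimalFamily s hs h hh) H
    isAlexanderConway_alexanderConway
  have h2 := Ideal.mem_map_of_mem (Polynomial.toLaurent (R := ℤ)) h1
  rw [Ideal.map_span, ← Set.range_comp] at h2
  exact h2

end PlanarTangle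

theorem corollary5p9 :
    (∃! f : PlanarTangle.OrientedLink → Polynomial ℤ, PlanarTangle.IsAlexanderConway f) ∧
    ∀ (n : ℕ), 0 < n → ∀ (ε : List Bool), ε.length = 2 * n →
      (∀ σ : PlanarTangle.EndPairing ε, ∃ H, PlanarTangle.IsMinimalClosure σ H) ∧
      ∀ (t : PlanarTangle.Tangle [] ε) (ℓ : PlanarTangle.OrientedLink), t.Embeds ℓ →
        Nat.card (PlanarTangle.EndPairing ε) = n.factorial ∧
        (∀ h : PlanarTangle.EndPairing ε → PlanarTangle.Diagram ε [],
          (∀ σ, PlanarTangle.IsMinimalClosure σ (h σ)) →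
          PlanarTangle.nabla ℓ ∈
            Ideal.span (Set.range fun σ => PlanarTangle.nabla (t.close (h σ)))) ∧
        (n = 2 → ∀ (σ₁ σ₂ : PlanarTangle.EndPairing ε) (h₁ h₂ : PlanarTangle.Diagram ε []),
          σ₁ ≠ σ₂ → PlanarTangle.IsMinimalClosure σ₁ h₁ → PlanarTangle.IsMinimalClosure σ₂ h₂ →
          PlanarTangle.nabla ℓ ∈
            Ideal.span {PlanarTangle.nabla (t.close h₁), PlanarTangle.nabla (t.close h₂)}) := by
  refine ⟨PlanarTangle.existsUnique_isAlexanderConway, fun n hn ε hε =>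
    ⟨PlanarTangle.exists_isMinimalClosure, fun t ℓ ht => ?_⟩⟩
  have hε0 : ε ≠ [] := by
    rintro rfl
    simp at hε
    omega
  -- The embedding provides a diagram outside the tangle and hence one pairing, so exactly half of
  -- the ends are incoming.
  obtain ⟨T, H, -, -⟩ := ht.exists_close hε0
  obtain ⟨σ, -⟩ := PlanarTangle.exists_connects H
  have hcard := PlanarTangle.card_endPairing hε σ
  refine ⟨hcard, fun h hh => ?_, ?_⟩
  · exact PlanarTangle.nabla_mem_span hε0 ht id Function.surjective_id h hh
  · rintro rfl σ₁ σ₂ h₁ h₂ hne hm₁ hm₂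
    -- There are exactly `2! = 2` pairings, so two distinct ones are all of them.
    have hs : Function.Surjective fun b : Bool => bif b then σ₁ else σ₂ := by
      intro τ
      obtain ⟨a, b, -, hab⟩ := Nat.card_eq_two_iff.1 hcard
      have hall : ∀ ρ : PlanarTangle.EndPairing ε, ρ = a ∨ ρ = b := by
        intro ρ
        have : ρ ∈ ({a, b} : Set (PlanarTangle.EndPairing ε)) := hab ▸ Set.mem_univ ρ
        simpa using this
      by_cases h1 : τ = σ₁
      · exact ⟨true, h1.symm⟩
      · refine ⟨false, ?_⟩
        rcases hall τ with h | h <;> rcases hall σ₁ with h' | h' <;>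
          rcases hall σ₂ with h'' | h'' <;> simp_all
    have := PlanarTangle.nabla_mem_span hε0 ht _ hs (fun b => bif b then h₁ else h₂) (by
      rintro (_ | _)
      · exact hm₂
      · exact hm₁)
    convert this using 2
    ext p
    simp [or_comm]
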